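/- Let $\mathbf k$ be an algebraically closed field, $\mathfrak h$ a $\mathbf k$-vector space of finite dimension $r$, and $W\subset GL(\mathfrak h)$ a finite group generated by reflections, where a reflection is an involution $s\neq 1$ of the form $s(y)=y-\alpha_s(y)\alpha_s^\vee$ with $\alpha_s\in\mathfrak h^*$, $\alpha_s^\vee\in\mathfrak h$ (for example, a finite Coxeter group and its reflection representation). Let $S$ be the set of reflections of $W$, let $\mathbf c:S\to\mathbf k$ be invariant under conjugation by $W$, and let $\mathfrak h_{\rm reg}=\{h\in\mathfrak h:\alpha_s(h)\ne 0\ \forall s\in S\}$. Let $P_1,\dots,P_r$ be algebraically independent homogeneous generators of $(S\mathfrak h)^W=\mathbf k[\mathfrak h^*]^W$. **Gaudin operators.** Let $H_{0,\mathbf c}$ be the classical rational Cherednik algebra: the quotient of $\mathbf kW\ltimes T(\mathfrak h\oplus\mathfrak h^*)$ by the relations $[x,x']=0$, $[y,y']=0$, $[y,x]=\sum_{s\in S}\mathbf c(s)\,x(y-sy)\,s$ for $x,x'\in\mathfrak h^*$, $y,y'\in\mathfrak h$ (replacing $\mathbf c$ by $-\mathbf c$ gives the other common sign convention). For $\lambda\in\mathfrak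 h^*$ let $M(\lambda)=H_{0,\mathbf c}/\sum_{y\in\mathfrak h}H_{0,\mathbf c}(y-\lambda(y))$, and for $h\in\mathfrak h_{\rm reg}$ let $M(h,\lambda)=M(\lambda)/\sum_{x\in\mathfrak h^*}(x-x(h))M(\lambda)$. For $y\in\mathfrak h$ the Gaudin operator $G_y(\mathbf c,h,\lambda)$ on $M(h,\lambda)$ is the action of the element $y+\sum_{s\in S}\mathbf c(s)\alpha_s(y)\alpha_s^{-1}s$ (of the localization of $H_{0,\mathbf c}$ at $\prod_{s\in S}\alpha_s$), which commutes with $\mathfrak h^*$. On the class $[w]$ of $w\in W$ it reads $$G_y(\mathbf c,h,\lambda)[w]=\lambda(w^{-1}y)[w]+\sum_{s\in S}\mathbf c(s)\frac{\alpha_s(y)}{\alpha_s(h)}[sw].$$ For a basis $(\omega_i^\vee)$ of $\mathfrak h$ put $G_i=G_{\omega_i^\vee}$. **Calogero–Moser hamiltonians.** The classical Dunkl operators are $\Theta(y)=p_y-\sum_{s\in S}\mathbf c(s)\frac{\alpha_s(y)}{\alpha_s}s\in \mathbf kW\ltimes\mathbf k[\mathfrak h_{\rm reg}\times\mathfrak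 h^*]$, $y\in\mathfrak h$, where $p_y(h,\mu)=\mu(y)$. The classical Calogero–Moser hamiltonian $H_k\in\mathbf k[\mathfrak h_{\rm reg}\times\mathfrak h^*]$ corresponding to $P_k$ is the function by which $P_k(\Theta(\cdot))$ acts on $W$-invariant functions; that is, $H_k=\sum_w f_w$ if $P_k(\Theta(\cdot))=\sum_w f_w w$. Write $H_k(\mathbf c,h,\mu)$ for its value at $(h,\mu)$. **Proposition.** For all $h\in\mathfrak h_{\rm reg}$ and $\lambda\in\mathfrak h^*$, $\dim M(h,\lambda)=|W|$, the operators $G_y(\mathbf c,h,\lambda)$, $y\in\mathfrak h$, commute with each other, and their joint spectrum on $M(h,\lambda)$ is the multiset of solutions $\mu\in\mathfrak h^*$ of the equations $$P_k(\lambda)=H_k(\mathbf c,h,\mu),\qquad 1\le k\le r.$$ That is, $\mu$ is a joint eigenvalue ($G_yv=\mu(y)v$ for all $y$, for some $v\neq 0$) if and only if it is a solution, and for every $\mu\in\mathfrak h^*$ the dimension of the joint generalized eigenspace of the $G_y$ with eigenvalues $\mu(y)$ equals the multiplicity of $\mu$ as a solution, i.e. $\dim_{\mathbf k}\mathcal O_{\mathfrak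 h^*,\mu}/(H_k(\mathbf c,h,\cdot)-P_k(\lambda),\ 1\le k\le r)$. For generic $(h,\lambda)$ (where some nonzero polynomial on $\mathfrak h\times\mathfrak h^*$ does not vanish) there are $|W|$ distinct joint eigenvalues, while, if $W\ne 1$, for some special $(h,\lambda)$ some of the solutions coalesce: there is a solution of multiplicity at least $2$. -/

import Mathlib

noncomputable section

namespace Gaudin

open Module
open scoped Classical

section Group

variable {k V : Type*} [Field k] [AddCommGroup V] [Module k V]

/-- `s` is a reflection: an involution `s ≠ 1` of the form `s y = y - α(y) v` with a linear form
`α` (a root of `s`) and a vector `v`. Then `α`, unique up to scaling, cuts out the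
hyperplane fixed by `s`. -/
def IsReflection (s : V ≃ₗ[k] V) : Prop :=
  s ≠ 1 ∧ s * s = 1 ∧ ∃ (α : Dual k V) (v : V), ∀ y, s y = y - α y • v

/-- A chosen root `α_s` of the reflection `s`. All the expressions below in which it occurs are
invariant under rescaling of `α_s`. -/
def root (s : V ≃ₗ[k] V) : Dual k V :=
  if hs : IsReflection s then hs.2.2.choose else 0

theorem root_spec {s : V ≃ₗ[k] V} (hs : IsReflection s) :
    ∃ v : V, ∀ y, s y = y - root s y • v := by
  rw [root, dif_pos hs]
  exact hs.2.2.choose_spec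

/-- The contragredient action on linear forms: `(g ξ)(y) = ξ(g⁻¹ y)`. -/
def coact (g : V ≃ₗ[k] V) (ξ : Dual k V) : Dual k V :=
  ξ ∘ₗ (g⁻¹ : V ≃ₗ[k] V).toLinearMap

variable (W : Subgroup (V ≃ₗ[k] V))

/-- The regular locus `𝔥_reg`: the complement of the reflection hyperplanes of `W`. -/
def regularSet : Set V := {h | ∀ s : W, IsReflection s.1 → s.1 h ≠ h}

theorem IsReflection.conj {s : V ≃ₗ[k] V} (hs : IsReflection s) (g : V ≃ₗ[k] V) :
    IsReflection (g * s * g⁻¹) := by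
  obtain ⟨h1, h2, α, v, h3⟩ := hs
  refine ⟨fun h => h1 ?_, ?_, coact g α, g v, fun y => ?_⟩
  · simpa using h
  · calc g * s * g⁻¹ * (g * s * g⁻¹) = g * (s * s) * g⁻¹ := by group
      _ = 1 := by simp [h2]
  · simp [LinearEquiv.mul_apply, h3, coact]

theorem regularSet_act {h : V} (hh : h ∈ regularSet W) (g : W) : g.1 h ∈ regularSet W := by
  intro s hs he
  have h1 := hs.conj (g⁻¹ : V ≃ₗ[k] V)
  refine hh (g⁻¹ * s * g) (by simpa using h1) ?_
  have : (g.1⁻¹ : V ≃ₗ[k] V) (g.1 h) = h := by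
    rw [← LinearEquiv.mul_apply, inv_mul_cancel]; rfl
  simp [LinearEquiv.mul_apply, he, this]

theorem root_ne_zero {h : V} (hh : h ∈ regularSet W) (s : W) (hs : IsReflection s.1) :
    root s.1 h ≠ 0 := by
  intro h0
  obtain ⟨v, hv⟩ := root_spec hs
  exact hh s hs (by rw [hv, h0]; simp)

/-- The finite set of reflections of `W`. -/
def refls [Fintype W] : Finset W := Finset.univ.filter fun s => IsReflection s.1

end Group

/-! ### The rational Cherednik algebra -/

section Algebra

variable {k V : Type*} [Field k] [AddCommGroup V] [Module k V]

/-- Generators of the rational Cherednik algebra: `x ξ` for `ξ ∈ 𝔥*`, `y v` for `v ∈ 𝔥`,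
`w g` for `g ∈ W`. -/
inductive Gen (W : Subgroup (V ≃ₗ[k] V)) : Type _
  | x (ξ : Dual k V) : Gen W
  | y (v : V) : Gen W
  | w (g : W) : Gen W

variable (W : Subgroup (V ≃ₗ[k] V))

/-- The generators inside the free algebra. -/
abbrev fx (ξ : Dual k V) : FreeAlgebra k (Gen W) := FreeAlgebra.ι k (Gen.x ξ)
/-- The generators inside the free algebra. -/
abbrev fy (v : V) : FreeAlgebra k (Gen W) := FreeAlgebra.ι k (Gen.y v)
/-- The generators inside the free algebra. -/
abbrev fw (g : W) : FreeAlgebra k (Gen W) := FreeAlgebra.ι k (Gen.w g)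

variable [Fintype W]

/-- The defining relations of `H_{t,c}`: those of `kW ⋉ T(𝔥 ⊕ 𝔥*)`, commutativity of `𝔥*` and of
`𝔥`, and `[y, ξ] = t ξ(y) + ∑_s c(s) ξ(y - s y) s`. Note that `ξ(y - s y) = α_s(y) ξ(α_s^∨)`.
The normalization of the sign of `c` is the one for which the Dunkl representation reads
`y ↦ p_y - ∑_s c(s) α_s(y) α_s⁻¹ s`; the opposite one is obtained by replacing `c` by `-c`. -/
inductive Rel (t : k) (c : W → k) : FreeAlgebra k (Gen W) → FreeAlgebra k (Gen W) → Prop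
  | x_add (ξ η : Dual k V) : Rel t c (fx W (ξ + η)) (fx W ξ + fx W η)
  | x_smul (a : k) (ξ : Dual k V) : Rel t c (fx W (a • ξ)) (a • fx W ξ)
  | y_add (u v : V) : Rel t c (fy W (u + v)) (fy W u + fy W v)
  | y_smul (a : k) (v : V) : Rel t c (fy W (a • v)) (a • fy W v)
  | w_one : Rel t c (fw W 1) 1
  | w_mul (g g' : W) : Rel t c (fw W (g * g')) (fw W g * fw W g')
  | w_x (g : W) (ξ : Dual k V) : Rel t c (fw W g * fx W ξ) (fx W (coact g.1 ξ) * fw W g)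
  | w_y (g : W) (v : V) : Rel t c (fw W g * fy W v) (fy W (g.1 v) * fw W g)
  | x_x (ξ η : Dual k V) : Rel t c (fx W ξ * fx W η) (fx W η * fx W ξ)
  | y_y (u v : V) : Rel t c (fy W u * fy W v) (fy W v * fy W u)
  | y_x (v : V) (ξ : Dual k V) : Rel t c (fy W v * fx W ξ)
      (fx W ξ * fy W v + (t * ξ v) • (1 : FreeAlgebra k (Gen W)) +
        ∑ s ∈ refls W, (c s * ξ (v - s.1 v)) • fw W s)

/-- The rational Cherednik algebra `H_{t,c}` attached to `𝔥 = V` and `W`. -/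
abbrev Cherednik (t : k) (c : W → k) : Type _ := RingQuot (Rel W t c)

variable (t : k) (c : W → k)

/-- The image of `ξ ∈ 𝔥*` in `H_{t,c}`. -/
def hx (ξ : Dual k V) : Cherednik W t c := RingQuot.mkAlgHom k (Rel W t c) (fx W ξ)
/-- The image of `v ∈ 𝔥` in `H_{t,c}`. -/
def hy (v : V) : Cherednik W t c := RingQuot.mkAlgHom k (Rel W t c) (fy W v)
/-- The image of `g ∈ W` in `H_{t,c}`. -/
def hw (g : W) : Cherednik W t c := RingQuot.mkAlgHom k (Rel W t c) (fw W g)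

theorem hx_comm (ξ η : Dual k V) : Commute (hx W t c ξ) (hx W t c η) := by
  change hx W t c ξ * hx W t c η = hx W t c η * hx W t c ξ
  simpa [hx] using RingQuot.mkAlgHom_rel k (Rel.x_x (t := t) (c := c) (W := W) ξ η)

theorem hw_hx (g : W) (ξ : Dual k V) :
    hw W t c g * hx W t c ξ = hx W t c (coact g.1 ξ) * hw W t c g := by
  simpa [hx, hw] using RingQuot.mkAlgHom_rel k (Rel.w_x (t := t) (c := c) (W := W) g ξ)

theorem hy_hx (v : V) (ξ : Dual k V) :
    hy W t c v * hx W t c ξ = hx W t c ξ * hy W t c v + (t * ξ v) • (1 : Cherednik W t c) +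
      ∑ s ∈ refls W, (c s * ξ (v - s.1 v)) • hw W t c s := by
  simpa [hx, hw, hy] using RingQuot.mkAlgHom_rel k (Rel.y_x (t := t) (c := c) (W := W) v ξ)

theorem hx_add (ξ η : Dual k V) : hx W t c (ξ + η) = hx W t c ξ + hx W t c η := by
  simpa [hx] using RingQuot.mkAlgHom_rel k (Rel.x_add (t := t) (c := c) (W := W) ξ η)

theorem hx_smul (a : k) (ξ : Dual k V) : hx W t c (a • ξ) = a • hx W t c ξ := by
  simpa [hx] using RingQuot.mkAlgHom_rel k (Rel.x_smul (t := t) (c := c) (W := W) a ξ)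

theorem hx_root_pairwise (A : Finset W) :
    (A : Set W).Pairwise (Function.onFun Commute fun s => hx W t c (root s.1)) :=
  fun _ _ _ _ _ => hx_comm W t c _ _

/-- The product `∏_{s ∈ A} α_s` in `H_{t,c}`. -/
def rootProd (A : Finset W) : Cherednik W t c :=
  A.noncommProd (fun s => hx W t c (root s.1)) (hx_root_pairwise W t c A)

/-- The Whittaker module `M(λ) = H_{t,c} / H_{t,c} (y - λ(y), y ∈ 𝔥)`. -/
abbrev Whittaker (lam : Dual k V) : Type _ :=
  Cherednik W t c ⧸ Submodule.span (Cherednik W t c)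
    (Set.range fun v : V => hy W t c v - algebraMap k (Cherednik W t c) (lam v))

/-- The subspace `(ξ - ξ(h), ξ ∈ 𝔥*) M(λ)` of `M(λ)`. -/
def fiberKer (h : V) (lam : Dual k V) : Submodule k (Whittaker W t c lam) :=
  Submodule.span k {m | ∃ (ξ : Dual k V) (m' : Whittaker W t c lam),
    m = (hx W t c ξ - algebraMap k (Cherednik W t c) (ξ h)) • m'}

/-- The space `M(h,λ) = M(λ) / (ξ - ξ(h), ξ ∈ 𝔥*) M(λ)`, in the classical case `t = 0`. -/
abbrev Fiber (h : V) (lam : Dual k V) : Type _ :=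
  Whittaker W 0 c lam ⧸ fiberKer W 0 c h lam

/-! ### The action of `Θ⁻¹(𝔥)` on the fibers -/

/-- The element `δ Θ⁻¹(p_y) = δ y + ∑_s c(s) α_s(y) (δ / α_s) s` of `H_{0,c}`, where
`δ = ∏_s α_s` over all the reflections `s` of `W`. Here
`Θ⁻¹(p_y) = y + ∑_s c(s) α_s(y) α_s⁻¹ s` is the element of `H_{0,c}[δ⁻¹]` which the Dunkl
representation `Θ` sends to the momentum `p_y`, `y ∈ 𝔥`. -/
def momentum (v : V) : Cherednik W 0 c :=
  rootProd W 0 c (refls W) * hy W 0 c v +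
    ∑ s ∈ refls W, (c s * root s.1 v) • (rootProd W 0 c ((refls W).erase s) * hw W 0 c s)

theorem momentum_comm_hx (v : V) (ξ : Dual k V) :
    Commute (momentum W c v) (hx W 0 c ξ) := by
  have hP : ∀ A : Finset W, Commute (rootProd W 0 c A) (hx W 0 c ξ) := fun A =>
    (Finset.noncommProd_commute A _ _ _ fun s _ => hx_comm W 0 c _ _).symm
  have key : ∀ s ∈ refls W,
      (c s * root s.1 v) • (rootProd W 0 c ((refls W).erase s) * hw W 0 c s) * hx W 0 c ξ =
      hx W 0 c ξ * ((c s * root s.1 v) • (rootProd W 0 c ((refls W).erase s) * hw W 0 c s)) -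
      rootProd W 0 c (refls W) * ((c s * ξ (v - s.1 v)) • hw W 0 c s) := by
    intro s hs
    have hsr : IsReflection s.1 := by simpa [refls] using hs
    obtain ⟨u, hu⟩ := root_spec hsr
    have hinv : (s.1⁻¹ : V ≃ₗ[k] V) = s.1 := inv_eq_of_mul_eq_one_left hsr.2.1
    have hco : coact s.1 ξ = ξ + (-(ξ u)) • root s.1 := by
      ext z
      simp [coact, hinv, hu]
      ring
    have hδ : rootProd W 0 c ((refls W).erase s) * hx W 0 c (root s.1) =
        rootProd W 0 c (refls W) :=
      Finset.noncommProd_erase_mul (refls W) hs (fun s => hx W 0 c (root s.1)) _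
    have hd : ξ (v - s.1 v) = root s.1 v * ξ u := by simp [hu]
    rw [smul_mul_assoc, mul_assoc, hw_hx, hco, hx_add, hx_smul, add_mul, mul_add, smul_mul_assoc,
      mul_smul_comm, ← mul_assoc _ (hx W 0 c (root s.1)), hδ, ← mul_assoc, (hP _).eq, hd,
      mul_smul_comm, mul_smul_comm, smul_add, smul_smul, mul_assoc, sub_eq_add_neg, mul_neg, neg_smul,
      mul_assoc (c s)]
  unfold Commute SemiconjBy momentum
  rw [add_mul, Finset.sum_mul, Finset.sum_congr rfl key, mul_assoc, hy_hx, mul_add, mul_add,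
    Finset.sum_sub_distrib, mul_add, Finset.mul_sum, Finset.mul_sum, ← mul_assoc, (hP _).eq,
    mul_assoc]
  simp

theorem fiberKer_le_comap (h : V) (lam : Dual k V) (v : V) :
    fiberKer W 0 c h lam ≤
      (fiberKer W 0 c h lam).comap (Algebra.lsmul k k (Whittaker W 0 c lam) (momentum W c v)) := by
  refine Submodule.span_le.2 ?_
  rintro _ ⟨ξ, m, rfl⟩
  refine Submodule.subset_span ⟨ξ, momentum W c v • m, ?_⟩
  change momentum W c v • ((hx W 0 c ξ - algebraMap k (Cherednik W 0 c) (ξ h)) • m) = _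
  rw [← mul_smul, ← mul_smul, mul_sub, sub_mul, (momentum_comm_hx W c v ξ).eq,
    (Algebra.commutes (ξ h) (momentum W c v)).symm]

/-- The Gaudin operator `G_y(c,h,λ)`, `y ∈ 𝔥`, for `h ∈ 𝔥_reg`: the action of
`Θ⁻¹(p_y) = δ⁻¹ (δ Θ⁻¹(p_y))` on `M(h,λ)`, where `δ` acts by the nonzero scalar `δ(h)`. -/
def gaudin (h : V) (lam : Dual k V) (v : V) : End k (Fiber W c h lam) :=
  (∏ s ∈ refls W, root s.1 h)⁻¹ •
    (fiberKer W 0 c h lam).mapQ (fiberKer W 0 c h lam)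
      (Algebra.lsmul k k (Whittaker W 0 c lam) (momentum W c v)) (fiberKer_le_comap W c h lam v)

end Algebra

/-! ### Joint spectra -/

section Spectrum

variable {k V E : Type*} [Field k] [AddCommGroup V] [Module k V] [AddCommGroup E] [Module k E]

/-- `μ ∈ 𝔥*` is a joint eigenvalue of the operators `G y`, `y ∈ 𝔥`. -/
def IsJointEigenvalue (G : V → End k E) (μ : Dual k V) : Prop :=
  ∃ e : E, e ≠ 0 ∧ ∀ y, G y e = μ y • e

/-- The multiplicity of `μ` in the joint spectrum of the operators `G y`, `y ∈ 𝔥`: the dimension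
of the joint generalized eigenspace. -/
def spectralMult (G : V → End k E) (μ : Dual k V) : ℕ :=
  finrank k (⨅ y, (G y).maxGenEigenspace (μ y) : Submodule k E)

end Spectrum

/-! ### Invariants and classical Calogero-Moser hamiltonians

Fix a basis `b` of `𝔥`. Then `S𝔥 = k[𝔥*]` is the ring of polynomials in `X i = b i`. -/

section Poly

variable {k V : Type*} [Field k] [AddCommGroup V] [Module k V] {r : ℕ} (b : Basis (Fin r) k V)

/-- The inclusion of `𝔥` in `S𝔥`. -/
def linForm (v : V) : MvPolynomial (Fin r) k := ∑ i, MvPolynomial.C (b.repr v i) * MvPolynomial.X i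

/-- The value of `f ∈ S𝔥 = k[𝔥*]` at a point of `𝔥*`. -/
def evalAt (μ : Dual k V) : MvPolynomial (Fin r) k →ₐ[k] k := MvPolynomial.aeval fun i => μ (b i)

/-- The action of `GL(𝔥)` on `S𝔥` by algebra automorphisms. -/
def polyAct (g : V ≃ₗ[k] V) : MvPolynomial (Fin r) k →ₐ[k] MvPolynomial (Fin r) k :=
  MvPolynomial.aeval fun i => linForm b (g (b i))

variable (W : Subgroup (V ≃ₗ[k] V))

/-- The algebra of invariants `(S𝔥)^W`. -/
def invariants : Subalgebra k (MvPolynomial (Fin r) k) :=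
  ⨅ g : W, AlgHom.equalizer (polyAct b g.1) (AlgHom.id k _)

/-- Functions on `𝔥_reg` with values in `S𝔥 = k[𝔥*]`. They contain `k[𝔥_reg × 𝔥*]`. -/
abbrev PhaseFun (r : ℕ) (W : Subgroup (V ≃ₗ[k] V)) : Type _ :=
  regularSet W → MvPolynomial (Fin r) k

/-- The action of `g ∈ W` on functions on `𝔥_reg × 𝔥*`. -/
def phaseAct (g : W) : End k (PhaseFun r W) where
  toFun f := fun h => polyAct b g.1 (f ⟨g⁻¹.1 h.1, regularSet_act W h.2 g⁻¹⟩)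
  map_add' f f' := by ext1 h; simp
  map_smul' a f := by ext1 h; simp

/-- Multiplication by a function on `𝔥_reg × 𝔥*`. -/
def phaseMul (f : PhaseFun r W) : End k (PhaseFun r W) := LinearMap.mulLeft k f

variable [Fintype W] (c : W → k)

/-- The classical Dunkl operator `Θ(y) = p_y - ∑_s c(s) α_s(y) α_s⁻¹ s`, as an operator on
functions on `𝔥_reg × 𝔥*`; here `p_y` is the function `(h, μ) ↦ μ(y)`. -/
def dunkl (v : V) : End k (PhaseFun r W) :=
  phaseMul W (fun _ => linForm b v) -
    ∑ s ∈ refls W, c s •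
      (phaseMul W (fun h => MvPolynomial.C (root s.1 v / root s.1 h.1)) * phaseAct b W s)

/-- The value of a polynomial at a tuple of elements of an algebra, with the factors of the
monomials in increasing order of the variables (immaterial when the elements commute, as
the Dunkl operators do). -/
def polyEval {A : Type*} [Ring A] [Algebra k A] (D : Fin r → A) (f : MvPolynomial (Fin r) k) : A :=
  ∑ m ∈ f.support, f.coeff m • (List.ofFn fun i => D i ^ m i).prod

/-- The classical Calogero-Moser hamiltonian attached to `f ∈ (S𝔥)^W`. Writing
`f(Θ(b 1), …, Θ(b r)) = ∑_w f_w w` with functions `f_w` on `𝔥_reg × 𝔥*`, it is `∑_w f_w`, the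
function by which this operator acts on invariant functions. It is obtained by applying the
operator to `1`. For `h ∈ 𝔥_reg`, `hamiltonian b W c f h` is the function
`μ ↦ H_f(c, h, μ)` on `𝔥*`. -/
def hamiltonian (f : MvPolynomial (Fin r) k) : PhaseFun r W :=
  polyEval (fun i => dunkl b W c (b i)) f 1

/-- The ideal of the equations `H_j(c,h,μ) = P_j(λ)`, `1 ≤ j ≤ r`, for `μ ∈ 𝔥*`. -/
def equationIdeal (P : Fin r → MvPolynomial (Fin r) k) (h : regularSet W) (lam : Dual k V) :
    Ideal (MvPolynomial (Fin r) k) :=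
  Ideal.span (Set.range fun j =>
    hamiltonian b W c (P j) h - MvPolynomial.C (evalAt b lam (P j)))

/-- The maximal ideal of a point of `𝔥*`. -/
def pointIdeal (μ : Dual k V) : Ideal (MvPolynomial (Fin r) k) := RingHom.ker (evalAt b μ)

instance (μ : Dual k V) : (pointIdeal b μ).IsPrime := RingHom.ker_isPrime _

/-- The multiplicity of `μ` as a solution of the system of equations given by `I`: the dimension
over `k` of the quotient by `I` of the local ring of `𝔥*` at `μ`. -/
def solutionMult (I : Ideal (MvPolynomial (Fin r) k)) (μ : Dual k V) : ℕ :=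
  finrank k (Localization.AtPrime (pointIdeal b μ) ⧸
    I.map (algebraMap (MvPolynomial (Fin r) k) (Localization.AtPrime (pointIdeal b μ))))

end Poly

end Gaudin

end

/-! A Gaudin operator is a matrix on `W → k`: the diagonal matrix `λ(w⁻¹y)` plus the pole part `∑
c(s) ρ_s(y,h) s`, where `ρ_s(y,h) = α_s(y)/α_s(h)` and `s` acts by left translation. Words in `𝔥*`
and `W` span `M(λ)`, so `W → k` maps onto `M(h,λ)`. An inverse comes from letting the Cherednik
algebra act, through Dunkl operators, on functions on `𝔥_reg` with values in `W → k` (`fiberEquiv`,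
`fiberEquiv_gaudin`). In this action `W` acts diagonally and the momentum `p_y` acts by the Gaudin
operator.

On a constant function `δ_u` the pole part of the Gaudin operator cancels that of `Θ(y)`, so `Θ(y)`
acts by the scalar `λ(u⁻¹y)` and an invariant `f(Θ)` by `f(λ)`. On the other hand `f(Θ)` commutes
with functions of position, so only its coefficient at `1` survives, and `f(Θ)` is multiplication by
`H_f`. Comparing the two gives `H_f(h,G) = f(λ)` (`gaudinHom_hamiltonian`); every joint eigenvalue
therefore solves the equations.

For multiplicities let `λ` vary. Put `R = S𝔥` and let `R` act on `U = (W → R)` by the Gaudin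
operators with universal `λ`. Since `p_y` acts diagonally up to terms of lower degree, `U` is free
over `R` of rank `|W|` (`universalGaudinEquiv`). If `I` is the ideal of the equations and `J = (P_j
- P_j(λ))`, then `I` acts on `U` as `J` acts on the coefficients. Hence `(R/I)^|W|` is isomorphic to
`U/IU`, which is the module of functions `W → R/J`. The algebra `R/J` has dimension `|W|`, because
`R` is flat of rank `|W|` over the invariants, by a depth argument (`flat_mvPolynomial`,
`finrank_quotient_generators`). A filtration of `R/J` with one-dimensional steps filters that module
by `|W|` Gaudin modules at points of the orbit of `λ`, all isomorphic to the one at `λ`. Localizing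
at `μ` and cancelling `|W|` gives equality of multiplicities (`spectralMult_eq_solutionMult`);
positivity of the multiplicity of a solution gives the converse for eigenvalues.

Generic simplicity is the nonvanishing of a discriminant: for `λ` scaled suitably, a Gaudin operator
is a separable perturbation of a diagonal matrix with distinct entries. For coalescence, the
Jacobian of the `H_j` in `μ` has the Jacobian of the `P_j` as leading term. If it had no zero it
would be constant, all `P_j` would be linear, and `W` trivial. At a zero `μ` one chooses `λ` with
`P_j(λ) = H_j(μ)`. -/

noncomputable section

namespace Gaudin

open Module
open scoped Classical

section

/-! ### Ratios of roots, and a quadratic identity between reflections with a given product -/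

section Rho

variable {k V : Type*} [Field k] [AddCommGroup V] [Module k V]

/-- The ratio `α_s(y) / α_s(h)`, which does not depend on the choice of the root `α_s`. -/
def rho (s : V ≃ₗ[k] V) (y h : V) : k := root s y / root s h

theorem rho_add (s : V ≃ₗ[k] V) (y z h : V) : rho s (y + z) h = rho s y h + rho s z h := by
  simp [rho, add_div]

theorem rho_sub (s : V ≃ₗ[k] V) (y z h : V) : rho s (y - z) h = rho s y h - rho s z h := by
  simp [rho, sub_div]

theorem rho_smul (s : V ≃ₗ[k] V) (a : k) (y h : V) : rho s (a • y) h = a * rho s y h := by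
  simp [rho, mul_div_assoc]

theorem root_eq_zero_iff {s : V ≃ₗ[k] V} (hs : IsReflection s) (h : V) :
    root s h = 0 ↔ s h = h := by
  obtain ⟨v, hv⟩ := root_spec hs
  refine ⟨fun h0 => by simp [hv, h0], fun h0 => ?_⟩
  by_contra hne
  have hv0 : v = 0 := by
    have : root s h • v = 0 := by rw [← sub_eq_self (a := h), ← hv h, h0]
    simpa [hne] using this
  exact hs.1 (LinearEquiv.ext fun y => by simp [hv, hv0])

/-- The vector `h - s h` replaces the coroot here, so no normalization of the root enters. -/
theorem rho_smul_sub {s : V ≃ₗ[k] V} (hs : IsReflection s) {h : V} (hh : s h ≠ h) (y : V) :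
    rho s y h • (h - s h) = y - s y := by
  obtain ⟨v, hv⟩ := root_spec hs
  have : root s h ≠ 0 := fun h0 => hh ((root_eq_zero_iff hs h).1 h0)
  simp [hv, rho, smul_smul, div_mul_cancel₀ _ this]

theorem eq_of_rho {s : V ≃ₗ[k] V} (hs : IsReflection s) {h : V} (hh : s h ≠ h) (y : V) :
    s y = y - rho s y h • (h - s h) := by
  rw [rho_smul_sub hs hh]; abel

theorem rho_unique {s : V ≃ₗ[k] V} (hs : IsReflection s) {h : V} (hh : s h ≠ h) {y : V} {a : k}
    (ha : a • (h - s h) = y - s y) : rho s y h = a := by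
  rw [← rho_smul_sub hs hh y, ← sub_eq_zero, ← sub_smul] at ha
  have : h - s h ≠ 0 := sub_ne_zero.2 (Ne.symm hh)
  exact (sub_eq_zero.1 ((smul_eq_zero.1 ha).resolve_right this)).symm

theorem rho_conj {s : V ≃ₗ[k] V} (hs : IsReflection s) (g : V ≃ₗ[k] V) {h : V} (hh : s h ≠ h)
    (y : V) : rho (g * s * g⁻¹) (g y) (g h) = rho s y h := by
  have e : ∀ z, (g * s * g⁻¹) (g z) = g (s z) := fun z => by
    rw [LinearEquiv.mul_apply, LinearEquiv.mul_apply, ← LinearEquiv.mul_apply g⁻¹ g,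
      inv_mul_cancel]; rfl
  refine rho_unique (hs.conj g) ?_ ?_
  · rw [e]; exact fun h0 => hh (g.injective h0)
  · rw [e, e, ← map_sub, ← map_sub, ← rho_smul_sub hs hh y, map_smul]

variable (W : Subgroup (V ≃ₗ[k] V)) [Fintype W]

theorem mem_refls {s : W} : s ∈ refls W ↔ IsReflection s.1 := by simp [refls]

theorem refl_mul_self {s : W} (hs : s ∈ refls W) : s * s = 1 :=
  Subtype.ext ((mem_refls W).1 hs).2.1

theorem refl_inv {s : W} (hs : s ∈ refls W) : s⁻¹ = s :=
  inv_eq_of_mul_eq_one_left (refl_mul_self W hs)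

theorem conj_mem_refls {s : W} (hs : s ∈ refls W) (g : W) : g * s * g⁻¹ ∈ refls W := by
  rw [mem_refls] at *
  exact hs.conj g.1

theorem regular_ne {h : V} (hh : h ∈ regularSet W) {s : W} (hs : s ∈ refls W) : s.1 h ≠ h :=
  hh s ((mem_refls W).1 hs)

variable (c : W → k)

/-- The coefficient of the product of the reflections `u`, `s` in a commutator of the
pole parts of Dunkl operators. -/
def wedge (y y' h : V) (p : W × W) : k :=
  c p.1 * c p.2 * (rho p.1.1 y h * rho p.2.1 y' h - rho p.1.1 y' h * rho p.2.1 y h)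

/-- The pairs of reflections with a given product. -/
def reflPairs (w : W) : Finset (W × W) := (refls W ×ˢ refls W).filter fun p => p.1 * p.2 = w

variable {W c} (hc : ∀ g s : W, IsReflection s.1 → c (g * s * g⁻¹) = c s)

/-- The pairs `(u, s)` and `(s, sus⁻¹)` have the same product. Since `z - sus⁻¹z = s(sz - usz)`, the
ratio for `sus⁻¹` is the one for `u` plus a correction proportional to `ρ_s(z)`, and the
antisymmetry of `wedge` removes the correction. -/
theorem wedge_swap (hc : ∀ g s : W, IsReflection s.1 → c (g * s * g⁻¹) = c s)
    {h : V} (hh : h ∈ regularSet W) (y y' : V) {u s : W} (hu : u ∈ refls W)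
    (hs : s ∈ refls W) :
    wedge W c y y' h (s, s * u * s⁻¹) • (h - (s * u * s⁻¹).1 h) =
      -(wedge W c y y' h (u, s) • s.1 (h - u.1 h)) := by
  have hsus := conj_mem_refls W hu s
  have key : ∀ z, rho (s * u * s⁻¹).1 z h • (h - (s * u * s⁻¹).1 h) =
      (rho u.1 z h - rho s.1 z h * rho u.1 (h - s.1 h) h) • s.1 (h - u.1 h) := by
    intro z
    have hz : s.1 z = z - rho s.1 z h • (h - s.1 h) :=
      eq_of_rho ((mem_refls W).1 hs) (regular_ne W hh hs) z
    have hss : ∀ x, s.1 (s.1 x) = x := fun x => by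
      have := congrArg (fun g : W => g.1 x) (refl_mul_self W hs)
      simpa [LinearEquiv.mul_apply] using this
    rw [rho_smul_sub ((mem_refls W).1 hsus) (regular_ne W hh hsus), ← rho_smul, ← rho_sub, ← hz,
      ← map_smul, rho_smul_sub ((mem_refls W).1 hu) (regular_ne W hh hu), refl_inv W hs]
    simp [LinearEquiv.mul_apply, hss]
  have hcu : c (s * u * s⁻¹) = c u := hc s u ((mem_refls W).1 hu)
  have : wedge W c y y' h (s, s * u * s⁻¹) • (h - (s * u * s⁻¹).1 h) =
      (c s * c u * rho s.1 y h) • (rho (s * u * s⁻¹).1 y' h • (h - (s * u * s⁻¹).1 h)) -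
      (c s * c u * rho s.1 y' h) • (rho (s * u * s⁻¹).1 y h • (h - (s * u * s⁻¹).1 h)) := by
    simp only [wedge, hcu]
    module
  rw [this, key, key]
  simp only [wedge]
  module

/-- For `w = us` one has `h - w⁻¹h = (h - sh) + s(h - uh)`. After reindexing by `(u, s) ↦ (s,
sus⁻¹)` the second terms cancel the first ones by `wedge_swap`. The scalar sum therefore vanishes
wherever `w` moves `h`. -/
theorem sum_wedge_smul (hc : ∀ g s : W, IsReflection s.1 → c (g * s * g⁻¹) = c s)
    {h : V} (hh : h ∈ regularSet W) (y y' : V) (w : W) :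
    (∑ p ∈ reflPairs W w, wedge W c y y' h p) • (h - w⁻¹.1 h) = 0 := by
  have h1 : ∀ p ∈ reflPairs W w, wedge W c y y' h p • (h - w⁻¹.1 h) =
      wedge W c y y' h p • (h - p.2.1 h) + wedge W c y y' h p • p.2.1 (h - p.1.1 h) := by
    rintro ⟨u, s⟩ hp
    simp only [reflPairs, Finset.mem_filter, Finset.mem_product] at hp
    obtain ⟨⟨hu, hs⟩, rfl⟩ := hp
    rw [← smul_add, mul_inv_rev, refl_inv W hu, refl_inv W hs]
    simp [LinearEquiv.mul_apply]
  have h2 : ∑ p ∈ reflPairs W w, wedge W c y y' h p • p.2.1 (h - p.1.1 h) =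
      -∑ p ∈ reflPairs W w, wedge W c y y' h p • (h - p.2.1 h) := by
    rw [← Finset.sum_neg_distrib]
    refine Finset.sum_bij' (fun p _ => (p.2, p.2 * p.1 * p.2⁻¹)) (fun p _ => (p.1 * p.2 * p.1⁻¹, p.1))
      ?_ ?_ ?_ ?_ ?_
    · rintro ⟨u, s⟩ hp
      simp only [reflPairs, Finset.mem_filter, Finset.mem_product] at hp ⊢
      obtain ⟨⟨hu, hs⟩, rfl⟩ := hp
      refine ⟨⟨hs, conj_mem_refls W hu s⟩, ?_⟩
      rw [← mul_assoc, ← mul_assoc, refl_mul_self W hs, refl_inv W hs, one_mul]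
    · rintro ⟨u, s⟩ hp
      simp only [reflPairs, Finset.mem_filter, Finset.mem_product] at hp ⊢
      obtain ⟨⟨hu, hs⟩, rfl⟩ := hp
      exact ⟨⟨conj_mem_refls W hs u, hu⟩, by group⟩
    · rintro ⟨u, s⟩ hp
      simp only [reflPairs, Finset.mem_filter, Finset.mem_product] at hp
      obtain ⟨⟨hu, hs⟩, rfl⟩ := hp
      simp only [Prod.mk.injEq, and_true]
      rw [← mul_assoc, ← mul_assoc, refl_mul_self W hs, refl_inv W hs, one_mul, mul_assoc, refl_mul_self W hs, mul_one]
    · rintro ⟨u, s⟩ hp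
      simp only [reflPairs, Finset.mem_filter, Finset.mem_product] at hp
      obtain ⟨⟨hu, hs⟩, rfl⟩ := hp
      simp only [Prod.mk.injEq, true_and]
      rw [← mul_assoc, ← mul_assoc, refl_mul_self W hu, refl_inv W hu, one_mul, mul_assoc, refl_mul_self W hu, mul_one]
    · rintro ⟨u, s⟩ hp
      simp only [reflPairs, Finset.mem_filter, Finset.mem_product] at hp
      rw [wedge_swap hc hh y y' hp.1.1 hp.1.2, neg_neg]
  rw [Finset.sum_smul, Finset.sum_congr rfl h1, Finset.sum_add_distrib, h2, add_neg_cancel]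

end Rho

/-! ### Linear forms, evaluation and the action of `GL(𝔥)` on `S𝔥` -/

section Poly

variable {k V : Type*} [Field k] [AddCommGroup V] [Module k V] {r : ℕ} (b : Basis (Fin r) k V)

theorem linForm_add (u v : V) : linForm b (u + v) = linForm b u + linForm b v := by
  simp [linForm, add_mul, Finset.sum_add_distrib]

theorem linForm_smul (a : k) (v : V) : linForm b (a • v) = a • linForm b v := by
  simp [linForm, MvPolynomial.smul_eq_C_mul, Finset.mul_sum, mul_assoc]

/-- `linForm` as a linear map. -/
def linHom : V →ₗ[k] MvPolynomial (Fin r) k where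
  toFun := linForm b
  map_add' := linForm_add b
  map_smul' := linForm_smul b

@[simp] theorem linHom_apply (v : V) : linHom b v = linForm b v := rfl

theorem linForm_basis (i : Fin r) : linForm b (b i) = MvPolynomial.X i := by
  simp [linForm, Finsupp.single_apply]

theorem linForm_injective : Function.Injective (linForm b) := by
  intro u v h
  refine b.repr.injective (Finsupp.ext fun i => ?_)
  have := congrArg (MvPolynomial.coeff (Finsupp.single i 1)) h
  simpa [linForm, MvPolynomial.coeff_sum, MvPolynomial.coeff_C_mul, MvPolynomial.coeff_X,
    Finsupp.single_left_inj] using this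

/-- An algebra homomorphism from `S𝔥` is determined by a linear map on `𝔥`. -/
theorem aeval_linForm {A : Type*} [CommRing A] [Algebra k A] (l : V →ₗ[k] A) (v : V) :
    MvPolynomial.aeval (fun i => l (b i)) (linForm b v) = l v := by
  conv_rhs => rw [← b.sum_repr v, map_sum]
  simp [linForm, Algebra.smul_def]

theorem algHom_linForm {A : Type*} [Ring A] [Algebra k A] (φ : MvPolynomial (Fin r) k →ₐ[k] A)
    (v : V) : φ (linForm b v) = ∑ i, b.repr v i • φ (MvPolynomial.X i) := by
  simp [linForm, ← MvPolynomial.smul_eq_C_mul]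

theorem algHom_ext_linForm {A : Type*} [Ring A] [Algebra k A]
    {φ ψ : MvPolynomial (Fin r) k →ₐ[k] A} (h : ∀ v, φ (linForm b v) = ψ (linForm b v)) :
    φ = ψ := by
  refine MvPolynomial.algHom_ext fun i => ?_
  rw [← linForm_basis b, h]

@[simp] theorem evalAt_linForm (μ : Dual k V) (v : V) : evalAt b μ (linForm b v) = μ v :=
  aeval_linForm b μ v

@[simp] theorem polyAct_linForm (g : V ≃ₗ[k] V) (v : V) :
    polyAct b g (linForm b v) = linForm b (g v) :=
  aeval_linForm b (linHom b ∘ₗ g.toLinearMap) v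

theorem polyAct_mul (g g' : V ≃ₗ[k] V) : polyAct b (g * g') = (polyAct b g).comp (polyAct b g') :=
  algHom_ext_linForm b fun v => by simp [LinearEquiv.mul_apply]

theorem polyAct_one : polyAct b (1 : V ≃ₗ[k] V) = AlgHom.id k _ :=
  algHom_ext_linForm b fun v => by simp

theorem polyAct_inv_apply (g : V ≃ₗ[k] V) (f : MvPolynomial (Fin r) k) :
    polyAct b g⁻¹ (polyAct b g f) = f := by
  rw [← AlgHom.comp_apply, ← polyAct_mul, inv_mul_cancel, polyAct_one]; rfl

theorem evalAt_polyAct (μ : Dual k V) (g : V ≃ₗ[k] V) (f : MvPolynomial (Fin r) k) :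
    evalAt b μ (polyAct b g f) = evalAt b (μ ∘ₗ g.toLinearMap) f := by
  rw [← AlgHom.comp_apply]
  congr 1
  exact algHom_ext_linForm b fun v => by simp

theorem mem_invariants {W : Subgroup (V ≃ₗ[k] V)} {f : MvPolynomial (Fin r) k} :
    f ∈ invariants b W ↔ ∀ g : W, polyAct b g.1 f = f := by
  simp [invariants, Algebra.mem_iInf, AlgHom.mem_equalizer]

end Poly

/-! ### Polynomials in commuting elements -/

section CommEval

variable {k A : Type*} [Field k] [Ring A] [Algebra k A] {r : ℕ}

open scoped IsMulCommutative in
/-- Evaluation of polynomials at a tuple of commuting elements of an algebra. -/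
def commEval (D : Fin r → A) (hD : ∀ i j, Commute (D i) (D j)) :
    MvPolynomial (Fin r) k →ₐ[k] A :=
  haveI : IsMulCommutative (Algebra.adjoin k (Set.range D)) := Algebra.isMulCommutative_adjoin k (by
    rintro _ ⟨i, rfl⟩ _ ⟨j, rfl⟩
    exact hD i j)
  (Algebra.adjoin k (Set.range D)).val.comp
    (MvPolynomial.aeval (R := k) (S₁ := Algebra.adjoin k (Set.range D))
      fun i => ⟨D i, Algebra.subset_adjoin ⟨i, rfl⟩⟩)

@[simp] theorem commEval_X (D : Fin r → A) (hD : ∀ i j, Commute (D i) (D j)) (i : Fin r) :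
    commEval (k := k) D hD (MvPolynomial.X i) = D i := by
  simp [commEval]

/-- The ordered products of `polyEval` lose their dependence on the order once the values come from
an algebra homomorphism; this links `hamiltonian` to the homomorphism `thetaHom`. -/
theorem polyEval_eq_algHom (φ : MvPolynomial (Fin r) k →ₐ[k] A) (f : MvPolynomial (Fin r) k) :
    polyEval (fun i => φ (MvPolynomial.X i)) f = φ f := by
  conv_rhs => rw [f.as_sum]
  simp only [polyEval, map_sum]
  refine Finset.sum_congr rfl fun m _ => ?_
  rw [MvPolynomial.monomial_eq, ← MvPolynomial.smul_eq_C_mul, map_smul, Finsupp.prod_fintype _ _ (by simp),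
    ← List.prod_ofFn, map_list_prod, List.map_ofFn]
  simp [Function.comp_def]

end CommEval

end

section

/-! ### Rationality along lines, and vanishing extended from the points moved by `w` -/

section LineRat

open MvPolynomial

variable {k V : Type*} [Field k] [AddCommGroup V] [Module k V] {r : ℕ} (b : Basis (Fin r) k V)
  (W : Subgroup (V ≃ₗ[k] V))

theorem phaseAct_apply (g : W) (f : PhaseFun r W) (h : regularSet W) :
    phaseAct b W g f h = polyAct b g.1 (f ⟨g⁻¹.1 h.1, regularSet_act W h.2 g⁻¹⟩) := rfl

theorem phaseAct_mul_apply (g : W) (f f' : PhaseFun r W) :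
    phaseAct b W g (f * f') = phaseAct b W g f * phaseAct b W g f' := by
  funext h; simp [phaseAct_apply]

theorem phaseAct_fun_one (g : W) : phaseAct b W g 1 = 1 := by
  funext h; simp [phaseAct_apply]

theorem phaseAct_mul (g g' : W) : phaseAct b W (g * g') = phaseAct b W g * phaseAct b W g' := by
  ext f h : 2
  simp only [phaseAct_apply, Module.End.mul_apply, Subgroup.coe_mul, polyAct_mul, AlgHom.comp_apply]
  congr 4

theorem phaseAct_one : phaseAct b W 1 = 1 := by
  ext f h : 2
  simp only [phaseAct_apply, Subgroup.coe_one, polyAct_one, AlgHom.id_apply, Module.End.one_apply]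
  congr 2

/-- The action of `W` on functions on `𝔥_reg × 𝔥*`, as a representation. -/
def phaseRep : W →* End k (PhaseFun r W) where
  toFun := phaseAct b W
  map_one' := phaseAct_one b W
  map_mul' := phaseAct_mul b W

/-- Functions on `𝔥_reg` with values in `S𝔥` whose restriction to every line is a rational
function without pole at the points of `𝔥_reg`. -/
def lineRational : Subalgebra k (PhaseFun r W) where
  carrier := {f | ∀ (h : regularSet W) (u : V), ∃ (q : Polynomial k)
    (p : Polynomial (MvPolynomial (Fin r) k)), q.eval 0 ≠ 0 ∧
    ∀ (t : k) (ht : h.1 + t • u ∈ regularSet W), C (q.eval t) * f ⟨_, ht⟩ = p.eval (C t)}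
  mul_mem' := by
    intro f f' hf hf' h u
    obtain ⟨q, p, h1, h2⟩ := hf h u
    obtain ⟨q', p', h1', h2'⟩ := hf' h u
    refine ⟨q * q', p * p', by simp [h1, h1'], fun t ht => ?_⟩
    rw [Polynomial.eval_mul, Polynomial.eval_mul, ← h2 t ht, ← h2' t ht, map_mul, Pi.mul_apply]
    ring
  add_mem' := by
    intro f f' hf hf' h u
    obtain ⟨q, p, h1, h2⟩ := hf h u
    obtain ⟨q', p', h1', h2'⟩ := hf' h u
    refine ⟨q * q', q'.map C * p + q.map C * p', by simp [h1, h1'], fun t ht => ?_⟩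
    rw [Polynomial.eval_add, Polynomial.eval_mul, Polynomial.eval_mul, Polynomial.eval_mul, ← h2 t ht,
      ← h2' t ht, map_mul, Pi.add_apply, Polynomial.eval_map, Polynomial.eval₂_hom,
      Polynomial.eval_map, Polynomial.eval₂_hom]
    ring
  algebraMap_mem' := fun a h u => ⟨1, Polynomial.C (C a), by simp, fun t ht => by
    simp [MvPolynomial.algebraMap_eq]⟩

theorem const_mem_lineRational (f : MvPolynomial (Fin r) k) :
    (fun _ => f : PhaseFun r W) ∈ lineRational W :=
  fun h u => ⟨1, Polynomial.C f, by simp, fun t ht => by simp⟩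

theorem rho_mem_lineRational {s : W} (hs : IsReflection s.1) (y : V) :
    (fun h => C (rho s.1 y h.1) : PhaseFun r W) ∈ lineRational W := by
  intro h u
  refine ⟨Polynomial.C (root s.1 h.1) + Polynomial.X * Polynomial.C (root s.1 u),
    Polynomial.C (C (root s.1 y)), by simpa using root_ne_zero W h.2 s hs, fun t ht => ?_⟩
  have := root_ne_zero W ht s hs
  simp only [map_add, map_smul, smul_eq_mul] at this
  simp only [rho, Polynomial.eval_add, Polynomial.eval_C, Polynomial.eval_mul, Polynomial.eval_X,
    map_add (root s.1), map_smul, smul_eq_mul]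
  rw [← map_mul C, mul_div_cancel₀ _ this]

theorem phaseAct_mem_lineRational (g : W) {f : PhaseFun r W} (hf : f ∈ lineRational W) :
    phaseAct b W g f ∈ lineRational W := by
  intro h u
  obtain ⟨q, p, h1, h2⟩ := hf ⟨g⁻¹.1 h.1, regularSet_act W h.2 g⁻¹⟩ (g⁻¹.1 u)
  refine ⟨q, p.map (polyAct b g.1).toRingHom, h1, fun t ht => ?_⟩
  have e : g⁻¹.1 h.1 + t • g⁻¹.1 u = g⁻¹.1 (h.1 + t • u) := by simp
  have ht' : g⁻¹.1 h.1 + t • g⁻¹.1 u ∈ regularSet W := e ▸ regularSet_act W ht g⁻¹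
  have := congrArg (polyAct b g.1) (h2 t ht')
  have hC : ∀ a, polyAct b g.1 (C a) = C a := fun a => (polyAct b g.1).commutes a
  rw [map_mul, hC] at this
  rw [phaseAct_apply]
  simp only [← e]
  rw [this]
  conv_rhs => rw [← hC t]
  exact (Polynomial.eval_map_apply (f := (polyAct b g.1).toRingHom) (C t)).symm

variable [Fintype W] [Infinite k]

/-- A rational function on `𝔥_reg` which vanishes at the points not fixed by `w ≠ 1` is `0`. -/
theorem lineRational_eq_zero {w : W} (hw : w ≠ 1) {f : PhaseFun r W} (hf : f ∈ lineRational W)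
    (h0 : ∀ h : regularSet W, w.1 h.1 ≠ h.1 → f h = 0) : f = 0 := by
  funext h
  by_cases hh : w.1 h.1 = h.1
  swap
  · exact h0 h hh
  -- The value at a fixed point `h` is reached along a line through `h` whose other points are moved
  -- by `w`.
  obtain ⟨u, hu⟩ : ∃ u, w.1 u ≠ u := by
    by_contra! H
    exact hw (Subtype.ext (LinearEquiv.ext H))
  obtain ⟨q, p, h1, h2⟩ := hf h u
  -- `Q(t) ≠ 0` means that `t ≠ 0`, so that `w` moves `h + tu`, and that `h + tu` lies on no
  -- reflection hyperplane. The numerator `p` vanishes at all these `t`, hence is `0`, and `q(0) ≠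
  -- 0` gives the value at `h`.
  let Q : Polynomial k := Polynomial.X * ∏ s ∈ refls W,
    (Polynomial.C (root s.1 h.1) + Polynomial.X * Polynomial.C (root s.1 u))
  have hQ : Q ≠ 0 := by
    refine mul_ne_zero Polynomial.X_ne_zero (Finset.prod_ne_zero_iff.2 fun s hs e => ?_)
    have := congrArg (Polynomial.eval 0) e
    exact root_ne_zero W h.2 s ((mem_refls W).1 hs) (by simpa using this)
  have hp : p = 0 := by
    refine Polynomial.eq_zero_of_infinite_isRoot p ?_
    have hinf : ({t | Q.eval t ≠ 0} : Set k).Infinite := by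
      have : ({t | Q.eval t ≠ 0} : Set k) = {t | Q.IsRoot t}ᶜ := rfl
      rw [this]
      exact (Polynomial.finite_setOfPred_isRoot hQ).infinite_compl
    refine (hinf.image (f := (C : k →+* MvPolynomial (Fin r) k)) (C_injective _ _).injOn).mono ?_
    rintro _ ⟨t, ht, rfl⟩
    simp only [Q, Polynomial.eval_mul, Polynomial.eval_X, Polynomial.eval_prod, Set.mem_ofPred_eq,
      mul_ne_zero_iff, Finset.prod_ne_zero_iff, Polynomial.eval_add, Polynomial.eval_C] at ht
    have hreg : h.1 + t • u ∈ regularSet W := fun s hs => by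
      rw [Ne, ← root_eq_zero_iff hs]
      simpa using ht.2 s ((mem_refls W).2 hs)
    have hne : w.1 (h.1 + t • u) ≠ h.1 + t • u := by
      simp [hh, ht.1, hu]
    simp only [Set.mem_ofPred_eq, Polynomial.IsRoot]
    rw [← h2 t hreg, h0 ⟨_, hreg⟩ hne, mul_zero]
  have := h2 0 (by simp)
  simp only [hp, Polynomial.eval_zero, zero_smul, add_zero] at this
  simpa [h1] using this

variable {W} {c : W → k}

/-- For `w = 1` the pairs are `(s, s)` and each term is `0` by antisymmetry. Otherwise
`sum_wedge_smul` covers the points moved by `w`, and rationality along lines covers the rest. -/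
theorem sum_wedge (_b : Basis (Fin r) k V) (hc : ∀ g s : W, IsReflection s.1 → c (g * s * g⁻¹) = c s)
    {h : V} (hh : h ∈ regularSet W) (y y' : V) (w : W) :
    ∑ p ∈ reflPairs W w, wedge W c y y' h p = 0 := by
  by_cases hw : w = 1
  · refine Finset.sum_eq_zero ?_
    rintro ⟨u, s⟩ hp
    simp only [reflPairs, Finset.mem_filter, Finset.mem_product] at hp
    have : s = u := by
      rw [← inv_eq_of_mul_eq_one_right (hp.2.trans hw), refl_inv W hp.1.1]
    subst this
    simp only [wedge]
    ring
  let f : PhaseFun r W := ∑ p ∈ reflPairs W w, (algebraMap k _ (c p.1 * c p.2) *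
    ((fun h => C (rho p.1.1 y h.1)) * (fun h => C (rho p.2.1 y' h.1)) -
    (fun h => C (rho p.1.1 y' h.1)) * (fun h => C (rho p.2.1 y h.1))))
  have hf : f ∈ lineRational W := by
    refine Subalgebra.sum_mem _ fun p hp => ?_
    simp only [reflPairs, Finset.mem_filter, Finset.mem_product, mem_refls] at hp
    exact Subalgebra.mul_mem _ (Subalgebra.algebraMap_mem _ _) (Subalgebra.sub_mem _
      (Subalgebra.mul_mem _ (rho_mem_lineRational W hp.1.1 _) (rho_mem_lineRational W hp.1.2 _))
      (Subalgebra.mul_mem _ (rho_mem_lineRational W hp.1.1 _) (rho_mem_lineRational W hp.1.2 _)))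
  have hfe : ∀ h : regularSet W, f h = C (∑ p ∈ reflPairs W w, wedge W c y y' h.1 p) := by
    intro h
    simp [f, wedge, MvPolynomial.algebraMap_eq]
  have := congrFun (lineRational_eq_zero W hw hf fun h hne => ?_) ⟨h, hh⟩
  · rw [hfe] at this
    exact (C_injective (Fin r) k) (this.trans (map_zero _).symm)
  · rw [hfe, (smul_eq_zero.1 (sum_wedge_smul hc h.2 y y' w)).resolve_right, map_zero]
    intro e
    refine hne ?_
    have := congrArg w.1 (sub_eq_zero.1 e)
    rw [this, ← LinearEquiv.mul_apply]
    simp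

theorem sum_wedge_apply (b : Basis (Fin r) k V)
    (hc : ∀ g s : W, IsReflection s.1 → c (g * s * g⁻¹) = c s)
    {h : V} (hh : h ∈ regularSet W) (y y' : V) {X : Type*} [AddCommGroup X] [Module k X]
    (φ : W → X) :
    ∑ p ∈ refls W ×ˢ refls W, wedge W c y y' h p • φ (p.1 * p.2) = 0 := by
  rw [← Finset.sum_fiberwise (refls W ×ˢ refls W) (fun p => p.1 * p.2)]
  refine Finset.sum_eq_zero fun w _ => ?_
  rw [Finset.sum_congr rfl (g := fun p => wedge W c y y' h p • φ w), ← Finset.sum_smul]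
  · have := sum_wedge b hc hh y y' w
    rw [reflPairs] at this
    rw [this, zero_smul]
  · intro p hp
    rw [(Finset.mem_filter.1 hp).2]

end LineRat

end

section

/-! ### Dunkl operators in an arbitrary representation of the crossed product -/

section CovRep

open MvPolynomial

variable {k V : Type*} [Field k] [AddCommGroup V] [Module k V] {r : ℕ} (b : Basis (Fin r) k V)
  (W : Subgroup (V ≃ₗ[k] V))

/-- The function `p_y` on phase space. -/
def momFun (y : V) : PhaseFun r W := fun _ => linForm b y

/-- The linear function `ξ ∈ 𝔥*` on phase space. -/
def posFun (ξ : Dual k V) : PhaseFun r W := fun h => C (ξ h.1)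

/-- The function `α_s(y) / α_s` on phase space. -/
def rhoFun (s : W) (y : V) : PhaseFun r W := fun h => C (rho s.1 y h.1)

variable {W}

theorem phaseAct_momFun (g : W) (y : V) : phaseAct b W g (momFun b W y) = momFun b W (g.1 y) := by
  funext h
  simp [phaseAct_apply, momFun]

theorem polyAct_C (g : V ≃ₗ[k] V) (a : k) : polyAct b g (C a) = C a := (polyAct b g).commutes a

theorem phaseAct_posFun (g : W) (ξ : Dual k V) :
    phaseAct b W g (posFun W ξ) = posFun W (coact g.1 ξ) := by
  funext h
  simp [phaseAct_apply, posFun, coact]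

theorem rho_conj_refl {s : W} (hs : IsReflection s.1) (g : W) {h : V} (hh : h ∈ regularSet W)
    (y : V) : rho (g * s * g⁻¹).1 (g.1 y) h = rho s.1 y (g⁻¹.1 h) := by
  have h1 : s.1 (g⁻¹.1 h) ≠ g⁻¹.1 h := regularSet_act W hh g⁻¹ s hs
  have := rho_conj hs g.1 h1 y
  rw [← this, ← LinearEquiv.mul_apply g.1]
  simp

theorem phaseAct_rhoFun {s : W} (hs : IsReflection s.1) (g : W) (y : V) :
    phaseAct b W g (rhoFun W s y) = rhoFun W (g * s * g⁻¹) (g.1 y) := by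
  funext h
  rw [rhoFun, phaseAct_apply, rho_conj_refl hs g h.2, rhoFun, polyAct_C]

variable (W)

/-- A covariant representation of the group `W` and the algebra of functions on phase space:
an algebra with a homomorphism from their crossed product. -/
structure CovRep (A : Type*) [Ring A] [Algebra k A] where
  /-- The action of functions. -/
  mul : PhaseFun r W →ₐ[k] A
  /-- The action of the group. -/
  act : W →* A
  act_mul : ∀ g f, act g * mul f = mul (phaseAct b W g f) * act g

variable {b W} {A : Type*} [Ring A] [Algebra k A] (D : CovRep b W A) [Fintype W] (c : W → k)

/-- The pole part `∑_s c(s) α_s(y) α_s⁻¹ s` of a Dunkl operator. -/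
def CovRep.pole (y : V) : A := ∑ s ∈ refls W, c s • (D.mul (rhoFun W s y) * D.act s)

theorem CovRep.pole_add (y z : V) : D.pole c (y + z) = D.pole c y + D.pole c z := by
  have : ∀ s, rhoFun (r := r) W s (y + z) = rhoFun W s y + rhoFun W s z := fun s => by
    funext h; simp [rhoFun, rho_add]
  simp [CovRep.pole, this, add_mul, Finset.sum_add_distrib]

theorem CovRep.pole_smul (a : k) (y : V) : D.pole c (a • y) = a • D.pole c y := by
  have : ∀ s, rhoFun (r := r) W s (a • y) = a • rhoFun W s y := fun s => by
    funext h; simp [rhoFun, rho_smul, MvPolynomial.smul_eq_C_mul]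
  simp only [CovRep.pole, this, map_smul, smul_mul_assoc, Finset.smul_sum]
  exact Finset.sum_congr rfl fun s _ => smul_comm _ _ _

/-- The Dunkl operator `Θ(y) = p_y - ∑_s c(s) α_s(y) α_s⁻¹ s`. -/
def CovRep.theta : V →ₗ[k] A where
  toFun y := D.mul (momFun b W y) - D.pole c y
  map_add' y z := by
    have : momFun b W (y + z) = momFun b W y + momFun b W z := by
      funext h; simp [momFun, linForm_add]
    rw [this, map_add, D.pole_add]; abel
  map_smul' a y := by
    have : momFun b W (a • y) = a • momFun b W y := by
      funext h; simp [momFun, linForm_smul]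
    rw [this, map_smul, D.pole_smul, RingHom.id_apply, smul_sub]

theorem CovRep.theta_apply (y : V) : D.theta c y = D.mul (momFun b W y) - D.pole c y := rfl

variable {c}

theorem CovRep.act_pole (hc : ∀ g s : W, IsReflection s.1 → c (g * s * g⁻¹) = c s) (g : W) (y : V) :
    D.act g * D.pole c y = D.pole c (g.1 y) * D.act g := by
  simp only [CovRep.pole, Finset.mul_sum, Finset.sum_mul]
  refine Finset.sum_bij' (fun s _ => g * s * g⁻¹) (fun s _ => g⁻¹ * s * g)
    (fun s hs => conj_mem_refls W hs g)
    (fun s hs => by simpa using conj_mem_refls W hs g⁻¹) (fun s _ => by group) (fun s _ => by group)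
    fun s hs => ?_
  have hs' := (mem_refls W).1 hs
  rw [hc g s hs', mul_smul_comm, smul_mul_assoc, ← mul_assoc, D.act_mul, phaseAct_rhoFun b hs',
    mul_assoc (D.mul _), mul_assoc (D.mul _), ← map_mul D.act, ← map_mul D.act]
  simp

theorem CovRep.act_theta (hc : ∀ g s : W, IsReflection s.1 → c (g * s * g⁻¹) = c s) (g : W) (y : V) :
    D.act g * D.theta c y = D.theta c (g.1 y) * D.act g := by
  rw [D.theta_apply, D.theta_apply, mul_sub, sub_mul, D.act_mul, phaseAct_momFun, D.act_pole hc]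

omit [Fintype W] in
theorem CovRep.mul_comm' (f f' : PhaseFun r W) : D.mul f * D.mul f' = D.mul f' * D.mul f := by
  rw [← map_mul, mul_comm, map_mul]

/-- Commuting `s` past `ξ` produces `ξ(h) - ξ(sh)`, and `ρ_s(y,h)(h - sh) = y - sy` cancels the
denominator. -/
theorem CovRep.theta_pos (c : W → k) (y : V) (ξ : Dual k V) :
    D.theta c y * D.mul (posFun W ξ) = D.mul (posFun W ξ) * D.theta c y +
      ∑ s ∈ refls W, (c s * ξ (y - s.1 y)) • D.act s := by
  have key : ∀ s ∈ refls W, c s • (D.mul (rhoFun W s y) * D.act s) * D.mul (posFun W ξ) =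
      D.mul (posFun W ξ) * (c s • (D.mul (rhoFun W s y) * D.act s)) -
      (c s * ξ (y - s.1 y)) • D.act s := by
    intro s hs
    have hs' := (mem_refls W).1 hs
    have e : rhoFun (r := r) W s y * posFun W (coact s.1 ξ) = posFun W ξ * rhoFun W s y -
        algebraMap k _ (ξ (y - s.1 y)) := by
      funext h
      have h1 : s.1 h.1 ≠ h.1 := regular_ne W h.2 hs
      have h2 := congrArg ξ (rho_smul_sub hs' h1 y)
      have h3 : (s.1⁻¹ : V ≃ₗ[k] V) = s.1 := inv_eq_of_mul_eq_one_left hs'.2.1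
      simp only [rhoFun, posFun, coact, h3, Pi.mul_apply, Pi.sub_apply, Pi.algebraMap_apply,
        MvPolynomial.algebraMap_eq, LinearMap.comp_apply, LinearEquiv.coe_coe, ← h2, ← map_mul,
        ← map_sub C, map_smul, smul_eq_mul, map_sub ξ]
      congr 1
      ring
    rw [smul_mul_assoc, mul_assoc, D.act_mul, phaseAct_posFun, ← mul_assoc, ← map_mul, e, map_sub,
      sub_mul, map_mul, mul_assoc, smul_sub, mul_smul_comm, AlgHom.commutes, ← Algebra.smul_def,
      smul_smul]
  rw [D.theta_apply, sub_mul, CovRep.pole, Finset.sum_mul, Finset.sum_congr rfl key,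
    Finset.sum_sub_distrib, mul_sub, D.mul_comm', Finset.mul_sum]
  abel

/-- The pair `(u, s)` is renamed `(usu⁻¹, u)`, which keeps the product. The reflection `p.2` then
acts on `y'`, and `p.2 y'` can be expanded by `eq_of_rho`. -/
theorem CovRep.pole_mul_pole (hc : ∀ g s : W, IsReflection s.1 → c (g * s * g⁻¹) = c s) (y y' : V) :
    D.pole c y * D.pole c y' = ∑ p ∈ refls W ×ˢ refls W,
      (c p.1 * c p.2) • (D.mul (rhoFun W p.2 y * rhoFun W p.1 (p.2.1 y')) * D.act (p.1 * p.2)) := by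
  rw [CovRep.pole, CovRep.pole, Finset.sum_mul_sum, ← Finset.sum_product']
  refine Finset.sum_bij' (fun p _ => (p.1 * p.2 * p.1⁻¹, p.1)) (fun p _ => (p.2, p.2 * p.1 * p.2⁻¹))
    (fun p hp => ?_) (fun p hp => ?_) (fun p hp => ?_) (fun p hp => ?_) (fun p hp => ?_)
  all_goals
    rw [Finset.mem_product] at hp
    obtain ⟨u, s⟩ := p
  · exact Finset.mem_product.2 ⟨conj_mem_refls W hp.2 _, hp.1⟩
  · exact Finset.mem_product.2 ⟨hp.2, conj_mem_refls W hp.1 _⟩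
  · have h1 : u * (u * s * u⁻¹) * u⁻¹ = s := by
      rw [refl_inv W hp.1, mul_assoc, mul_assoc, refl_mul_self W hp.1, mul_one, ← mul_assoc,
        refl_mul_self W hp.1, one_mul]
    simp only [h1]
  · have h1 : s * (s * u * s⁻¹) * s⁻¹ = u := by
      rw [refl_inv W hp.2, mul_assoc, mul_assoc, refl_mul_self W hp.2, mul_one, ← mul_assoc,
        refl_mul_self W hp.2, one_mul]
    simp only [h1]
  · have hs' := (mem_refls W).1 hp.2
    have h1 : u * s * u⁻¹ * u = u * s := by group
    simp only
    rw [smul_mul_smul_comm, mul_assoc, ← mul_assoc (D.act u), D.act_mul, phaseAct_rhoFun b hs',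
      map_mul D.mul, h1, map_mul D.act, hc u s hs', mul_comm (c s)]
    simp only [mul_assoc]

variable [Infinite k]

/-- After expansion of `p.2 y'` the terms quadratic in `ρ_{p.2}` are symmetric in `y, y'` and drop
out. The coefficient of each `w` in the commutator is then minus the sum in `sum_wedge`. -/
theorem CovRep.commute_pole (hc : ∀ g s : W, IsReflection s.1 → c (g * s * g⁻¹) = c s) (y y' : V) :
    Commute (D.pole c y) (D.pole c y') := by
  rw [Commute, SemiconjBy, ← sub_eq_zero, D.pole_mul_pole hc, D.pole_mul_pole hc,
    ← Finset.sum_sub_distrib, ← Finset.sum_fiberwise _ (fun p => p.1 * p.2)]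
  refine Finset.sum_eq_zero fun w _ => ?_
  have e : ∑ p ∈ reflPairs W w, (c p.1 * c p.2) •
      (rhoFun W p.2 y * rhoFun W p.1 (p.2.1 y') - rhoFun W p.2 y' * rhoFun W p.1 (p.2.1 y)) =
      (0 : PhaseFun r W) := by
    funext h
    have := sum_wedge b hc h.2 y y' w
    rw [Finset.sum_apply, Pi.zero_apply, ← neg_eq_zero, ← Finset.sum_neg_distrib, ← map_zero C,
      ← this, map_sum]
    refine Finset.sum_congr rfl fun p hp => ?_
    simp only [reflPairs, Finset.mem_filter, Finset.mem_product] at hp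
    have hs' := (mem_refls W).1 hp.1.2
    have hz : ∀ z, p.2.1 z = z - rho p.2.1 z h.1 • (h.1 - p.2.1 h.1) := fun z =>
      eq_of_rho hs' (regular_ne W h.2 hp.1.2) z
    simp only [rhoFun, wedge, Pi.smul_apply, Pi.sub_apply, Pi.mul_apply, MvPolynomial.smul_eq_C_mul,
      ← map_mul, ← map_sub C, ← map_neg C]
    congr 1
    rw [hz y, hz y', rho_sub, rho_sub, rho_smul, rho_smul]
    ring
  calc _ = D.mul (∑ p ∈ reflPairs W w, (c p.1 * c p.2) •
      (rhoFun W p.2 y * rhoFun W p.1 (p.2.1 y') - rhoFun W p.2 y' * rhoFun W p.1 (p.2.1 y))) *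
        D.act w := by
        rw [map_sum, Finset.sum_mul]
        refine Finset.sum_congr rfl fun p hp => ?_
        rw [(Finset.mem_filter.1 hp).2, map_smul, map_sub, smul_mul_assoc, sub_mul, smul_sub]
    _ = 0 := by rw [e, map_zero, zero_mul]

-- The identity `p_y - p_{sy} = ρ_s(y) p_{h - sh}` makes the commutator symmetric in `y` and `y'`,
-- so the cross terms cancel in `commute_theta`.
omit [Infinite k] in
theorem CovRep.mom_mul_pole (y y' : V) :
    D.mul (momFun b W y) * D.pole c y' - D.pole c y' * D.mul (momFun b W y) =
      ∑ s ∈ refls W, c s • (D.mul (rhoFun W s y' * rhoFun W s y *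
        fun h => linForm b (h.1 - s.1 h.1)) * D.act s) := by
  rw [CovRep.pole, Finset.mul_sum, Finset.sum_mul, ← Finset.sum_sub_distrib]
  refine Finset.sum_congr rfl fun s hs => ?_
  have hs' := (mem_refls W).1 hs
  rw [mul_smul_comm, smul_mul_assoc, mul_assoc (D.mul _), D.act_mul, phaseAct_momFun, ← mul_assoc,
    ← mul_assoc, ← map_mul, ← map_mul, ← smul_sub, ← sub_mul, ← map_sub]
  congr 3
  funext h
  have h1 : linForm b (rho s.1 y h.1 • (h.1 - s.1 h.1)) = linForm b (y - s.1 y) :=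
    congrArg _ (rho_smul_sub hs' (regular_ne W h.2 hs) y)
  rw [linForm_smul, MvPolynomial.smul_eq_C_mul, ← linHom_apply b (y - _), map_sub] at h1
  simp only [momFun, rhoFun, Pi.sub_apply, Pi.mul_apply]
  rw [mul_assoc, h1, linHom_apply, linHom_apply]
  ring

theorem CovRep.commute_theta (hc : ∀ g s : W, IsReflection s.1 → c (g * s * g⁻¹) = c s) (y y' : V) :
    Commute (D.theta c y) (D.theta c y') := by
  have h1 := (D.commute_pole hc y y').eq
  have h2 := D.mom_mul_pole (c := c) y y'
  have h3 := D.mom_mul_pole (c := c) y' y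
  have h4 : ∀ s, rhoFun (r := r) W s y' * rhoFun W s y = rhoFun W s y * rhoFun W s y' :=
    fun s => mul_comm _ _
  simp only [h4] at h2
  rw [← h3, sub_eq_iff_eq_add] at h2
  rw [Commute, SemiconjBy, D.theta_apply, D.theta_apply, sub_mul, sub_mul, mul_sub, mul_sub, mul_sub,
    mul_sub, h1, h2, D.mul_comm' (momFun b W y)]
  abel

end CovRep

end

section

section Coroot

variable {k V : Type*} [Field k] [AddCommGroup V] [Module k V]

/-- The coroot of the reflection `s` corresponding to the chosen root. -/
def coroot (s : V ≃ₗ[k] V) : V := if hs : IsReflection s then (root_spec hs).choose else 0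

theorem coroot_spec {s : V ≃ₗ[k] V} (hs : IsReflection s) (y : V) :
    y - s y = root s y • coroot s := by
  have := (root_spec hs).choose_spec y
  rw [coroot, dif_pos hs, sub_eq_iff_eq_add, ← sub_eq_iff_eq_add']
  exact this.symm

theorem coroot_ne_zero {s : V ≃ₗ[k] V} (hs : IsReflection s) : coroot s ≠ 0 := fun h =>
  hs.1 (LinearEquiv.ext fun y => by
    have := coroot_spec hs y
    rw [h, smul_zero, sub_eq_zero] at this
    exact this.symm)

end Coroot

/-! ### Invariants of Dunkl operators commute with functions of position -/

section Central

open MvPolynomial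

variable {k V : Type*} [Field k] [Infinite k] [AddCommGroup V] [Module k V] {r : ℕ}
  {b : Basis (Fin r) k V} {W : Subgroup (V ≃ₗ[k] V)} [Fintype W]
  {A : Type*} [Ring A] [Algebra k A] (D : CovRep b W A) {c : W → k}
  (hc : ∀ g s : W, IsReflection s.1 → c (g * s * g⁻¹) = c s)

/-- Polynomials in Dunkl operators. -/
def CovRep.thetaHom : MvPolynomial (Fin r) k →ₐ[k] A :=
  commEval (fun i => D.theta c (b i)) fun _ _ => D.commute_theta hc _ _

theorem CovRep.thetaHom_linForm (y : V) : D.thetaHom hc (linForm b y) = D.theta c y := by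
  rw [algHom_linForm]
  conv_rhs => rw [← b.sum_repr y, map_sum]
  simp [CovRep.thetaHom]

theorem CovRep.thetaHom_X (i : Fin r) : D.thetaHom hc (X i) = D.theta c (b i) := by
  rw [← linForm_basis b, D.thetaHom_linForm]

/-- The elements `d s` are the divided differences `(f - sf)/α_s^∨`. Their twisted Leibniz rule
matches the commutation rule of a Dunkl operator with `ξ`, so the two statements go through one
induction on `f`. -/
theorem CovRep.exists_divided_difference (f : MvPolynomial (Fin r) k) :
    ∃ d : W → MvPolynomial (Fin r) k,
      (∀ s ∈ refls W, f - polyAct b s.1 f = linForm b (coroot s.1) * d s) ∧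
      ∀ ξ : Dual k V, D.thetaHom hc f * D.mul (posFun W ξ) =
        D.mul (posFun W ξ) * D.thetaHom hc f +
        ∑ s ∈ refls W, (c s * ξ (coroot s.1)) • (D.thetaHom hc (d s) * D.act s) := by
  induction f using MvPolynomial.induction_on with
  | C a =>
    refine ⟨0, fun s _ => by simp, fun ξ => ?_⟩
    rw [← MvPolynomial.algebraMap_eq, AlgHom.commutes]
    simpa using Algebra.commutes a _
  | add p q hp hq =>
    obtain ⟨d, h1, h2⟩ := hp
    obtain ⟨d', h1', h2'⟩ := hq
    refine ⟨d + d', fun s hs => ?_, fun ξ => ?_⟩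
    · rw [Pi.add_apply, mul_add, ← h1 s hs, ← h1' s hs, map_add]; ring
    · simp only [map_add, add_mul, mul_add, h2, h2', Pi.add_apply, smul_add, Finset.sum_add_distrib]
      abel
  | mul_X p i hp =>
    obtain ⟨d, h1, h2⟩ := hp
    refine ⟨fun s => C (root s.1 (b i)) * p + d s * linForm b (s.1 (b i)), fun s hs => ?_,
      fun ξ => ?_⟩
    · have h3 : linForm b (b i) - linForm b (s.1 (b i)) =
          C (root s.1 (b i)) * linForm b (coroot s.1) := by
        rw [← MvPolynomial.smul_eq_C_mul, ← linForm_smul, ← coroot_spec ((mem_refls W).1 hs),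
          ← linHom_apply, ← linHom_apply, ← linHom_apply, map_sub]
      rw [map_mul, ← linForm_basis b, polyAct_linForm]
      calc _ = p * (linForm b (b i) - linForm b (s.1 (b i))) +
            (p - polyAct b s.1 p) * linForm b (s.1 (b i)) := by ring
        _ = _ := by rw [h3, h1 s hs]; ring
    · rw [map_mul, mul_assoc, D.thetaHom_X, D.theta_pos, mul_add, ← mul_assoc, h2, add_mul,
        mul_assoc (D.mul _), Finset.mul_sum, Finset.sum_mul, add_assoc, ← Finset.sum_add_distrib]
      congr 1
      refine Finset.sum_congr rfl fun s hs => ?_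
      rw [coroot_spec ((mem_refls W).1 hs), smul_mul_assoc, mul_assoc, D.act_theta hc,
        ← D.thetaHom_linForm hc, map_add, add_mul, map_mul, map_mul, ← MvPolynomial.algebraMap_eq,
        AlgHom.commutes, mul_smul_comm, ← Algebra.smul_def, smul_add, smul_mul_assoc, smul_smul,
        map_smul, smul_eq_mul, mul_assoc, ← mul_assoc (c s), mul_assoc (c s),
        mul_comm (root s.1 (b i)), mul_assoc, add_comm]

/-- The divided differences of an invariant vanish. -/
theorem CovRep.commute_thetaHom_pos {f : MvPolynomial (Fin r) k} (hf : f ∈ invariants b W)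
    (ξ : Dual k V) : Commute (D.thetaHom hc f) (D.mul (posFun W ξ)) := by
  obtain ⟨d, h1, h2⟩ := D.exists_divided_difference hc f
  rw [Commute, SemiconjBy, h2, Finset.sum_eq_zero, add_zero]
  intro s hs
  have h3 := h1 s hs
  rw [(mem_invariants b).1 hf, sub_self, eq_comm, mul_eq_zero] at h3
  have h4 : linForm b (coroot s.1) ≠ 0 := fun h0 =>
    coroot_ne_zero ((mem_refls W).1 hs) (linForm_injective b (h0.trans (linHom b).map_zero.symm))
  rw [h3.resolve_left h4]
  simp

end Central

/-! ### Coefficients of `f(Θ)` in the crossed product, and the hamiltonians -/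

section Formal

open MvPolynomial

variable {k V : Type*} [Field k] [AddCommGroup V] [Module k V] {r : ℕ}
  (b : Basis (Fin r) k V) (W : Subgroup (V ≃ₗ[k] V))

/-- The crossed product of `W` and the functions on phase space, as a representation of itself. -/
def formalRep : CovRep b W (End k (W → PhaseFun r W)) where
  mul := AlgHom.ofLinearMap
    { toFun := fun f =>
        { toFun := fun F w => f * F w
          map_add' := fun F G => by funext w; simp [mul_add]
          map_smul' := fun a F => by funext w; simp }
      map_add' := fun f g => by ext1 F; funext w; simp [add_mul]
      map_smul' := fun a f => by ext1 F; funext w; simp }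
    (by ext1 F; funext w; simp)
    (fun f g => by ext1 F; funext w; simp [mul_assoc])
  act :=
    { toFun := fun g =>
        { toFun := fun F w => phaseAct b W g (F (g⁻¹ * w))
          map_add' := fun F G => by funext w; simp
          map_smul' := fun a F => by funext w; simp }
      map_one' := by ext1 F; funext w; simp [phaseAct_one]
      map_mul' := fun g g' => by ext1 F; funext w; simp [phaseAct_mul, mul_assoc] }
  act_mul g f := by ext1 F; funext w; simp [phaseAct_mul_apply]

theorem formalRep_mul (f : PhaseFun r W) (F : W → PhaseFun r W) (w : W) :
    (formalRep b W).mul f F w = f * F w := rfl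

theorem formalRep_act (g : W) (F : W → PhaseFun r W) (w : W) :
    (formalRep b W).act g F w = phaseAct b W g (F (g⁻¹ * w)) := rfl

/-- The standard representation of the crossed product on the functions on phase space. -/
def phaseCovRep : CovRep b W (End k (PhaseFun r W)) where
  mul := Algebra.lmul k (PhaseFun r W)
  act := phaseRep b W
  act_mul g f := by ext1 F; exact phaseAct_mul_apply b W g f F

variable {b W} {A : Type*} [Ring A] [Algebra k A] (D : CovRep b W A) [Fintype W] {c : W → k}

/-- The element of the crossed product with given coefficients. -/
def CovRep.ev (F : W → PhaseFun r W) : A := ∑ w, D.mul (F w) * D.act w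

theorem CovRep.ev_smul (a : k) (F : W → PhaseFun r W) : D.ev (a • F) = a • D.ev F := by
  simp [CovRep.ev, Finset.smul_sum]

theorem CovRep.ev_add (F G : W → PhaseFun r W) : D.ev (F + G) = D.ev F + D.ev G := by
  simp [CovRep.ev, add_mul, Finset.sum_add_distrib]

theorem CovRep.ev_mul (f : PhaseFun r W) (F : W → PhaseFun r W) :
    D.ev ((formalRep b W).mul f F) = D.mul f * D.ev F := by
  simp [CovRep.ev, formalRep_mul, Finset.mul_sum, mul_assoc]

theorem CovRep.ev_act (g : W) (F : W → PhaseFun r W) :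
    D.ev ((formalRep b W).act g F) = D.act g * D.ev F := by
  simp only [CovRep.ev, formalRep_act, Finset.mul_sum]
  rw [← Equiv.sum_comp (Equiv.mulLeft g)]
  refine Finset.sum_congr rfl fun w _ => ?_
  rw [← mul_assoc, D.act_mul, mul_assoc, ← map_mul]
  simp

/-- `ev` as a linear map. -/
def CovRep.evHom : (W → PhaseFun r W) →ₗ[k] A where
  toFun := D.ev
  map_add' := D.ev_add
  map_smul' := D.ev_smul

theorem CovRep.ev_theta (y : V) (F : W → PhaseFun r W) :
    D.ev ((formalRep b W).theta c y F) = D.theta c y * D.ev F := by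
  change D.evHom _ = _ * D.evHom _
  rw [CovRep.theta_apply, CovRep.theta_apply, LinearMap.sub_apply, map_sub, sub_mul, CovRep.pole,
    CovRep.pole, LinearMap.sum_apply, map_sum, Finset.sum_mul]
  congr 1
  · exact D.ev_mul _ _
  · refine Finset.sum_congr rfl fun s _ => ?_
    rw [LinearMap.smul_apply, map_smul, smul_mul_assoc, mul_assoc, Module.End.mul_apply]
    congr 1
    exact (D.ev_mul _ _).trans (congrArg _ (D.ev_act _ _))

variable [Infinite k] (hc : ∀ g s : W, IsReflection s.1 → c (g * s * g⁻¹) = c s)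

/-- The expansion of `f(Θ)` is computed once, in the formal crossed product, and this transports it
to every representation. -/
theorem CovRep.ev_thetaHom (f : MvPolynomial (Fin r) k) (F : W → PhaseFun r W) :
    D.ev ((formalRep b W).thetaHom hc f F) = D.thetaHom hc f * D.ev F := by
  induction f using MvPolynomial.induction_on generalizing F with
  | C a =>
    rw [← MvPolynomial.algebraMap_eq, AlgHom.commutes, AlgHom.commutes, ← Algebra.smul_def,
      Module.algebraMap_end_apply, D.ev_smul]
  | add p q hp hq => rw [map_add, map_add, add_mul, LinearMap.add_apply, D.ev_add, hp, hq]
  | mul_X p i hp =>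
    rw [map_mul, map_mul, Module.End.mul_apply, hp, mul_assoc, CovRep.thetaHom_X, CovRep.thetaHom_X,
      D.ev_theta]

/-- The coefficients `f_w` of `f(Θ) = ∑_w f_w w`. -/
def thetaCoeff (f : MvPolynomial (Fin r) k) : W → PhaseFun r W :=
  (formalRep b W).thetaHom hc f (Pi.single 1 1)

omit [Infinite k] in
theorem CovRep.ev_single (w : W) : D.ev (Pi.single w 1) = D.act w := by
  rw [CovRep.ev, Finset.sum_eq_single w]
  · simp
  · intro u _ hu; simp [hu]
  · simp

theorem CovRep.ev_thetaCoeff (f : MvPolynomial (Fin r) k) :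
    D.ev (thetaCoeff (b := b) hc f) = D.thetaHom hc f := by
  rw [thetaCoeff, D.ev_thetaHom, D.ev_single, map_one, mul_one]

theorem thetaCoeff_mem_lineRational (f : MvPolynomial (Fin r) k) (w : W) :
    thetaCoeff (b := b) hc f w ∈ lineRational W := by
  -- The claim is made for all `F`, since the last variable of a monomial is applied before the
  -- remaining factors.
  suffices H : ∀ F : W → PhaseFun r W, (∀ w, F w ∈ lineRational W) →
      ∀ w, (formalRep b W).thetaHom hc f F w ∈ lineRational W by
    refine H _ (fun w => ?_) w
    by_cases hw : w = 1
    · subst hw; simp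
    · simp [hw]
  intro F hF
  induction f using MvPolynomial.induction_on generalizing F with
  | C a =>
    intro w
    rw [← MvPolynomial.algebraMap_eq, AlgHom.commutes, Module.algebraMap_end_apply]
    exact Subalgebra.smul_mem _ (hF w) a
  | add p q hp hq =>
    intro w
    rw [map_add]
    exact Subalgebra.add_mem _ (hp F hF w) (hq F hF w)
  | mul_X p i hp =>
    rw [map_mul, CovRep.thetaHom_X]
    refine hp _ fun w => ?_
    rw [CovRep.theta_apply, LinearMap.sub_apply, CovRep.pole, LinearMap.sum_apply, Pi.sub_apply,
      Finset.sum_apply]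
    refine Subalgebra.sub_mem _ (Subalgebra.mul_mem _ (const_mem_lineRational W _) (hF w))
      (Subalgebra.sum_mem _ fun s hs => Subalgebra.smul_mem _ (Subalgebra.mul_mem _
        (rho_mem_lineRational W ((mem_refls W).1 hs) _) (phaseAct_mem_lineRational b W _ (hF _))) _)

/-- Comparing the coefficients of `w` on both sides of `f(Θ)ξ = ξf(Θ)` gives `f_w(h)(ξ(w⁻¹h) - ξ(h))
= 0` for all `ξ`. Thus `f_w` vanishes at the points moved by `w⁻¹`, hence everywhere by rationality.
-/
theorem thetaCoeff_eq_zero {f : MvPolynomial (Fin r) k} (hf : f ∈ invariants b W) {w : W}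
    (hw : w ≠ 1) : thetaCoeff (b := b) hc f w = 0 := by
  refine lineRational_eq_zero W (w := w⁻¹) (by simpa using hw) (thetaCoeff_mem_lineRational hc f w)
    fun h hh => ?_
  obtain ⟨ξ, hξ⟩ : ∃ ξ : Dual k V, ξ (w⁻¹.1 h.1) ≠ ξ h.1 := by
    by_contra! H
    exact hh (sub_eq_zero.1 ((Module.forall_dual_apply_eq_zero_iff k _).1 fun ξ => by
      rw [map_sub, H, sub_self]))
  have h1 := ((formalRep b W).commute_thetaHom_pos hc hf ξ).eq
  have h2 := congrFun (congrFun (LinearMap.congr_fun h1 (Pi.single 1 1)) w) h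
  rw [← (formalRep b W).ev_thetaCoeff] at h2
  simp only [Module.End.mul_apply, CovRep.ev, LinearMap.sum_apply, Finset.sum_apply, formalRep_mul,
    formalRep_act] at h2
  rw [Finset.sum_eq_single w, Finset.mul_sum, Finset.sum_eq_single w] at h2
  · simp only [inv_mul_cancel, Pi.single_eq_same, mul_one, phaseAct_fun_one, phaseAct_posFun,
      Pi.mul_apply] at h2
    rw [mul_comm, ← sub_eq_zero, ← sub_mul, mul_eq_zero] at h2
    refine h2.resolve_left fun h3 => hξ ?_
    simp only [posFun, coact, LinearMap.comp_apply, ← map_sub C] at h3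
    exact sub_eq_zero.1 (C_injective (Fin r) k (h3.trans (map_zero _).symm))
  · intro u _ hu
    have : u⁻¹ * w ≠ 1 := fun h => hu (inv_mul_eq_one.1 h)
    simp [this]
  · simp
  · intro u _ hu
    have : u⁻¹ * w ≠ 1 := fun h => hu (inv_mul_eq_one.1 h)
    simp [this]
  · simp

theorem CovRep.thetaHom_eq_mul_thetaCoeff {f : MvPolynomial (Fin r) k} (hf : f ∈ invariants b W) :
    D.thetaHom hc f = D.mul (thetaCoeff (b := b) hc f 1) := by
  rw [← D.ev_thetaCoeff, CovRep.ev, Finset.sum_eq_single 1]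
  · simp
  · intro w _ hw; simp [thetaCoeff_eq_zero hc hf hw]
  · simp

omit [Infinite k] in
theorem dunkl_eq_theta (y : V) : dunkl b W c y = (phaseCovRep b W).theta c y := rfl

theorem hamiltonian_eq_thetaHom (f : MvPolynomial (Fin r) k) :
    hamiltonian b W c f = (phaseCovRep b W).thetaHom hc f 1 := by
  rw [← polyEval_eq_algHom]
  simp only [CovRep.thetaHom_X]
  rfl

theorem hamiltonian_eq_thetaCoeff {f : MvPolynomial (Fin r) k} (hf : f ∈ invariants b W) :
    hamiltonian b W c f = thetaCoeff (b := b) hc f 1 := by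
  rw [hamiltonian_eq_thetaHom hc, CovRep.thetaHom_eq_mul_thetaCoeff _ hc hf]
  exact mul_one _

/-- `f(Θ)` acts by the Calogero-Moser hamiltonian of the invariant `f`. -/
theorem CovRep.thetaHom_eq_mul_hamiltonian {f : MvPolynomial (Fin r) k}
    (hf : f ∈ invariants b W) : D.thetaHom hc f = D.mul (hamiltonian b W c f) := by
  rw [hamiltonian_eq_thetaCoeff hc hf, D.thetaHom_eq_mul_thetaCoeff hc hf]

end Formal

end

section

/-! ### Gaudin operators as matrices, and the identity `H_f(h,G) = f(λ)` -/

section Matrix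

open MvPolynomial

variable {k V : Type*} [Field k] [AddCommGroup V] [Module k V] {r : ℕ}
  (b : Basis (Fin r) k V) (W : Subgroup (V ≃ₗ[k] V))
  {T : Type*} [CommRing T] [Algebra k T] (l : V →ₗ[k] T)

/-- The left regular representation of `W` on the functions `W → T`. -/
def leftReg (T : Type*) [CommRing T] : W →* End T (W → T) where
  toFun g :=
    { toFun := fun f w => f (g⁻¹ * w)
      map_add' := fun _ _ => rfl
      map_smul' := fun _ _ => rfl }
  map_one' := by ext1 f; funext w; simp
  map_mul' g g' := by ext1 f; funext w; simp [mul_assoc]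

omit [Algebra k T] in
theorem leftReg_apply (g : W) (f : W → T) (w : W) : leftReg W T g f w = f (g⁻¹ * w) := rfl

/-- The diagonal part of the Gaudin operator. -/
def gaudinDiag (y : V) : End T (W → T) where
  toFun f w := l (w⁻¹.1 y) * f w
  map_add' f g := by funext w; simp [mul_add]
  map_smul' a f := by funext w; simp [mul_left_comm]

theorem gaudinDiag_apply (y : V) (f : W → T) (w : W) : gaudinDiag W l y f w = l (w⁻¹.1 y) * f w := rfl

theorem leftReg_mul_gaudinDiag (g : W) (y : V) :
    leftReg W T g * gaudinDiag W l y = gaudinDiag W l (g.1 y) * leftReg W T g := by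
  ext1 f; funext w
  simp only [Module.End.mul_apply, leftReg_apply, gaudinDiag_apply]
  congr 2

theorem gaudinDiag_add (y z : V) : gaudinDiag W l (y + z) = gaudinDiag W l y + gaudinDiag W l z := by
  ext1 f; funext w; simp [gaudinDiag_apply, add_mul]

theorem gaudinDiag_smul (a : k) (y : V) : gaudinDiag W l (a • y) = a • gaudinDiag W l y := by
  ext1 f; funext w; simp [gaudinDiag_apply]

variable [Fintype W] (c : W → k)

/-- The pole part of the Gaudin operator. -/
def gaudinPole (T : Type*) [CommRing T] [Algebra k T] (h y : V) : End T (W → T) :=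
  ∑ s ∈ refls W, (c s * rho s.1 y h) • leftReg W T s

/-- The Gaudin operator as a matrix; the coefficient ring `T` and the linear map `l : 𝔥 → T`
stand for the algebra of functions of `λ` or its value at a point. -/
def gaudinOp (h : V) : V →ₗ[k] End T (W → T) where
  toFun y := gaudinDiag W l y + gaudinPole W c T h y
  map_add' y z := by
    simp only [gaudinDiag_add, gaudinPole, rho_add, mul_add, add_smul, Finset.sum_add_distrib]
    abel
  map_smul' a y := by
    simp only [gaudinDiag_smul, gaudinPole, rho_smul, RingHom.id_apply, smul_add, Finset.smul_sum,
      smul_smul, mul_left_comm]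

theorem gaudinOp_apply (h y : V) :
    gaudinOp W l c h y = gaudinDiag W l y + gaudinPole W c T h y := rfl

theorem gaudinOp_apply_apply (h y : V) (f : W → T) (w : W) :
    gaudinOp W l c h y f w =
      l (w⁻¹.1 y) * f w + ∑ s ∈ refls W, (c s * rho s.1 y h) • f (s * w) := by
  rw [gaudinOp_apply, LinearMap.add_apply, Pi.add_apply, gaudinDiag_apply, gaudinPole,
    LinearMap.sum_apply, Finset.sum_apply]
  congr 1
  refine Finset.sum_congr rfl fun s hs => ?_
  rw [LinearMap.smul_apply, Pi.smul_apply, leftReg_apply, refl_inv W hs]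

variable {W c} (hc : ∀ g s : W, IsReflection s.1 → c (g * s * g⁻¹) = c s)

include hc

/-- This equivariance is what lets the momenta act by Gaudin operators in `gaudinRep`: the group
element also moves the base point `h`. -/
theorem leftReg_mul_gaudinOp (g : W) {h : V} (hh : h ∈ regularSet W) (y : V) :
    leftReg W T g * gaudinOp W l c (g⁻¹.1 h) y = gaudinOp W l c h (g.1 y) * leftReg W T g := by
  rw [gaudinOp_apply, gaudinOp_apply, mul_add, add_mul, leftReg_mul_gaudinDiag]
  congr 1
  simp only [gaudinPole, Finset.mul_sum, Finset.sum_mul]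
  refine Finset.sum_bij' (fun s _ => g * s * g⁻¹) (fun s _ => g⁻¹ * s * g)
    (fun s hs => conj_mem_refls W hs g)
    (fun s hs => by simpa using conj_mem_refls W hs g⁻¹) (fun s _ => by group) (fun s _ => by group)
    fun s hs => ?_
  have hs' := (mem_refls W).1 hs
  rw [hc g s hs', rho_conj_refl hs' g hh, mul_smul_comm, smul_mul_assoc, ← map_mul, ← map_mul]
  simp

variable [Infinite k]

theorem gaudinPole_commute (b : Basis (Fin r) k V) {h : V} (hh : h ∈ regularSet W) (y y' : V) :
    Commute (gaudinPole W c T h y) (gaudinPole W c T h y') := by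
  rw [Commute, SemiconjBy, ← sub_eq_zero, gaudinPole, gaudinPole, Finset.sum_mul_sum,
    Finset.sum_mul_sum, ← Finset.sum_product', ← Finset.sum_product', ← Finset.sum_sub_distrib,
    ← sum_wedge_apply b hc hh y y' (fun w => leftReg W T w)]
  refine Finset.sum_congr rfl fun p _ => ?_
  rw [smul_mul_smul_comm, smul_mul_smul_comm, ← map_mul]
  refine (sub_smul _ _ _).symm.trans (congrArg (· • leftReg W T (p.1 * p.2)) ?_)
  simp only [wedge]
  ring

-- As for the Dunkl operators, the right side is symmetric in `y` and `y'`, which settles the mixed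
-- terms in `gaudinOp_commute`.
omit [Infinite k] hc in
theorem gaudinDiag_mul_gaudinPole {h : V} (hh : h ∈ regularSet W) (y y' : V) :
    gaudinDiag W l y * gaudinPole W c T h y' - gaudinPole W c T h y' * gaudinDiag W l y =
      ∑ s ∈ refls W, (c s * (rho s.1 y' h * rho s.1 y h)) •
        (gaudinDiag W l (h - s.1 h) * leftReg W T s) := by
  rw [gaudinPole, Finset.mul_sum, Finset.sum_mul, ← Finset.sum_sub_distrib]
  refine Finset.sum_congr rfl fun s hs => ?_
  have hs' := (mem_refls W).1 hs
  have e := rho_smul_sub hs' (regular_ne W hh hs) y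
  have e' : gaudinDiag W l (y - s.1 y) = gaudinDiag W l y - gaudinDiag W l (s.1 y) := by
    refine LinearMap.ext fun f => ?_
    funext w; simp [gaudinDiag_apply, sub_mul]
  rw [mul_smul_comm, smul_mul_assoc, leftReg_mul_gaudinDiag]
  refine (smul_sub _ _ _).symm.trans ?_
  rw [← sub_mul, ← e', ← e, gaudinDiag_smul, smul_mul_assoc, smul_smul, mul_assoc]

theorem gaudinOp_commute (b : Basis (Fin r) k V) {h : V} (hh : h ∈ regularSet W) (y y' : V) :
    Commute (gaudinOp W l c h y) (gaudinOp W l c h y') := by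
  have h0 : gaudinDiag W l y * gaudinDiag W l y' = gaudinDiag W l y' * gaudinDiag W l y := by
    refine LinearMap.ext fun f => ?_
    funext w; simp [gaudinDiag_apply, mul_left_comm]
  have h1 := (gaudinPole_commute (T := T) hc b hh y y').eq
  have h2 := gaudinDiag_mul_gaudinPole (c := c) l hh y y'
  have h3 := gaudinDiag_mul_gaudinPole (c := c) l hh y' y
  have h4 : ∀ s : W, rho s.1 y' h * rho s.1 y h = rho s.1 y h * rho s.1 y' h :=
    fun s => mul_comm _ _
  simp only [h4] at h2
  rw [← h3, sub_eq_iff_eq_add] at h2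
  rw [Commute, SemiconjBy, gaudinOp_apply, gaudinOp_apply, add_mul, add_mul, mul_add, mul_add,
    mul_add, mul_add, h1, h2, h0]
  abel

/-- Polynomials in the Gaudin operators. -/
def gaudinHom (h : regularSet W) : MvPolynomial (Fin r) k →ₐ[k] End T (W → T) :=
  commEval (fun i => gaudinOp W l c h.1 (b i)) fun _ _ => gaudinOp_commute l hc b h.2 _ _

theorem gaudinHom_linForm (h : regularSet W) (y : V) :
    gaudinHom b l hc h (linForm b y) = gaudinOp W l c h.1 y := by
  rw [algHom_linForm]
  conv_rhs => rw [← b.sum_repr y, map_sum]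
  simp [gaudinHom]

theorem leftReg_mul_gaudinHom (g : W) (h : regularSet W) (f : MvPolynomial (Fin r) k) :
    leftReg W T g * gaudinHom b l hc ⟨g⁻¹.1 h.1, regularSet_act W h.2 g⁻¹⟩ f =
      gaudinHom b l hc h (polyAct b g.1 f) * leftReg W T g := by
  induction f using MvPolynomial.induction_on with
  | C a =>
    rw [polyAct_C, ← MvPolynomial.algebraMap_eq, AlgHom.commutes, AlgHom.commutes]
    exact (Algebra.commutes a _).symm
  | add p q hp hq => rw [map_add, map_add, map_add, mul_add, add_mul, hp, hq]
  | mul_X p i hp =>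
    rw [map_mul, map_mul, map_mul, ← mul_assoc, hp, ← linForm_basis b, polyAct_linForm,
      gaudinHom_linForm, gaudinHom_linForm, mul_assoc, leftReg_mul_gaudinOp l hc g h.2, mul_assoc]

/-- The representation of the crossed product on functions on `𝔥_reg` with values in
`W → T`, in which the momenta act by the Gaudin operators. -/
def gaudinRep : CovRep b W (End k (regularSet W → W → T)) where
  mul := AlgHom.ofLinearMap
    { toFun := fun f =>
        { toFun := fun F h => gaudinHom b l hc h (f h) (F h)
          map_add' := fun F G => by funext h; simp
          map_smul' := fun a F => by
            funext h
            exact LinearMap.map_smul_of_tower (gaudinHom b l hc h (f h)) a (F h) }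
      map_add' := fun f g => by ext1 F; funext h; simp
      map_smul' := fun a f => by ext1 F; funext h; simp }
    (by ext1 F; funext h; simp)
    (fun f g => by ext1 F; funext h; simp)
  act :=
    { toFun := fun g =>
        { toFun := fun F h => leftReg W T g (F ⟨g⁻¹.1 h.1, regularSet_act W h.2 g⁻¹⟩)
          map_add' := fun F G => by funext h; simp
          map_smul' := fun a F => by
            funext h
            exact LinearMap.map_smul_of_tower (leftReg W T g) a _ }
      map_one' := by ext1 F; funext h; simp
      map_mul' := fun g g' => by
        ext1 F
        funext h
        simp only [LinearMap.coe_mk, AddHom.coe_mk, Module.End.mul_apply, map_mul]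
        rfl }
  act_mul g f := by
    ext1 F
    funext h
    exact LinearMap.congr_fun (leftReg_mul_gaudinHom b l hc g h _) _

theorem gaudinRep_mul (f : PhaseFun r W) (F : regularSet W → W → T) (h : regularSet W) :
    (gaudinRep b l hc).mul f F h = gaudinHom b l hc h (f h) (F h) := rfl

theorem gaudinRep_act (g : W) (F : regularSet W → W → T) (h : regularSet W) (w : W) :
    (gaudinRep b l hc).act g F h w = F ⟨g⁻¹.1 h.1, regularSet_act W h.2 g⁻¹⟩ (g⁻¹ * w) := rfl

theorem gaudinRep_theta_apply (y : V) (F : regularSet W → W → T) (h : regularSet W) (w : W) :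
    (gaudinRep b l hc).theta c y F h w = gaudinOp W l c h.1 y (F h) w -
      ∑ s ∈ refls W, (c s * rho s.1 y h.1) •
        F ⟨s⁻¹.1 h.1, regularSet_act W h.2 s⁻¹⟩ (s⁻¹ * w) := by
  rw [CovRep.theta_apply, LinearMap.sub_apply, Pi.sub_apply, Pi.sub_apply, gaudinRep_mul, momFun,
    gaudinHom_linForm, CovRep.pole, LinearMap.sum_apply, Finset.sum_apply, Finset.sum_apply]
  congr 1
  refine Finset.sum_congr rfl fun s _ => ?_
  rw [LinearMap.smul_apply, Pi.smul_apply, Pi.smul_apply, Module.End.mul_apply, gaudinRep_mul,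
    rhoFun, ← MvPolynomial.algebraMap_eq, AlgHom.commutes, Module.algebraMap_end_apply, Pi.smul_apply,
    gaudinRep_act, smul_smul]

/-- A constant function does not see the motion of `h`, so the pole part of `Θ(y)` and that of the
Gaudin operator are the same left translations and cancel. Only the diagonal term remains. -/
theorem gaudinRep_theta_single (y : V) (u : W) (t : T) :
    (gaudinRep b l hc).theta c y (fun _ => Pi.single u t) =
      fun _ => Pi.single u (l (u⁻¹.1 y) * t) := by
  funext h w
  rw [gaudinRep_theta_apply, gaudinOp_apply_apply, Finset.sum_congr rfl (g := fun s =>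
    (c s * rho s.1 y h.1) • (Pi.single u t : W → T) (s⁻¹ * w)), add_sub_cancel_right]
  · by_cases hw : w = u
    · subst hw; simp
    · simp [hw]
  · intro s hs
    rw [refl_inv W hs]

theorem gaudinRep_thetaHom_single (f : MvPolynomial (Fin r) k) (u : W) (t : T) :
    (gaudinRep b l hc).thetaHom hc f (fun _ => Pi.single u t) =
      fun _ => Pi.single u (aeval (fun i => l (b i)) (polyAct b u.1⁻¹ f) * t) := by
  induction f using MvPolynomial.induction_on generalizing t with
  | C a =>
    rw [polyAct_C, ← MvPolynomial.algebraMap_eq, AlgHom.commutes, AlgHom.commutes,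
      Module.algebraMap_end_apply]
    funext h
    rw [Pi.smul_apply, ← Pi.single_smul, Algebra.smul_def]
  | add p q hp hq =>
    rw [map_add, map_add, map_add, LinearMap.add_apply, hp, hq]
    funext h
    rw [Pi.add_apply, ← Pi.single_add, add_mul]
  | mul_X p i hp =>
    rw [map_mul, map_mul, map_mul, Module.End.mul_apply, CovRep.thetaHom_X, gaudinRep_theta_single,
      hp, ← linForm_basis b, polyAct_linForm, aeval_linForm, mul_assoc]
    rfl

/-- The hamiltonian of an invariant `f`, evaluated at the Gaudin operators, is the scalar
`f(λ)`. -/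
theorem gaudinHom_hamiltonian {f : MvPolynomial (Fin r) k} (hf : f ∈ invariants b W)
    (h : regularSet W) :
    gaudinHom b l hc h (hamiltonian b W c f h) =
      algebraMap T _ (aeval (fun i => l (b i)) f) := by
  refine LinearMap.pi_ext fun u t => ?_
  -- On the constant function `δ_u`, the operator `f(Θ)` is computed twice: as a scalar by the
  -- cancellation of poles, and as `H_f(h,G)` because `f` is invariant.
  have h1 := congrFun (gaudinRep_thetaHom_single b l hc f u t) h
  have h2 : polyAct b u.1⁻¹ f = f := (mem_invariants b).1 hf u⁻¹
  rw [h2, CovRep.thetaHom_eq_mul_hamiltonian _ hc hf, gaudinRep_mul] at h1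
  rw [h1, Module.algebraMap_end_apply, ← Pi.single_smul, smul_eq_mul]

end Matrix

end

section

/-! ### A spanning set of the Whittaker module and of its fibers -/

section Cherednik

variable {k V : Type*} [Field k] [AddCommGroup V] [Module k V] (W : Subgroup (V ≃ₗ[k] V)) [Fintype W]
  (t : k) (c : W → k)

theorem hw_mul (g g' : W) : hw W t c (g * g') = hw W t c g * hw W t c g' := by
  simpa [hw] using RingQuot.mkAlgHom_rel k (Rel.w_mul (t := t) (c := c) (W := W) g g')

theorem hw_one : hw W t c 1 = 1 := by
  simpa [hw] using RingQuot.mkAlgHom_rel k (Rel.w_one (t := t) (c := c) (W := W))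

theorem hw_hy (g : W) (v : V) : hw W t c g * hy W t c v = hy W t c (g.1 v) * hw W t c g := by
  simpa [hw, hy] using RingQuot.mkAlgHom_rel k (Rel.w_y (t := t) (c := c) (W := W) g v)

theorem cherednik_induction {p : Cherednik W t c → Prop}
    (hx' : ∀ ξ, p (hx W t c ξ)) (hy' : ∀ v, p (hy W t c v)) (hw' : ∀ g, p (hw W t c g))
    (hscalar : ∀ a, p (algebraMap k _ a)) (hadd : ∀ a b, p a → p b → p (a + b))
    (hmul : ∀ a b, p a → p b → p (a * b)) (a : Cherednik W t c) : p a := by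
  obtain ⟨a, rfl⟩ := RingQuot.mkAlgHom_surjective k (Rel W t c) a
  induction a using FreeAlgebra.induction with
  | grade0 a => simpa using hscalar a
  | grade1 x =>
    cases x with
    | x ξ => exact hx' ξ
    | y v => exact hy' v
    | w g => exact hw' g
  | mul a b ha hb => rw [map_mul]; exact hmul _ _ ha hb
  | add a b ha hb => rw [map_add]; exact hadd _ _ ha hb

variable (lam : Dual k V)

/-- The generator of the Whittaker module. -/
def whit : Whittaker W t c lam := Submodule.Quotient.mk 1

theorem hy_smul_whit (v : V) : hy W t c v • whit W t c lam = lam v • whit W t c lam := by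
  have h1 : hy W t c v - algebraMap k (Cherednik W t c) (lam v) ∈
    Submodule.span (Cherednik W t c)
      (Set.range fun v : V => hy W t c v - algebraMap k (Cherednik W t c) (lam v)) :=
    Submodule.subset_span ⟨v, rfl⟩
  have h2 := (Submodule.Quotient.mk_eq_zero _).2 h1
  rw [whit, ← Submodule.Quotient.mk_smul, ← Submodule.Quotient.mk_smul, ← sub_eq_zero,
    ← Submodule.Quotient.mk_sub, ← h2, smul_eq_mul, mul_one, Algebra.smul_def, mul_one]

/-- The span of the products of elements of `𝔥*` and of `W` applied to the generator. -/
def whitSpan : Submodule k (Whittaker W t c lam) :=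
  Submodule.span k (Set.range fun p : List (Dual k V) × W =>
    (p.1.map (hx W t c)).prod • hw W t c p.2 • whit W t c lam)

variable {W t c lam}

theorem mem_whitSpan (l : List (Dual k V)) (g : W) :
    (l.map (hx W t c)).prod • hw W t c g • whit W t c lam ∈ whitSpan W t c lam :=
  Submodule.subset_span ⟨(l, g), rfl⟩

theorem smul_mem_whitSpan_of {a : Cherednik W t c}
    (h : ∀ (l : List (Dual k V)) (g : W), a • (l.map (hx W t c)).prod • hw W t c g • whit W t c lam ∈ whitSpan W t c lam)
    {m : Whittaker W t c lam} (hm : m ∈ whitSpan W t c lam) : a • m ∈ whitSpan W t c lam := by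
  refine Submodule.span_induction (p := fun m _ => a • m ∈ whitSpan W t c lam) ?_ ?_ ?_ ?_ hm
  · rintro _ ⟨⟨l, g⟩, rfl⟩
    exact h l g
  · rw [smul_zero]; exact Submodule.zero_mem _
  · intro x y _ _ hx hy
    rw [smul_add]; exact Submodule.add_mem _ hx hy
  · intro x y _ hy
    rw [smul_comm]; exact Submodule.smul_mem _ _ hy

theorem hx_smul_mem (ξ : Dual k V) {m : Whittaker W t c lam} (hm : m ∈ whitSpan W t c lam) :
    hx W t c ξ • m ∈ whitSpan W t c lam :=
  smul_mem_whitSpan_of (fun l g => by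
    have := mem_whitSpan (W := W) (t := t) (c := c) (lam := lam) (ξ :: l) g
    rwa [List.map_cons, List.prod_cons, mul_smul] at this) hm

theorem hw_mul_prod (g : W) (l : List (Dual k V)) :
    hw W t c g * (l.map (hx W t c)).prod =
      ((l.map (coact g.1)).map (hx W t c)).prod * hw W t c g := by
  induction l with
  | nil => simp
  | cons ξ l ih =>
    simp only [List.map_cons, List.prod_cons]
    rw [← mul_assoc, hw_hx, mul_assoc, ih, mul_assoc]

theorem hw_smul_mem (g : W) {m : Whittaker W t c lam} (hm : m ∈ whitSpan W t c lam) :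
    hw W t c g • m ∈ whitSpan W t c lam :=
  smul_mem_whitSpan_of (fun l g' => by
    rw [← mul_smul, hw_mul_prod, mul_smul, ← mul_smul (hw W t c g), ← hw_mul]
    exact mem_whitSpan _ _) hm

/-- Moving `y` to the right through a word in `𝔥*` creates only shorter words and group elements; at
the generator `y` becomes a scalar. -/
theorem hy_smul_mem (v : V) {m : Whittaker W t c lam} (hm : m ∈ whitSpan W t c lam) :
    hy W t c v • m ∈ whitSpan W t c lam :=
  smul_mem_whitSpan_of (fun l g => by
    induction l generalizing v with
    | nil =>
      have h1 : hy W t c v = hy W t c (g.1 (g.1⁻¹ v)) := by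
        rw [← LinearEquiv.mul_apply, mul_inv_cancel]; rfl
      simp only [List.map_nil, List.prod_nil, one_smul]
      rw [h1, ← mul_smul, ← hw_hy, mul_smul, hy_smul_whit, smul_comm]
      refine Submodule.smul_mem _ _ ?_
      simpa using mem_whitSpan (W := W) (t := t) (c := c) (lam := lam) [] g
    | cons ξ l ih =>
      rw [List.map_cons, List.prod_cons, mul_smul, ← mul_smul, hy_hx, add_smul, add_smul, mul_smul,
        Finset.sum_smul, smul_assoc, one_smul]
      refine Submodule.add_mem _ (Submodule.add_mem _ (hx_smul_mem _ (ih v))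
        (Submodule.smul_mem _ _ (mem_whitSpan l g))) (Submodule.sum_mem _ fun s _ => ?_)
      rw [smul_assoc]
      exact Submodule.smul_mem _ _ (hw_smul_mem s (mem_whitSpan l g))) hm

theorem whitSpan_eq_top : whitSpan W t c lam = ⊤ := by
  refine Submodule.eq_top_iff'.2 fun m => ?_
  obtain ⟨a, rfl⟩ := Submodule.Quotient.mk_surjective _ m
  have h1 : (Submodule.Quotient.mk a : Whittaker W t c lam) = a • whit W t c lam := by
    rw [whit, ← Submodule.Quotient.mk_smul, smul_eq_mul, mul_one]
  have h2 : whit W t c lam ∈ whitSpan W t c lam := by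
    simpa [hw_one] using mem_whitSpan (W := W) (t := t) (c := c) (lam := lam) [] 1
  rw [h1]
  clear h1
  suffices H : ∀ m ∈ whitSpan W t c lam, a • m ∈ whitSpan W t c lam from H _ h2
  induction a using cherednik_induction W t c with
  | hx' ξ => exact fun m hm => hx_smul_mem ξ hm
  | hy' v => exact fun m hm => hy_smul_mem v hm
  | hw' g => exact fun m hm => hw_smul_mem g hm
  | hscalar a =>
    intro m hm
    rw [algebraMap_smul]
    exact Submodule.smul_mem _ _ hm
  | hadd a b ha hb =>
    intro m hm
    rw [add_smul]
    exact Submodule.add_mem _ (ha m hm) (hb m hm)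
  | hmul a b ha hb =>
    intro m hm
    rw [mul_smul]
    exact ha _ (hb m hm)

/-- The map `k^W → M(h,λ)` which is shown to be an isomorphism. -/
def toFiber (W : Subgroup (V ≃ₗ[k] V)) [Fintype W] (c : W → k) (h : V) (lam : Dual k V) :
    (W → k) →ₗ[k] Fiber W c h lam :=
  Fintype.linearCombination k fun g => (fiberKer W 0 c h lam).mkQ (hw W 0 c g • whit W 0 c lam)

/-- In the fiber a word in `𝔥*` acts by its value at `h`, so from the spanning set of `M(λ)` only
the group elements remain. -/
theorem toFiber_surjective (c : W → k) (h : V) (lam : Dual k V) :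
    Function.Surjective (toFiber W c h lam) := by
  have h1 : ∀ (l : List (Dual k V)) (m : Whittaker W 0 c lam),
      (fiberKer W 0 c h lam).mkQ ((l.map (hx W 0 c)).prod • m) =
        (l.map fun ξ => ξ h).prod • (fiberKer W 0 c h lam).mkQ m := by
    intro l m
    induction l generalizing m with
    | nil => simp
    | cons ξ l ih =>
      rw [List.map_cons, List.prod_cons, List.map_cons, List.prod_cons, mul_smul, mul_smul, ← ih,
        ← sub_eq_zero, ← map_smul, ← map_sub, Submodule.mkQ_apply, Submodule.Quotient.mk_eq_zero]
      refine Submodule.subset_span ⟨ξ, (l.map (hx W 0 c)).prod • m, ?_⟩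
      rw [sub_smul, algebraMap_smul]
  rw [← LinearMap.range_eq_top, eq_top_iff, ← Submodule.range_mkQ, LinearMap.range_eq_map,
    ← whitSpan_eq_top, whitSpan, Submodule.map_span, Submodule.span_le]
  rintro _ ⟨_, ⟨⟨l, g⟩, rfl⟩, rfl⟩
  refine ⟨(l.map fun ξ => ξ h).prod • Pi.single g 1, ?_⟩
  rw [map_smul, toFiber, Fintype.linearCombination_apply_single, one_smul]
  exact (h1 l _).symm

end Cherednik

/-! ### The Dunkl representation of the Cherednik algebra -/

section Action

open MvPolynomial

variable {k V : Type*} [Field k] [AddCommGroup V] [Module k V] {r : ℕ}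
  {b : Basis (Fin r) k V} {W : Subgroup (V ≃ₗ[k] V)} [Fintype W] [Infinite k]
  {A : Type*} [Ring A] [Algebra k A] (D : CovRep b W A) {c : W → k}
  (hc : ∀ g s : W, IsReflection s.1 → c (g * s * g⁻¹) = c s)

/-- The Dunkl representation of the Cherednik algebra in an algebra with a covariant
representation. -/
def CovRep.cherednikHom : Cherednik W 0 c →ₐ[k] A :=
  RingQuot.liftAlgHom k ⟨FreeAlgebra.lift k fun
      | Gen.x ξ => D.mul (posFun W ξ)
      | Gen.y v => D.theta c v
      | Gen.w g => D.act g, by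
    intro x y hxy
    have hpa : ∀ ξ η, posFun (r := r) W (ξ + η) = posFun W ξ + posFun W η := fun ξ η => by
      funext h; simp [posFun]
    have hps : ∀ (a : k) ξ, posFun (r := r) W (a • ξ) = a • posFun W ξ := fun a ξ => by
      funext h; simp [posFun, MvPolynomial.smul_eq_C_mul]
    cases hxy with
    | x_add ξ η => simp [hpa]
    | x_smul a ξ => simp [hps]
    | y_add u v => simp
    | y_smul a v => simp
    | w_one => simp
    | w_mul g g' => simp
    | w_x g ξ => simp [D.act_mul, phaseAct_posFun]
    | w_y g v => simp [D.act_theta hc]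
    | x_x ξ η => simpa using D.mul_comm' _ _
    | y_y u v => simpa using (D.commute_theta hc u v).eq
    | y_x v ξ => simp [D.theta_pos]⟩

theorem CovRep.cherednikHom_hx (ξ : Dual k V) :
    D.cherednikHom hc (hx W 0 c ξ) = D.mul (posFun W ξ) := by
  simp [CovRep.cherednikHom, hx]

theorem CovRep.cherednikHom_hy (v : V) : D.cherednikHom hc (hy W 0 c v) = D.theta c v := by
  simp [CovRep.cherednikHom, hy]

theorem CovRep.cherednikHom_hw (g : W) : D.cherednikHom hc (hw W 0 c g) = D.act g := by
  simp [CovRep.cherednikHom, hw]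

theorem CovRep.cherednikHom_rootProd (s : Finset W) :
    D.cherednikHom hc (rootProd W 0 c s) = D.mul (fun h => C (∏ s ∈ s, root s.1 h.1)) := by
  have : (fun h => C (∏ s ∈ s, root s.1 h.1) : PhaseFun r W) = ∏ s ∈ s, posFun W (root s.1) := by
    funext h; simp [posFun]
  rw [this, rootProd, ← Finset.noncommProd_eq_prod]
  refine (Finset.map_noncommProd s _ _ (D.cherednikHom hc)).trans
    (Eq.trans ?_ (Finset.map_noncommProd s _ _ D.mul).symm)
  exact Finset.noncommProd_congr rfl (fun s _ => D.cherednikHom_hx hc _) _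

end Action

end

section

/-! ### Identification of `M(h,λ)` with `W → k` -/

section FiberEquiv

open MvPolynomial

variable {k V : Type*} [Field k] [AddCommGroup V] [Module k V] {r : ℕ}
  (b : Basis (Fin r) k V) {W : Subgroup (V ≃ₗ[k] V)} [Fintype W] [Infinite k] {c : W → k}
  (hc : ∀ g s : W, IsReflection s.1 → c (g * s * g⁻¹) = c s) (lam : Dual k V)

/-- The action of the Cherednik algebra on the functions on `𝔥_reg` with values in `k^W`. -/
def whitAct : Cherednik W 0 c →ₐ[k] End k (regularSet W → W → k) :=
  (gaudinRep b lam hc).cherednikHom hc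

/-- The Whittaker module maps to functions on `𝔥_reg` with values in `k^W`. -/
def whitMap : Whittaker W 0 c lam →ₗ[k] (regularSet W → W → k) :=
  (((Submodule.span (Cherednik W 0 c)
    (Set.range fun v : V => hy W 0 c v - algebraMap k (Cherednik W 0 c) (lam v))).restrictScalars
      k).liftQ (LinearMap.applyₗ (fun _ => Pi.single 1 1) ∘ₗ (whitAct b hc lam).toLinearMap) (by
    intro a ha
    rw [LinearMap.mem_ker]
    refine Submodule.span_induction (p := fun a _ => whitAct b hc lam a (fun _ => Pi.single 1 1) = 0)
      ?_ ?_ ?_ ?_ ha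
    · rintro _ ⟨v, rfl⟩
      -- The constant function `δ₁` satisfies `Θ(v)δ₁ = λ(v)δ₁`, the defining relation of the
      -- generator of `M(λ)`.
      rw [map_sub, whitAct, CovRep.cherednikHom_hy, AlgHom.commutes, LinearMap.sub_apply,
        gaudinRep_theta_single, Module.algebraMap_end_apply]
      funext h
      simp [← Pi.single_smul]
    · simp
    · intro x y _ _ hx hy
      rw [map_add, LinearMap.add_apply, hx, hy, add_zero]
    · intro a x _ hx
      rw [smul_eq_mul, map_mul, Module.End.mul_apply, hx, map_zero])) ∘ₗ
  (Submodule.Quotient.restrictScalarsEquiv k _).symm.toLinearMap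

theorem whitMap_mk (a : Cherednik W 0 c) :
    whitMap b hc lam (Submodule.Quotient.mk a) = whitAct b hc lam a (fun _ => Pi.single 1 1) := rfl

theorem whitMap_smul (a : Cherednik W 0 c) (m : Whittaker W 0 c lam) :
    whitMap b hc lam (a • m) = whitAct b hc lam a (whitMap b hc lam m) := by
  obtain ⟨a', rfl⟩ := Submodule.Quotient.mk_surjective _ m
  rw [← Submodule.Quotient.mk_smul, whitMap_mk, whitMap_mk, smul_eq_mul, map_mul,
    Module.End.mul_apply]

theorem gaudinRep_mul_C (f : regularSet W → k) (F : regularSet W → W → k) (h : regularSet W) :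
    (gaudinRep b lam hc).mul (fun h => C (f h)) F h = f h • F h := by
  rw [gaudinRep_mul, ← MvPolynomial.algebraMap_eq, AlgHom.commutes, Module.algebraMap_end_apply]

/-- Evaluation of functions at `h` gives a map from the fiber to `k^W`. -/
def fiberMap (h : regularSet W) : Fiber W c h.1 lam →ₗ[k] (W → k) :=
  (fiberKer W 0 c h.1 lam).liftQ (LinearMap.proj h ∘ₗ whitMap b hc lam) (by
    refine Submodule.span_le.2 ?_
    rintro _ ⟨ξ, m, rfl⟩
    rw [SetLike.mem_coe, LinearMap.mem_ker, LinearMap.comp_apply, whitMap_smul, map_sub, whitAct,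
      CovRep.cherednikHom_hx, AlgHom.commutes, LinearMap.sub_apply, map_sub, LinearMap.proj_apply,
      show posFun (r := r) W ξ = fun h => C (ξ h.1) from rfl, gaudinRep_mul_C, Module.algebraMap_end_apply, LinearMap.proj_apply, Pi.smul_apply,
      sub_self])

theorem fiberMap_mkQ (h : regularSet W) (m : Whittaker W 0 c lam) :
    fiberMap b hc lam h ((fiberKer W 0 c h.1 lam).mkQ m) = whitMap b hc lam m h := rfl

/-- This gives the linear independence of the classes `[w]`, which the spanning argument leaves
open: `[g]` goes to the constant function `δ_g`. -/
theorem fiberMap_toFiber (h : regularSet W) (f : W → k) :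
    fiberMap b hc lam h (toFiber W c h.1 lam f) = f := by
  rw [← LinearMap.comp_apply]
  conv_rhs => rw [← LinearMap.id_apply (R := k) f]
  congr 1
  refine LinearMap.pi_ext' fun g => LinearMap.ext_ring ?_
  simp only [LinearMap.comp_apply, LinearMap.coe_single, toFiber,
    Fintype.linearCombination_apply_single, one_smul, fiberMap_mkQ, whitMap_smul, LinearMap.id_apply]
  rw [whit, whitMap_mk, map_one, whitAct, CovRep.cherednikHom_hw, Module.End.one_apply]
  funext w
  rw [gaudinRep_act]
  by_cases hw : w = g
  · subst hw; simp
  · have : g⁻¹ * w ≠ 1 := fun h => hw (inv_mul_eq_one.1 h).symm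
    simp [hw, this]

/-- The fiber `M(h,λ)` is identified with `k^W`. -/
def fiberEquiv (h : regularSet W) : Fiber W c h.1 lam ≃ₗ[k] (W → k) :=
  LinearEquiv.ofLinearMap (fiberMap b hc lam h) (toFiber W c h.1 lam)
    (LinearMap.ext fun f => fiberMap_toFiber b hc lam h f) (LinearMap.ext fun x => by
      obtain ⟨f, rfl⟩ := toFiber_surjective c h.1 lam x
      rw [LinearMap.comp_apply, fiberMap_toFiber]; rfl)

/-- `momentum` is `δ` times the element that the Dunkl representation sends to `p_v`: its reflection
terms cancel the poles of `Θ(v)`, and in `gaudinRep` the momentum acts by the Gaudin operator. -/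
theorem fiberEquiv_gaudin (h : regularSet W) (v : V) (x : Fiber W c h.1 lam) :
    fiberEquiv b hc lam h (gaudin W c h.1 lam v x) =
      gaudinOp W lam c h.1 v (fiberEquiv b hc lam h x) := by
  obtain ⟨m, rfl⟩ := (fiberKer W 0 c h.1 lam).mkQ_surjective x
  change fiberMap b hc lam h _ = gaudinOp W lam c h.1 v (fiberMap b hc lam h _)
  have h1 : gaudin W c h.1 lam v ((fiberKer W 0 c h.1 lam).mkQ m) =
      (∏ s ∈ refls W, root s.1 h.1)⁻¹ • (fiberKer W 0 c h.1 lam).mkQ (momentum W c v • m) := rfl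
  have hδ : (∏ s ∈ refls W, root s.1 h.1) ≠ 0 :=
    Finset.prod_ne_zero_iff.2 fun s hs => root_ne_zero W h.2 s ((mem_refls W).1 hs)
  rw [h1, map_smul, inv_smul_eq_iff₀ hδ, fiberMap_mkQ, fiberMap_mkQ, whitMap_smul]
  generalize whitMap b hc lam m = F
  rw [momentum, map_add, map_mul, map_sum, whitAct, CovRep.cherednikHom_hy,
    CovRep.cherednikHom_rootProd, LinearMap.add_apply, Pi.add_apply, Module.End.mul_apply,
    gaudinRep_mul_C, LinearMap.sum_apply, Finset.sum_apply]
  funext w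
  rw [Pi.add_apply, Pi.smul_apply, gaudinRep_theta_apply, Finset.sum_apply, smul_sub,
    Finset.smul_sum, sub_add_eq_add_sub, sub_eq_iff_eq_add]
  congr 1
  refine Finset.sum_congr rfl fun s hs => ?_
  rw [map_smul, map_mul, CovRep.cherednikHom_rootProd, CovRep.cherednikHom_hw, LinearMap.smul_apply,
    Pi.smul_apply, Pi.smul_apply, Module.End.mul_apply, gaudinRep_mul_C, Pi.smul_apply,
    gaudinRep_act, smul_smul, smul_smul]
  congr 1
  have h2 := root_ne_zero W h.2 s ((mem_refls W).1 hs)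
  rw [← Finset.mul_prod_erase _ _ hs, rho]
  field_simp

end FiberEquiv

end

section

open CategoryTheory Abelian IsLocalRing RingTheory.Sequence
open scoped Pointwise

universe u

/-! ### Depth through `Ext`, and freeness over a local ring -/

section Depth

/-- The long exact sequence of `Ext(N, -)` for multiplication by a regular element. -/
theorem subsingleton_ext_quotSMulTop {S : Type u} [CommRing S] {N M : ModuleCat.{u} S} {n : ℕ}
    (hext : ∀ i < n + 1, Subsingleton (Ext N M i)) {x : S} (hx : IsSMulRegular M x) :
    ∀ i < n, Subsingleton (Ext N (ModuleCat.of S (QuotSMulTop x M)) i) := by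
  intro i hi
  have zero1 := AddCommGrpCat.isZero_of_iff_subsingleton.mpr (hext i (by omega))
  have zero2 := AddCommGrpCat.isZero_of_iff_subsingleton.mpr (hext (i + 1) (by omega))
  exact AddCommGrpCat.subsingleton_of_isZero <| ShortComplex.Exact.isZero_of_both_zeros
    ((Ext.covariant_sequence_exact₃' N hx.smulShortComplex_shortExact) i (i + 1) rfl)
    (zero1.eq_zero_of_src _) (zero2.eq_zero_of_tgt _)

theorem smul_top_quotSMulTop_ne_top {S M : Type*} [CommRing S] [AddCommGroup M] [Module S M]
    {I : Ideal S} {x : S} (hx : x ∈ I) (hI : I • (⊤ : Submodule S M) ≠ ⊤) :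
    I • (⊤ : Submodule S (QuotSMulTop x M)) ≠ ⊤ := by
  intro eq
  refine absurd (congrArg (Submodule.comap (Submodule.mkQ _)) eq) ?_
  simpa [Submodule.comap_smul_top_of_surjective I _ (Submodule.mkQ_surjective _),
    Submodule.smul_mono_left ((Ideal.span_singleton_le_iff_mem I).mpr hx),
    ← Submodule.ideal_span_singleton_smul] using hI

/-- If the depth of `M` along the ideal of `S` generated by `I` is at least `n`, then there is
an `M`-regular sequence of length `n` in `I` itself. -/
theorem exists_isRegular_algebraMap {A S : Type u} [CommRing A] [CommRing S] [IsNoetherianRing S]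
    [Algebra A S] (I : Ideal A) (n : ℕ) (M : ModuleCat.{u} S) [Module.Finite S M]
    (hI : I.map (algebraMap A S) • (⊤ : Submodule S M) ≠ ⊤)
    (hext : ∀ i < n, Subsingleton
      (Ext (ModuleCat.of S (S ⧸ I.map (algebraMap A S))) M i)) :
    ∃ rs : List A, rs.length = n ∧ (∀ a ∈ rs, a ∈ I) ∧ IsRegular M (rs.map (algebraMap A S)) := by
  induction n generalizing M with
  | zero =>
    have : Nontrivial M := (Submodule.nontrivial_iff S).mp (nontrivial_of_ne _ _ hI)
    exact ⟨[], rfl, by simp, by simp [isRegular_iff]⟩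
  | succ n ih =>
    have : Nontrivial M := (Submodule.nontrivial_iff S).mp (nontrivial_of_ne _ _ hI)
    have h0 : Subsingleton (ModuleCat.of S (S ⧸ I.map (algebraMap A S)) ⟶ M) :=
      Ext.addEquiv₀.subsingleton_congr.mp (hext 0 n.zero_lt_succ)
    have h1 : Subsingleton ((S ⧸ I.map (algebraMap A S)) →ₗ[S] M) :=
      (ModuleCat.homAddEquiv (M := ModuleCat.of S (S ⧸ I.map (algebraMap A S)))
        (N := M)).symm.toEquiv.subsingleton
    have hreg : ∃ a ∈ I, IsSMulRegular M (algebraMap A S a) := by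
      by_contra! hcon
      -- If no element of `I` is regular on `M`, prime avoidance puts `I` inside the contraction of
      -- an associated prime. The element with that annihilator gives a nonzero map from `S/IS` to
      -- `M`, against the vanishing of `Ext` in degree `0`.
      have hsub : (I : Set A) ⊆ ⋃ p ∈ associatedPrimes S M, (p.comap (algebraMap A S) : Set A) := by
        intro a ha
        have := hcon a ha
        have h2 : algebraMap A S a ∈ ⋃ p ∈ associatedPrimes S M, (p : Set S) := by
          rw [biUnion_associatedPrimes_eq_compl_regular S M]; exact this
        simpa using h2
      obtain ⟨p, hp, hle⟩ := (Ideal.subset_union_prime_finite (associatedPrimes.finite S M)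
        (f := fun p => p.comap (algebraMap A S)) ⊤ ⊤
        (fun p hp _ _ => have := hp.isPrime; Ideal.comap_isPrime _ p)).1 hsub
      obtain ⟨hpr, m, hm⟩ := isAssociatedPrime_iff.mp (AssociatedPrimes.mem_iff.mp hp)
      have hker : I.map (algebraMap A S) ≤ LinearMap.ker (LinearMap.toSpanSingleton S M m) :=
        fun a ha => by
        have h2 := (Ideal.map_le_iff_le_comap.2 hle) ha
        rw [hm, Submodule.mem_colon_singleton] at h2
        exact h2
      have h3 := h1.elim ((I.map (algebraMap A S)).liftQ (LinearMap.toSpanSingleton S M m) hker) 0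
      have h4 : m = 0 := by
        have h5 := LinearMap.congr_fun h3 (Submodule.Quotient.mk 1)
        rw [Submodule.liftQ_apply, LinearMap.toSpanSingleton_apply, one_smul] at h5
        exact h5
      refine hpr.ne_top ?_
      rw [hm, h4]
      simp
    obtain ⟨a, haI, ha⟩ := hreg
    obtain ⟨rs, hl, hmem, hrs⟩ := ih (ModuleCat.of S (QuotSMulTop (algebraMap A S a) M))
      (smul_top_quotSMulTop_ne_top (Ideal.mem_map_of_mem _ haI) hI)
      (subsingleton_ext_quotSMulTop hext ha)
    refine ⟨a :: rs, by simp [hl], by simpa using ⟨haI, hmem⟩, ?_⟩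
    rw [List.map_cons, isRegular_cons_iff]
    exact ⟨ha, hrs⟩

theorem maximalIdeal_eq_map_of_surjective {A B : Type*} [CommRing A] [CommRing B] [IsLocalRing A]
    [IsLocalRing B] (f : A →+* B) (hf : Function.Surjective f) :
    maximalIdeal B = (maximalIdeal A).map f := by
  refine le_antisymm (fun x hx => ?_) ?_
  · obtain ⟨a, rfl⟩ := hf x
    refine Ideal.mem_map_of_mem _ ?_
    exact fun ha => hx (ha.map f)
  · rcases Ideal.map_eq_top_or_isMaximal_of_surjective f hf (maximalIdeal.isMaximal A) with h | h
    · exfalso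
      have h2 : (⊥ : Ideal B).comap f ≤ maximalIdeal A :=
        le_maximalIdeal (by rw [ne_eq, Ideal.comap_eq_top_iff]; exact bot_ne_top)
      have := Ideal.comap_map_of_surjective f hf (maximalIdeal A)
      rw [h, Ideal.comap_top, sup_eq_left.2 h2] at this
      exact (maximalIdeal.isMaximal A).ne_top this.symm
    · exact (eq_maximalIdeal h).le

/-- A finite module of depth `n` over a Noetherian local ring whose maximal ideal has `n`
generators is free. -/
theorem free_of_isRegular (n : ℕ) : ∀ (A M : Type u) [CommRing A] [IsNoetherianRing A]
    [IsLocalRing A] [AddCommGroup M] [Module A M] [Module.Finite A M] (f : Fin n → A)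
    (_ : maximalIdeal A = Ideal.span (Set.range f)) (rs : List A) (_ : rs.length = n)
    (_ : ∀ a ∈ rs, a ∈ maximalIdeal A) (_ : IsRegular M rs), Module.Free A M := by
  induction n with
  | zero =>
    intro A M _ _ _ _ _ _ f hf rs _ _ _
    have hA : IsField A := isField_iff_maximalIdeal_eq.2 (by rw [hf]; simp)
    let := hA.toField
    exact Module.Free.of_divisionRing A M
  | succ n ih =>
    intro A M _ _ _ _ _ _ f hf rs hlen hmem hreg
    have := hreg.nontrivial
    have hlt : maximalIdeal A • (⊤ : Submodule A M) ≠ ⊤ :=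
      (Submodule.top_ne_ideal_smul_of_le_jacobson_annihilator (maximalIdeal_le_jacobson _)).symm
    obtain ⟨r₀, hr₀, hr₀reg⟩ : ∃ a ∈ maximalIdeal A, IsSMulRegular M a := by
      cases rs with
      | nil => simp at hlen
      | cons a as => exact ⟨a, hmem a (by simp), ((isRegular_cons_iff M a as).1 hreg).1⟩
    obtain ⟨x, hx, hxsq, hxreg⟩ : ∃ x ∈ maximalIdeal A, x ∉ maximalIdeal A ^ 2 ∧
        IsSMulRegular M x := by
      by_contra! hcon
      -- Prime avoidance for the associated primes together with `m²`, the only member of the family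
      -- that need not be prime. If `m ⊆ m²`, Nakayama gives `m = 0`, and then `r₀ = 0` is not
      -- regular on the nonzero module `M`.
      have hsub : (maximalIdeal A : Set A) ⊆
          ⋃ p ∈ insert (maximalIdeal A ^ 2) (associatedPrimes A M), (id p : Ideal A) := by
        intro a ha
        rw [Set.biUnion_insert]
        by_cases h2 : a ∈ maximalIdeal A ^ 2
        · exact Or.inl h2
        · refine Or.inr ?_
          have := hcon a ha h2
          simp only [id]
          rw [biUnion_associatedPrimes_eq_compl_regular A M]
          exact this
      obtain ⟨p, hp, hle⟩ := (Ideal.subset_union_prime_finite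
        ((associatedPrimes.finite A M).insert _) (f := id) (maximalIdeal A ^ 2) (maximalIdeal A ^ 2)
        (fun p hp h _ => (hp.resolve_left h).isPrime)).1 hsub
      rcases hp with rfl | hp
      · have h0 : maximalIdeal A = ⊥ := by
          refine Submodule.eq_bot_of_le_smul_of_le_jacobson_bot (maximalIdeal A) _
            (IsNoetherian.noetherian _) ?_ (maximalIdeal_le_jacobson _)
          simpa [pow_two] using hle
        rw [h0, Ideal.mem_bot] at hr₀
        subst hr₀
        obtain ⟨m, hm⟩ := exists_ne (0 : M)
        exact hm (hr₀reg (by simp))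
      · have h1 : r₀ ∈ ⋃ p ∈ associatedPrimes A M, (p : Set A) :=
          Set.mem_biUnion hp (hle hr₀)
        rw [biUnion_associatedPrimes_eq_compl_regular A M] at h1
        exact h1 hr₀reg
    have hspan := hx
    rw [hf] at hspan
    obtain ⟨a, ha⟩ := (Submodule.mem_span_range_iff_exists_fun A).1 hspan
    have hfm : ∀ i, f i ∈ maximalIdeal A := fun i => by
      rw [hf]; exact Ideal.subset_span ⟨i, rfl⟩
    -- As `x ∉ m²`, some coefficient of `x` is a unit. That generator becomes redundant modulo `x`,
    -- and the maximal ideal of `A/x` is generated by `n` elements.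
    obtain ⟨j, hj⟩ : ∃ j, IsUnit (a j) := by
      by_contra! hcon
      refine hxsq ?_
      rw [← ha, pow_two]
      exact Ideal.sum_mem _ fun i _ => Ideal.mul_mem_mul (hcon i) (hfm i)
    have hne : Ideal.span {x} ≠ ⊤ := by
      rw [Ne, Ideal.span_singleton_eq_top]; exact hx
    have : Nontrivial (A ⧸ Ideal.span {x}) := Ideal.Quotient.nontrivial_iff.2 hne
    have : IsLocalRing (A ⧸ Ideal.span {x}) :=
      IsLocalRing.of_surjective' _ Ideal.Quotient.mk_surjective
    have hgen : maximalIdeal (A ⧸ Ideal.span {x}) =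
        Ideal.span (Set.range fun i => Ideal.Quotient.mk (Ideal.span {x}) (f (j.succAbove i))) := by
      rw [maximalIdeal_eq_map_of_surjective _ Ideal.Quotient.mk_surjective, hf, Ideal.map_span]
      refine le_antisymm (Ideal.span_le.2 ?_) (Ideal.span_mono ?_)
      · rintro _ ⟨_, ⟨i, rfl⟩, rfl⟩
        rcases Fin.eq_self_or_eq_succAbove j i with rfl | ⟨i, rfl⟩
        · have h1 := congrArg (Ideal.Quotient.mk (Ideal.span {x})) ha
          rw [Ideal.Quotient.eq_zero_iff_mem.2 (Ideal.mem_span_singleton_self x), map_sum,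
            Fin.sum_univ_succAbove _ i, smul_eq_mul, map_mul] at h1
          have h2 := hj.map (Ideal.Quotient.mk (Ideal.span {x}))
          refine (Ideal.unit_mul_mem_iff_mem _ h2).1 ?_
          rw [eq_neg_of_add_eq_zero_left h1]
          refine neg_mem (Ideal.sum_mem _ fun l _ => ?_)
          rw [smul_eq_mul, map_mul]
          exact Ideal.mul_mem_left _ _ (Ideal.subset_span ⟨l, rfl⟩)
        · exact Ideal.subset_span ⟨i, rfl⟩
      · rintro _ ⟨i, rfl⟩
        exact ⟨_, ⟨_, rfl⟩, rfl⟩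
    have hN : Nontrivial (A ⧸ maximalIdeal A) :=
      Ideal.Quotient.nontrivial_iff.2 (maximalIdeal.isMaximal A).ne_top
    have hsupp : Module.support A (A ⧸ maximalIdeal A) =
        PrimeSpectrum.zeroLocus (maximalIdeal A) := by
      rw [Module.support_eq_zeroLocus, Ideal.annihilator_quotient]
    -- Vanishing of `Ext` does not depend on the regular sequence chosen, so `M/xM` has depth at
    -- least `n` although `rs` need not begin with `x`.
    have hext : ∀ i < n + 1, Subsingleton
        (Ext (ModuleCat.of A (A ⧸ maximalIdeal A)) (ModuleCat.of A M) i) := by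
      rw [← hlen]
      exact ModuleCat.subsingleton_ext_of_exists_isRegular (maximalIdeal A)
        (ModuleCat.of A (A ⧸ maximalIdeal A)) hsupp.le (ModuleCat.of A M) hlt.lt_top rs hmem hreg
    obtain ⟨rs', hlen', hmem', hreg'⟩ :=
      ModuleCat.exists_isRegular_of_exists_subsingleton_ext (maximalIdeal A) n
        (ModuleCat.of A (QuotSMulTop x M)) (smul_top_quotSMulTop_ne_top hx hlt).lt_top
        (ModuleCat.of A (A ⧸ maximalIdeal A)) hsupp
        (subsingleton_ext_quotSMulTop hext hxreg)
    have hcons : IsRegular M (x :: rs') := (isRegular_cons_iff M x rs').2 ⟨hxreg, hreg'⟩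
    have : Module.Finite (A ⧸ Ideal.span {x}) (QuotSMulTop x M) :=
      Module.Finite.of_restrictScalars_finite A _ _
    have : Module.FinitePresentation A M := Module.finitePresentation_of_finite A M
    refine (Module.free_quotSMulTop_iff_free A M (maximalIdeal_le_jacobson _ hx) hxreg).1 ?_
    refine ih (A ⧸ Ideal.span {x}) (QuotSMulTop x M) _ hgen
      (rs'.map (Ideal.Quotient.mk (Ideal.span {x}))) (by simpa using hlen') ?_
      ((isRegular_cons_iff' M x rs').1 hcons).2
    intro b hb
    obtain ⟨a, ha, rfl⟩ := List.mem_map.1 hb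
    rw [maximalIdeal_eq_map_of_surjective _ Ideal.Quotient.mk_surjective]
    exact Ideal.mem_map_of_mem _ (hmem' a ha)

end Depth

end

/-! ### Flatness of a polynomial ring over a subring of full dimension -/

section

open CategoryTheory Abelian IsLocalRing RingTheory.Sequence
open scoped Pointwise

universe u

/-- A finite algebra which, along every maximal ideal of the base, has depth equal to the number
of generators of this ideal is flat. -/
theorem flat_of_isWeaklyRegular {A S : Type u} [CommRing A] [CommRing S] [IsNoetherianRing A]
    [IsNoetherianRing S] [Algebra A S] [Module.Finite A S] (n : ℕ)
    (H : ∀ m : Ideal A, m.IsMaximal → (∃ f : Fin n → A, m = Ideal.span (Set.range f)) ∧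
      m.map (algebraMap A S) ≠ ⊤ ∧ ∃ gs : List S, gs.length = n ∧
        (∀ g ∈ gs, g ∈ m.map (algebraMap A S)) ∧ IsWeaklyRegular S gs) :
    Module.Flat A S := by
  refine Module.flat_of_localized_maximal S fun m hm => ?_
  obtain ⟨⟨f, hf⟩, hne, gs, hlen, hmem, hreg⟩ := H m hm
  have hgs : IsRegular S gs := by
    refine ⟨hreg, fun htop => hne (top_le_iff.1 ?_)⟩
    rw [htop]
    change Ideal.ofList gs * ⊤ ≤ _
    rw [Ideal.mul_top]
    exact Ideal.span_le.2 hmem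
  have hne' : m.map (algebraMap A S) • (⊤ : Submodule S S) ≠ ⊤ := by simpa using hne
  have hsupp : Module.support S (S ⧸ m.map (algebraMap A S)) =
      PrimeSpectrum.zeroLocus (m.map (algebraMap A S)) := by
    rw [Module.support_eq_zeroLocus, Ideal.annihilator_quotient]
  have hext := ModuleCat.subsingleton_ext_of_exists_isRegular (m.map (algebraMap A S))
        (ModuleCat.of S (S ⧸ m.map (algebraMap A S))) hsupp.le (ModuleCat.of S S) hne'.lt_top
        gs hmem hgs
  rw [hlen] at hext
  -- The sequence `gs` lies in `S`; it is traded for one coming from `m` itself, which still makes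
  -- sense after localizing `S` at `m` as an `A`-module.
  obtain ⟨rs, hl, hrm, hrs⟩ := exists_isRegular_algebraMap m n (ModuleCat.of S S) hne' hext
  have hrs' : IsWeaklyRegular S rs := (isWeaklyRegular_map_algebraMap_iff S S rs).1 hrs.1
  have hnt : Nontrivial (LocalizedModule m.primeCompl S) := by
    refine (Module.mem_support_iff_of_finite (p := ⟨m, hm.isPrime⟩)).2 fun a ha => ?_
    by_contra ham
    obtain ⟨x, y, hy, hxy⟩ := hm.exists_inv ham
    refine hne ((Ideal.eq_top_iff_one _).2 ?_)
    have h1 := congrArg (algebraMap A S) hxy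
    have h2 : algebraMap A S a = 0 := by
      rw [Algebra.algebraMap_eq_smul_one]; exact Module.mem_annihilator.1 ha 1
    rw [map_add, map_mul, h2, mul_zero, zero_add, map_one] at h1
    rw [← h1]
    exact Ideal.mem_map_of_mem _ hy
  have hfin : Module.Finite (Localization.AtPrime m) (LocalizedModule m.primeCompl S) :=
    inferInstance
  have hreg2 := hrs'.isRegular_of_isLocalizedModule_of_mem (Localization.AtPrime m) m
    (LocalizedModule.mkLinearMap m.primeCompl S) hrm
  have hgen : maximalIdeal (Localization.AtPrime m) =
      Ideal.span (Set.range fun i => algebraMap A (Localization.AtPrime m) (f i)) := by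
    rw [← Localization.AtPrime.map_eq_maximalIdeal, ← Function.comp_def, Set.range_comp,
      ← Ideal.map_span, ← hf]
  have := free_of_isRegular n _ _ _ hgen (rs.map (algebraMap A (Localization.AtPrime m)))
    (by simpa using hl) (by
      intro b hb
      obtain ⟨a, ha, rfl⟩ := List.mem_map.1 hb
      rw [← Localization.AtPrime.map_eq_maximalIdeal]
      exact Ideal.mem_map_of_mem _ (hrm a ha)) hreg2
  have hflat : Module.Flat A (Localization.AtPrime m) := IsLocalization.flat _ m.primeCompl
  exact Module.Flat.trans A (Localization.AtPrime m) _

/-- The monic polynomials `g₁(X₁), …, gₙ(Xₙ)` form a regular sequence in some order. -/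
theorem exists_isWeaklyRegular_monic (k : Type u) [Field k] (n : ℕ) : ∀ (g : Fin n → Polynomial k)
    (_ : ∀ i, (g i).Monic), ∃ gs : List (MvPolynomial (Fin n) k), gs.length = n ∧
      (∀ p ∈ gs, ∃ i, p = Polynomial.aeval (MvPolynomial.X i : MvPolynomial (Fin n) k) (g i)) ∧
      IsWeaklyRegular (MvPolynomial (Fin n) k) gs := by
  induction n with
  | zero => exact fun g _ => ⟨[], rfl, by simp, by simp⟩
  | succ n ih =>
    intro g hg
    obtain ⟨gs, hlen, hmem, hreg⟩ := ih (fun i => g i.succ) fun i => hg _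
    let e := MvPolynomial.finSuccEquiv k n
    let q : Polynomial (MvPolynomial (Fin n) k) := (g 0).map MvPolynomial.C
    have hq : q.Monic := (hg 0).map _
    have h1 : IsWeaklyRegular (Polynomial (MvPolynomial (Fin n) k))
        (gs.map Polynomial.C ++ [q]) := by
      rw [isWeaklyRegular_append_iff, isWeaklyRegular_singleton_iff]
      refine ⟨hreg.of_flat (S := Polynomial (MvPolynomial (Fin n) k)), ?_⟩
      -- Modulo the earlier terms the ring is again a polynomial ring in the variable `X₀`, where a
      -- monic polynomial is a nonzerodivisor.
      refine (isSMulRegular_iff_right_eq_zero_of_smul).2 fun x hx => ?_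
      obtain ⟨p, rfl⟩ := Submodule.Quotient.mk_surjective _ x
      rw [← Submodule.Quotient.mk_smul, Submodule.Quotient.mk_eq_zero] at hx
      rw [Submodule.Quotient.mk_eq_zero]
      have hI : (Ideal.ofList (gs.map Polynomial.C) •
          (⊤ : Submodule (Polynomial (MvPolynomial (Fin n) k)) _)) =
          RingHom.ker (Polynomial.mapRingHom (Ideal.Quotient.mk (Ideal.ofList gs))) := by
        rw [Polynomial.ker_mapRingHom, Ideal.mk_ker, Ideal.map_ofList]
        simp
      rw [hI, RingHom.mem_ker] at hx ⊢
      rw [smul_eq_mul, map_mul] at hx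
      exact ((hq.map (Ideal.Quotient.mk (Ideal.ofList gs))).mul_right_eq_zero_iff).1 hx
    refine ⟨(gs.map Polynomial.C ++ [q]).map e.symm, by simp [hlen], ?_, ?_⟩
    · intro p hp
      rw [List.map_append, List.mem_append, List.map_map, List.map_singleton,
        List.mem_singleton, List.mem_map] at hp
      rcases hp with ⟨p, hp, rfl⟩ | rfl
      · obtain ⟨i, rfl⟩ := hmem p hp
        refine ⟨i.succ, ?_⟩
        rw [Function.comp_apply, AlgEquiv.symm_apply_eq]
        refine Eq.trans ?_ (Polynomial.aeval_algHom_apply e.toAlgHom _ _)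
        change _ = Polynomial.aeval (e _) _
        rw [MvPolynomial.finSuccEquiv_X_succ, Polynomial.aeval_def, Polynomial.aeval_def,
          Polynomial.hom_eval₂]
        rfl
      · refine ⟨0, ?_⟩
        rw [AlgEquiv.symm_apply_eq]
        refine Eq.trans ?_ (Polynomial.aeval_algHom_apply e.toAlgHom _ _)
        change _ = Polynomial.aeval (e _) _
        rw [MvPolynomial.finSuccEquiv_X_zero]
        rfl
    · refine (AddEquiv.isWeaklyRegular_congr (e := e.symm.toRingEquiv.toAddEquiv) ?_).1 h1
      rw [List.forall₂_map_right_iff]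
      exact List.forall₂_same.2 fun r _ x => by simp

/-- A finite injective extension `A → k[X₁, …, Xₙ]` is flat if every maximal ideal of `A` is the
kernel of a `k`-point and is generated by `n` elements. -/
theorem flat_mvPolynomial {k A : Type u} [Field k] [CommRing A] [Algebra k A] [IsNoetherianRing A]
    (n : ℕ) [Algebra A (MvPolynomial (Fin n) k)] [IsScalarTower k A (MvPolynomial (Fin n) k)]
    [FaithfulSMul A (MvPolynomial (Fin n) k)]
    [Module.Finite A (MvPolynomial (Fin n) k)]
    (H : ∀ m : Ideal A, m.IsMaximal → (∃ f : Fin n → A, m = Ideal.span (Set.range f)) ∧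
      ∃ φ : A →ₐ[k] k, m = RingHom.ker φ) :
    Module.Flat A (MvPolynomial (Fin n) k) := by
  refine flat_of_isWeaklyRegular n fun m hm => ⟨(H m hm).1, ?_, ?_⟩
  · intro htop
    obtain ⟨Q, hQ, hQm⟩ := Ideal.exists_ideal_over_maximal_of_isIntegral
      (S := MvPolynomial (Fin n) k) m (by
        rw [(RingHom.injective_iff_ker_eq_bot (algebraMap A (MvPolynomial (Fin n) k))).1
          (FaithfulSMul.algebraMap_injective _ _)]
        exact bot_le)
    exact hQ.ne_top (top_le_iff.1 (htop.symm.le.trans (Ideal.map_le_iff_le_comap.2 hQm.ge)))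
  · obtain ⟨φ, hφ⟩ := (H m hm).2
    let π := Ideal.Quotient.mk (m.map (algebraMap A (MvPolynomial (Fin n) k)))
    have hπ : π.comp (algebraMap A (MvPolynomial (Fin n) k)) =
        (π.comp (algebraMap k (MvPolynomial (Fin n) k))).comp (φ : A →+* k) := by
      ext a
      refine Ideal.Quotient.eq.2 ?_
      change algebraMap A _ a - algebraMap k _ (φ a) ∈ _
      rw [IsScalarTower.algebraMap_apply k A (MvPolynomial (Fin n) k),
        ← map_sub]
      refine Ideal.mem_map_of_mem _ ?_
      rw [hφ, RingHom.mem_ker]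
      simp
    -- An integral equation of `X_i` over `A`, reduced at the `k`-point of `m`, becomes a monic
    -- polynomial over `k` whose value at `X_i` lies in the extension of `m`.
    have hint : ∀ i, ∃ g : Polynomial k, g.Monic ∧
        Polynomial.aeval (MvPolynomial.X i : MvPolynomial (Fin n) k) g ∈
          m.map (algebraMap A (MvPolynomial (Fin n) k)) := by
      intro i
      obtain ⟨p, hp, hp0⟩ := Algebra.IsIntegral.isIntegral (R := A)
        (MvPolynomial.X i : MvPolynomial (Fin n) k)
      refine ⟨p.map (φ : A →+* k), hp.map _, ?_⟩
      rw [← Ideal.Quotient.eq_zero_iff_mem]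
      have := congrArg π hp0
      rw [Polynomial.hom_eval₂, hπ, ← Polynomial.eval₂_map, map_zero] at this
      rwa [Polynomial.aeval_def, Polynomial.hom_eval₂]
    choose g hg hgm using hint
    obtain ⟨gs, h1, h2, h3⟩ := exists_isWeaklyRegular_monic k n g hg
    refine ⟨gs, h1, fun p hp => ?_, h3⟩
    obtain ⟨i, rfl⟩ := h2 p hp
    exact hgm i

end

section

open scoped TensorProduct

/-- The rank of a finite flat algebra over a domain is the dimension of any of its fibers. -/
theorem finrank_quotient_map_ker {k Z R : Type*} [Field k] [CommRing Z] [IsDomain Z] [CommRing R]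
    [Algebra k Z] [Algebra Z R] [Algebra k R] [IsScalarTower k Z R] [Module.Flat Z R]
    [Module.Finite Z R] (φ : Z →ₐ[k] k) :
    finrank k (R ⧸ (RingHom.ker φ).map (algebraMap Z R)) = finrank Z R := by
  let : Algebra Z k := φ.toRingHom.toAlgebra
  have hs : Function.Surjective (Algebra.linearMap Z k) := fun a => ⟨algebraMap k _ a, by
    change φ (algebraMap k Z a) = a
    simp⟩
  have : IsScalarTower k Z k := IsScalarTower.of_algebraMap_eq fun a => by
    change a = φ (algebraMap k Z a)
    simp
  have hker : RingHom.ker φ = LinearMap.ker (Algebra.linearMap Z k) := rfl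
  let e₁ : (Z ⧸ RingHom.ker φ) ≃ₗ[Z] k :=
    (Submodule.quotEquivOfEq _ _ hker).trans
      ((Algebra.linearMap Z k).quotKerEquivOfSurjective hs)
  let e : k ⊗[Z] R ≃ₗ[Z] R ⧸ (RingHom.ker φ).map (algebraMap Z R) :=
    (TensorProduct.congr e₁.symm (LinearEquiv.refl Z R)).trans <|
      (TensorProduct.quotTensorEquivQuotSMul R (RingHom.ker φ)).trans <|
        (Submodule.quotEquivOfEq _ _ (Ideal.smul_top_eq_map _)).trans <|
          Submodule.Quotient.restrictScalarsEquiv Z _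
  have : (RingHom.ker φ).IsPrime := RingHom.ker_isPrime _
  rw [← (e.restrictScalars k).finrank_eq, ← Ideal.finrank_fiber_eq_finrank (RingHom.ker φ),
    Ideal.finrank_fiber_eq_rankAtStalk]
  have h1 := Module.rankAtStalk_baseChange (R := Z) (M := R) (S := k) ⊥
  rw [Module.rankAtStalk_eq_finrank_of_free] at h1
  refine h1.trans ?_
  congr 1

/-! ### The quotient `𝔥* → 𝔥*/W`: flatness, orbits and length of the fibers -/

section Invariants

variable {k V : Type*} [Field k] [AddCommGroup V] [Module k V] {r : ℕ} (b : Basis (Fin r) k V)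

theorem sub_C_mem_pointIdeal (μ : Dual k V) (f : MvPolynomial (Fin r) k) :
    f - MvPolynomial.C (evalAt b μ f) ∈ pointIdeal b μ := by
  rw [pointIdeal, RingHom.mem_ker, map_sub, sub_eq_zero, evalAt]
  simp

theorem pointIdeal_isMaximal (μ : Dual k V) : (pointIdeal b μ).IsMaximal :=
  RingHom.ker_isMaximal_of_surjective _ fun a => ⟨MvPolynomial.C a, by simp [evalAt]⟩

theorem pointIdeal_le_iff {μ ν : Dual k V} : pointIdeal b μ ≤ pointIdeal b ν ↔ μ = ν := by
  refine ⟨fun h => b.ext fun i => ?_, fun h => h ▸ le_rfl⟩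
  have h1 := h (sub_C_mem_pointIdeal b μ (MvPolynomial.X i))
  rw [pointIdeal, RingHom.mem_ker] at h1
  rw [map_sub, sub_eq_zero] at h1
  simpa [evalAt] using h1.symm

theorem exists_eq_pointIdeal [IsAlgClosed k] {I : Ideal (MvPolynomial (Fin r) k)}
    (hI : I.IsMaximal) : ∃ μ, I = pointIdeal b μ := by
  obtain ⟨x, rfl⟩ := (MvPolynomial.isMaximal_iff_eq_vanishingIdeal_singleton (K := k)).1 hI
  refine ⟨b.constr k x, ?_⟩
  ext f
  rw [MvPolynomial.mem_vanishingIdeal_singleton_iff, pointIdeal, RingHom.mem_ker, evalAt]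
  simp

variable (W : Subgroup (V ≃ₗ[k] V))

/-- The action of `W` on the ring `S𝔥`. -/
abbrev polyAction : MulSemiringAction W (MvPolynomial (Fin r) k) where
  smul g f := polyAct b g.1 f
  one_smul f := by
    change polyAct b 1 f = f
    rw [polyAct_one]; rfl
  mul_smul g g' f := by
    change polyAct b (g.1 * g'.1) f = _
    rw [polyAct_mul]; rfl
  smul_zero g := map_zero _
  smul_add g := map_add _
  smul_one g := map_one _
  smul_mul g := map_mul _

/-- Faithfulness is visible on linear forms. This structure yields integrality, transitivity of `W`
on the fibers and the rank `|W|`. -/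
theorem isGaloisGroup_invariants :
    letI := polyAction b W
    IsGaloisGroup W (invariants b W) (MvPolynomial (Fin r) k) := by
  let := polyAction b W
  refine ⟨⟨fun {g g'} h => ?_⟩, ⟨fun g z f => ?_⟩, ⟨fun f hf => ⟨⟨f, (mem_invariants b).2 hf⟩, rfl⟩⟩⟩
  · refine Subtype.ext (LinearEquiv.ext fun v => linForm_injective b ?_)
    have := h (linForm b v)
    change polyAct b g.1 _ = polyAct b g'.1 _ at this
    rwa [polyAct_linForm, polyAct_linForm] at this
  · change polyAct b g.1 (z.1 * f) = z.1 * polyAct b g.1 f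
    rw [map_mul, (mem_invariants b).1 z.2 g]

variable [Finite W]

theorem isIntegral_invariants : Algebra.IsIntegral (invariants b W) (MvPolynomial (Fin r) k) := by
  let := polyAction b W
  have := isGaloisGroup_invariants b W
  have := this.isInvariant
  exact Algebra.IsInvariant.isIntegral (invariants b W) (MvPolynomial (Fin r) k) W

theorem finite_invariants : Module.Finite (invariants b W) (MvPolynomial (Fin r) k) := by
  have := isIntegral_invariants b W
  have : Algebra.FiniteType (invariants b W) (MvPolynomial (Fin r) k) :=
    Algebra.FiniteType.of_restrictScalars_finiteType k _ _
  exact Algebra.IsIntegral.finite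

theorem exists_pointIdeal_comap [IsAlgClosed k] {m : Ideal (invariants b W)} (hm : m.IsMaximal) :
    ∃ μ, (pointIdeal b μ).comap (algebraMap (invariants b W) (MvPolynomial (Fin r) k)) = m := by
  have := isIntegral_invariants b W
  obtain ⟨Q, hQ, hQm⟩ := Ideal.exists_ideal_over_maximal_of_isIntegral
      (S := MvPolynomial (Fin r) k) m (by
        rw [(RingHom.injective_iff_ker_eq_bot (algebraMap (invariants b W) _)).1
          Subtype.val_injective]
        exact bot_le)
  obtain ⟨μ, rfl⟩ := exists_eq_pointIdeal b hQ
  exact ⟨μ, hQm⟩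

variable {W} {P : Fin r → MvPolynomial (Fin r) k}
  (hP_gen : Algebra.adjoin k (Set.range P) = invariants b W)

include hP_gen

omit [Finite W] in
theorem generator_mem (j : Fin r) : P j ∈ invariants b W :=
  hP_gen ▸ Algebra.subset_adjoin ⟨j, rfl⟩

omit [Finite W] in
theorem evalAt_eq_of_generators {μ ν : Dual k V}
    (h : ∀ j, evalAt b μ (P j) = evalAt b ν (P j)) {f : MvPolynomial (Fin r) k}
    (hf : f ∈ invariants b W) : evalAt b μ f = evalAt b ν f := by
  rw [← hP_gen] at hf
  have : Algebra.adjoin k (Set.range P) ≤ AlgHom.equalizer (evalAt b μ) (evalAt b ν) :=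
    Algebra.adjoin_le (by rintro _ ⟨j, rfl⟩; exact h j)
  exact this hf

/-- The values of the generators of the invariants separate the orbits. -/
theorem exists_act_eq_of_generators {μ ν : Dual k V}
    (h : ∀ j, evalAt b μ (P j) = evalAt b ν (P j)) : ∃ g : W, μ = ν ∘ₗ g.1.toLinearMap := by
  let := polyAction b W
  have hG := isGaloisGroup_invariants b W
  have := hG.isInvariant
  have := hG.commutes
  obtain ⟨g, hg⟩ := Algebra.IsInvariant.exists_smul_of_under_eq (invariants b W)
    (MvPolynomial (Fin r) k) W (pointIdeal b ν) (pointIdeal b μ) (by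
      ext z
      change evalAt b ν z.1 = 0 ↔ evalAt b μ z.1 = 0
      rw [evalAt_eq_of_generators b hP_gen h z.2])
  refine ⟨g⁻¹, (pointIdeal_le_iff b).1 fun f hf => ?_⟩
  rw [hg, Ideal.mem_pointwise_smul_iff_inv_smul_mem] at hf
  change evalAt b ν (polyAct b (g⁻¹ : W).1 f) = 0 at hf
  rw [evalAt_polyAct] at hf
  exact hf

omit [Finite W] in
/-- The maximal ideal of the invariants attached to a point is generated by the `P j - P j (μ)`. -/
theorem comap_pointIdeal_eq_span (μ : Dual k V) :
    (pointIdeal b μ).comap (algebraMap (invariants b W) (MvPolynomial (Fin r) k)) =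
      Ideal.span (Set.range fun j => (⟨P j, generator_mem b hP_gen j⟩ : invariants b W) -
        algebraMap k _ (evalAt b μ (P j))) := by
  set I := Ideal.span (Set.range fun j => (⟨P j, generator_mem b hP_gen j⟩ : invariants b W) -
        algebraMap k _ (evalAt b μ (P j))) with hI
  have key : ∀ z : invariants b W, z - algebraMap k _ (evalAt b μ z.1) ∈ I := by
    intro z
    obtain ⟨z, hz⟩ := z
    have hz' := hz
    rw [← hP_gen, Algebra.adjoin_range_eq_range_aeval] at hz'
    obtain ⟨q, rfl⟩ := hz'
    have h1 : (⟨MvPolynomial.aeval P q, hz⟩ : invariants b W) = MvPolynomial.aeval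
        (fun j => (⟨P j, generator_mem b hP_gen j⟩ : invariants b W)) q := by
      refine Subtype.ext ?_
      change _ = (invariants b W).val _
      rw [← AlgHom.comp_apply, MvPolynomial.comp_aeval]
      rfl
    change (⟨MvPolynomial.aeval P q, hz⟩ : invariants b W) -
      algebraMap k _ (evalAt b μ (MvPolynomial.aeval P q)) ∈ I
    rw [h1, ← AlgHom.comp_apply (evalAt b μ), MvPolynomial.comp_aeval, ← Ideal.Quotient.eq]
    have h2 : (Ideal.Quotient.mkₐ k I).comp (MvPolynomial.aeval
        (fun j => (⟨P j, generator_mem b hP_gen j⟩ : invariants b W))) =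
        (Algebra.ofId k _).comp (MvPolynomial.aeval fun i => evalAt b μ (P i)) := by
      ext j
      simp only [AlgHom.comp_apply, MvPolynomial.aeval_X]
      exact Ideal.Quotient.eq.2 (Ideal.subset_span ⟨j, rfl⟩)
    exact AlgHom.congr_fun h2 q
  refine le_antisymm (fun z hz => ?_) (Ideal.span_le.2 ?_)
  · have h1 : evalAt b μ z.1 = 0 := hz
    simpa [h1] using key z
  · rintro _ ⟨j, rfl⟩
    exact sub_C_mem_pointIdeal b μ (P j)

omit [Finite W] in
theorem isNoetherianRing_invariants : IsNoetherianRing (invariants b W) := by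
  have : Algebra.FiniteType k (invariants b W) := by
    rw [← Subalgebra.fg_iff_finiteType, ← hP_gen]
    exact Subalgebra.fg_def.2 ⟨_, Set.finite_range P, rfl⟩
  exact Algebra.FiniteType.isNoetherianRing k _

/-- The invariants have as many generators as there are variables, so each maximal ideal is
generated by `r` elements, the length of the regular sequence found in its extension to `S𝔥`. -/
theorem flat_invariants [IsAlgClosed k] :
    Module.Flat (invariants b W) (MvPolynomial (Fin r) k) := by
  have := isNoetherianRing_invariants b hP_gen
  have := finite_invariants b W
  refine flat_mvPolynomial r fun m hm => ?_
  obtain ⟨μ, rfl⟩ := exists_pointIdeal_comap b W hm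
  exact ⟨⟨_, comap_pointIdeal_eq_span b hP_gen μ⟩, (evalAt b μ).comp (invariants b W).val, rfl⟩

omit [Finite W] in
theorem map_comap_pointIdeal (μ : Dual k V) :
    ((pointIdeal b μ).comap (algebraMap (invariants b W) (MvPolynomial (Fin r) k))).map
      (algebraMap (invariants b W) (MvPolynomial (Fin r) k)) =
    Ideal.span (Set.range fun j => P j - MvPolynomial.C (evalAt b μ (P j))) := by
  rw [comap_pointIdeal_eq_span b hP_gen, Ideal.map_span, ← Set.range_comp]
  rfl

/-- The fibers of `𝔥* → 𝔥*/W` have length `|W|`. -/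
theorem finrank_quotient_generators [IsAlgClosed k] (μ : Dual k V) :
    finrank k (MvPolynomial (Fin r) k ⧸
      Ideal.span (Set.range fun j => P j - MvPolynomial.C (evalAt b μ (P j)))) = Nat.card W := by
  have := flat_invariants b hP_gen
  have := finite_invariants b W
  let := polyAction b W
  have hG := isGaloisGroup_invariants b W
  rw [IsGaloisGroup.card_eq_finrank' W (invariants b W) (MvPolynomial (Fin r) k),
    ← map_comap_pointIdeal b hP_gen]
  exact finrank_quotient_map_ker ((evalAt b μ).comp (invariants b W).val)

end Invariants

end

section

open scoped TensorProduct

/-! ### Dimension of the localization at a point -/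

section LocalDimension

variable {k A : Type*} [Field k] [CommRing A] [Algebra k A] (p : Ideal A) [p.IsPrime]

/-- The dimension over `k` of the localization at `p` of an `A`-module. -/
def localDim (k : Type*) {A : Type*} [Field k] [CommRing A] [Algebra k A] (p : Ideal A) [p.IsPrime]
    (M : Type*) [AddCommGroup M] [Module A M] : ℕ :=
  finrank k (Localization.AtPrime p ⊗[A] M)

variable {M M' M'' : Type*} [AddCommGroup M] [Module A M] [AddCommGroup M'] [Module A M']
  [AddCommGroup M''] [Module A M'']

theorem localDim_congr (e : M ≃ₗ[A] M') : localDim k p M = localDim k p M' :=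
  ((TensorProduct.AlgebraTensorModule.congr
    (LinearEquiv.refl (Localization.AtPrime p) _) e).restrictScalars k).finrank_eq

theorem localDim_eq_zero_of_subsingleton [Subsingleton M] : localDim k p M = 0 :=
  finrank_zero_of_subsingleton

/-- Localization is flat. Finiteness of the middle term is needed because `finrank` is `0` on
infinite-dimensional spaces. -/
theorem localDim_add (f : M →ₗ[A] M') (g : M' →ₗ[A] M'') (hf : Function.Injective f)
    (hg : Function.Surjective g) (hfg : Function.Exact f g)
    (hfin : FiniteDimensional k (Localization.AtPrime p ⊗[A] M')) :
    localDim k p M' = localDim k p M + localDim k p M'' := by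
  have : Module.Flat A (Localization.AtPrime p) := IsLocalization.flat _ p.primeCompl
  let F : Localization.AtPrime p ⊗[A] M →ₗ[k] Localization.AtPrime p ⊗[A] M' :=
    (TensorProduct.AlgebraTensorModule.lTensor (Localization.AtPrime p) _ f).restrictScalars k
  let G : Localization.AtPrime p ⊗[A] M' →ₗ[k] Localization.AtPrime p ⊗[A] M'' :=
    (TensorProduct.AlgebraTensorModule.lTensor (Localization.AtPrime p) _ g).restrictScalars k
  have hF : Function.Injective F := Module.Flat.lTensor_preserves_injective_linearMap f hf
  have hG : Function.Surjective G := LinearMap.lTensor_surjective _ hg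
  have hFG : Function.Exact F G := lTensor_exact _ hfg hg
  have h1 := LinearMap.finrank_range_add_finrank_ker G
  rw [LinearMap.range_eq_top.2 hG, finrank_top, LinearMap.exact_iff.1 hFG,
    LinearMap.finrank_range_of_inj hF] at h1
  rw [localDim, localDim, localDim, ← h1, add_comm]

theorem localDim_pi {ι : Type*} [Fintype ι]
    (hfin : FiniteDimensional k (Localization.AtPrime p ⊗[A] M)) :
    localDim k p (ι → M) = Fintype.card ι * localDim k p M := by
  rw [localDim, ((TensorProduct.piRight A (Localization.AtPrime p) (Localization.AtPrime p)
    (fun _ : ι => M)).restrictScalars k).finrank_eq, Module.finrank_pi_fintype k]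
  simp [localDim]

/-- Localization of a quotient ring. -/
def localizationQuotientEquiv (k : Type*) {A : Type*} [Field k] [CommRing A] [Algebra k A]
    (p : Ideal A) [p.IsPrime] (I : Ideal A) : Localization.AtPrime p ⊗[A] (A ⧸ I) ≃ₗ[k]
      Localization.AtPrime p ⧸ I.map (algebraMap A (Localization.AtPrime p)) :=
  ((TensorProduct.tensorQuotEquivQuotSMul (Localization.AtPrime p) I).trans <|
    (Submodule.quotEquivOfEq _ _ (Ideal.smul_top_eq_map _)).trans <|
      Submodule.Quotient.restrictScalarsEquiv A _).restrictScalars k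

theorem localDim_quotient (I : Ideal A) : localDim k p (A ⧸ I) =
    finrank k (Localization.AtPrime p ⧸ I.map (algebraMap A (Localization.AtPrime p))) :=
  (localizationQuotientEquiv k p I).finrank_eq

end LocalDimension

/-! ### Joint generalized eigenspaces as localizations -/

section JointSpectrum

variable {k V : Type*} [Field k] [AddCommGroup V] [Module k V] {r : ℕ} (b : Basis (Fin r) k V)
  {M : Type*} [AddCommGroup M] [Module k M] [Module (MvPolynomial (Fin r) k) M]
  [IsScalarTower k (MvPolynomial (Fin r) k) M]

/-- Multiplication by `y ∈ 𝔥` on a module over `S𝔥`. -/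
def mulOp (M : Type*) [AddCommGroup M] [Module k M] [Module (MvPolynomial (Fin r) k) M]
    [IsScalarTower k (MvPolynomial (Fin r) k) M] (y : V) : End k M :=
  Algebra.lsmul k k M (linForm b y)

theorem mulOp_apply (y : V) (m : M) : mulOp b M y m = linForm b y • m := rfl

theorem mulOp_sub_pow (y : V) (a : k) (n : ℕ) (m : M) :
    ((mulOp b M y - a • 1) ^ n) m = (linForm b y - MvPolynomial.C a) ^ n • m := by
  have : mulOp b M y - a • 1 = Algebra.lsmul k k M (linForm b y - MvPolynomial.C a) := by
    rw [map_sub, mulOp]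
    congr 1
    ext m
    simp [← MvPolynomial.algebraMap_eq]
  rw [this, ← map_pow]
  rfl

/-- The joint generalized eigenspace, as an `S𝔥`-submodule. -/
def jointEigenspace (M : Type*) [AddCommGroup M] [Module k M] [Module (MvPolynomial (Fin r) k) M]
    [IsScalarTower k (MvPolynomial (Fin r) k) M] (μ : Dual k V) :
    Submodule (MvPolynomial (Fin r) k) M where
  __ := (⨅ y, (mulOp b M y).maxGenEigenspace (μ y) : Submodule k M).toAddSubmonoid
  smul_mem' f m hm := by
    simp only [AddSubsemigroup.mem_carrier, AddSubmonoid.mem_toSubsemigroup,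
      Submodule.mem_toAddSubmonoid, Submodule.mem_iInf, End.mem_maxGenEigenspace,
      mulOp_sub_pow] at hm ⊢
    intro y
    obtain ⟨n, hn⟩ := hm y
    exact ⟨n, by rw [smul_comm, hn, smul_zero]⟩

theorem mem_jointEigenspace {μ : Dual k V} {m : M} : m ∈ jointEigenspace b M μ ↔
    ∀ y, ∃ n : ℕ, (linForm b y - MvPolynomial.C (μ y)) ^ n • m = 0 := by
  change m ∈ (⨅ y, (mulOp b M y).maxGenEigenspace (μ y) : Submodule k M) ↔ _
  simp only [Submodule.mem_iInf, End.mem_maxGenEigenspace, mulOp_sub_pow]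

theorem pointIdeal_eq_span (μ : Dual k V) : pointIdeal b μ =
    Ideal.span (Set.range fun i => MvPolynomial.X i - MvPolynomial.C (μ (b i))) := by
  refine le_antisymm (fun f hf => ?_) (Ideal.span_le.2 ?_)
  · set I := Ideal.span (Set.range fun i => (MvPolynomial.X i : MvPolynomial (Fin r) k) -
      MvPolynomial.C (μ (b i))) with hI
    have h1 : Ideal.Quotient.mkₐ k I = (Algebra.ofId k _).comp (evalAt b μ) := by
      ext i
      simp only [evalAt, AlgHom.comp_apply, MvPolynomial.aeval_X]
      exact Ideal.Quotient.eq.2 (Ideal.subset_span ⟨i, rfl⟩)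
    rw [← Ideal.Quotient.eq_zero_iff_mem, ← Ideal.Quotient.mkₐ_eq_mk k, h1, AlgHom.comp_apply]
    have : evalAt b μ f = 0 := hf
    rw [this, map_zero]
  · rintro _ ⟨i, rfl⟩
    have := sub_C_mem_pointIdeal b μ (MvPolynomial.X i)
    simpa [evalAt] using this

/-- An annihilator of an element of the joint generalized eigenspace is either everything or
contained only in the maximal ideal of the point. -/
theorem eq_pointIdeal_of_prime {μ : Dual k V} {m : M} (hm : m ∈ jointEigenspace b M μ)
    {q : Ideal (MvPolynomial (Fin r) k)} (hq : q.IsPrime)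
    (hle : ∀ f : MvPolynomial (Fin r) k, f • m = 0 → f ∈ q) : q = pointIdeal b μ := by
  refine ((pointIdeal_isMaximal b μ).eq_of_le hq.ne_top ?_).symm
  rw [pointIdeal_eq_span, Ideal.span_le]
  rintro _ ⟨i, rfl⟩
  obtain ⟨n, hn⟩ := (mem_jointEigenspace b).1 hm (b i)
  rw [linForm_basis] at hn
  exact hq.mem_of_pow_mem n (hle _ hn)

/-- If `m ≠ 0`, a maximal ideal containing its annihilator must be the ideal of the point `μ`; but
the annihilator contains `s`. -/
theorem eq_zero_of_smul_eq_zero {μ : Dual k V} {m : M} (hm : m ∈ jointEigenspace b M μ)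
    {s : MvPolynomial (Fin r) k} (hs : s ∉ pointIdeal b μ) (h : s • m = 0) : m = 0 := by
  by_contra h0
  obtain ⟨q, hq, hle⟩ := Ideal.exists_le_maximal
    (LinearMap.ker (LinearMap.toSpanSingleton (MvPolynomial (Fin r) k) M m)) (by
      rw [Ne, Ideal.eq_top_iff_one]
      simpa using h0)
  have := eq_pointIdeal_of_prime b hm hq.isPrime fun f hf => hle (by simpa using hf)
  exact hs (this ▸ hle (by simpa using h))

/-- An associated prime of the generalized eigenspace can only be the ideal of `μ`, and an element
with that annihilator is an eigenvector. -/
theorem exists_joint_eigenvector {μ : Dual k V} (h : jointEigenspace b M μ ≠ ⊥) :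
    ∃ m : M, m ≠ 0 ∧ ∀ y, linForm b y • m = μ y • m := by
  have : Nontrivial (jointEigenspace b M μ) := Submodule.nontrivial_iff_ne_bot.2 h
  obtain ⟨q, hq⟩ := associatedPrimes.nonempty (MvPolynomial (Fin r) k) (jointEigenspace b M μ)
  obtain ⟨hpr, m, hm⟩ := isAssociatedPrime_iff.mp (AssociatedPrimes.mem_iff.mp hq)
  have hqm : ∀ f : MvPolynomial (Fin r) k, f • m.1 = 0 ↔ f ∈ q := fun f => by
    rw [hm, Submodule.mem_colon_singleton, Submodule.mem_bot, Subtype.ext_iff]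
    rfl
  have hqp := eq_pointIdeal_of_prime b m.2 hpr fun f hf => (hqm f).1 hf
  refine ⟨m.1, fun h0 => hpr.ne_top ?_, fun y => ?_⟩
  · rw [Ideal.eq_top_iff_one, ← hqm, h0, smul_zero]
  · have h1 := sub_C_mem_pointIdeal b μ (linForm b y)
    rw [← hqp, ← hqm, sub_smul, sub_eq_zero, evalAt_linForm, ← MvPolynomial.algebraMap_eq,
      algebraMap_smul] at h1
    exact h1

variable [IsAlgClosed k] [FiniteDimensional k M]

/-- `M` is the sum of its joint generalized eigenspaces. A component with `χ(y) ≠ μ(y)` is killed by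
a power of `y - χ(y)`, which does not vanish at `μ`. -/
theorem exists_add_mem_jointEigenspace (μ : Dual k V) (m : M) :
    ∃ u ∈ jointEigenspace b M μ, ∃ s ∉ pointIdeal b μ, s • (m - u) = 0 := by
  have hcomm : ∀ y z, Commute (mulOp b M y) (mulOp b M z) := fun y z => by
    change mulOp b M y * mulOp b M z = mulOp b M z * mulOp b M y
    rw [mulOp, mulOp, ← map_mul, mul_comm, map_mul]
  have htop := End.iSup_iInf_maxGenEigenspace_eq_top_of_forall_mapsTo (mulOp b M)
    (fun i j φ => End.mapsTo_maxGenEigenspace_of_comm (hcomm j i) φ)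
    (fun i => End.iSup_maxGenEigenspace_eq_top _)
  have hm : m ∈ ⨆ χ : V → k, ⨅ i, (mulOp b M i).maxGenEigenspace (χ i) := htop ▸ Submodule.mem_top
  induction hm using Submodule.iSup_induction' with
  | mem χ x hx =>
    simp only [Submodule.mem_iInf, End.mem_maxGenEigenspace, mulOp_sub_pow] at hx
    by_cases h : ∀ y, χ y = μ y
    · refine ⟨x, (mem_jointEigenspace b).2 fun y => ?_, 1, ?_, by simp⟩
      · rw [← h y]; exact hx y
      · exact (Ideal.ne_top_iff_one _).1 (pointIdeal_isMaximal b μ).ne_top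
    · push Not at h
      obtain ⟨y, hy⟩ := h
      obtain ⟨n, hn⟩ := hx y
      refine ⟨0, zero_mem _, _, fun hmem => ?_, by rw [sub_zero]; exact hn⟩
      have h1 := (inferInstance : (pointIdeal b μ).IsPrime).mem_of_pow_mem n hmem
      rw [pointIdeal, RingHom.mem_ker, map_sub, evalAt_linForm, sub_eq_zero] at h1
      exact hy (by simpa [evalAt] using h1.symm)
  | zero => exact ⟨0, zero_mem _, 1, (Ideal.ne_top_iff_one _).1 (pointIdeal_isMaximal b μ).ne_top,
      by simp⟩
  | add x y _ _ hx hy =>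
    obtain ⟨u, hu, s, hs, h1⟩ := hx
    obtain ⟨v, hv, t, ht, h2⟩ := hy
    refine ⟨u + v, add_mem hu hv, s * t, fun h => ?_, ?_⟩
    · exact ((inferInstance : (pointIdeal b μ).IsPrime).mem_or_mem h).elim hs ht
    · rw [add_sub_add_comm, smul_add, mul_smul, mul_smul, h2, smul_comm, h1]
      simp

omit [IsAlgClosed k] in
theorem finiteDimensional_jointEigenspace (μ : Dual k V) :
    FiniteDimensional k (jointEigenspace b M μ) :=
  Module.Finite.of_injective ((jointEigenspace b M μ).subtype.restrictScalars k)
    Subtype.val_injective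

/-- The localization of a finite dimensional module at a point is the joint generalized
eigenspace. -/
theorem exists_linearEquiv_localization (μ : Dual k V) :
    Nonempty (jointEigenspace b M μ ≃ₗ[k] Localization.AtPrime (pointIdeal b μ)
      ⊗[MvPolynomial (Fin r) k] M) := by
  have := finiteDimensional_jointEigenspace (M := M) b μ
  let p := pointIdeal b μ
  let j := TensorProduct.mk (MvPolynomial (Fin r) k) (Localization.AtPrime p) M 1
  have hj : IsLocalizedModule p.primeCompl j := inferInstance
  let e : jointEigenspace b M μ →ₗ[MvPolynomial (Fin r) k] Localization.AtPrime p
      ⊗[MvPolynomial (Fin r) k] M := j ∘ₗ (jointEigenspace b M μ).subtype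
  have hsurj : ∀ (s : MvPolynomial (Fin r) k), s ∉ p → ∀ u : jointEigenspace b M μ,
      ∃ v : jointEigenspace b M μ, s • v = u := by
    intro s hs
    -- Elements outside the ideal of `μ` act injectively on a finite-dimensional space, hence
    -- bijectively: the eigenspace is already local.
    refine LinearMap.surjective_of_injective (K := k)
      (f := Algebra.lsmul k k (jointEigenspace b M μ) s) ?_
    refine (injective_iff_map_eq_zero _).2 fun u hu => ?_
    exact Subtype.ext (eq_zero_of_smul_eq_zero b u.2 hs (congrArg Subtype.val hu))
  refine ⟨(LinearEquiv.ofBijective e ⟨?_, ?_⟩).restrictScalars k⟩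
  · rw [injective_iff_map_eq_zero]
    intro u hu
    have h1 : j u.1 = j 0 := by rw [map_zero]; exact hu
    obtain ⟨s, hs⟩ := hj.exists_of_eq h1
    rw [smul_zero] at hs
    exact Subtype.ext (eq_zero_of_smul_eq_zero b u.2 s.2 hs)
  · intro z
    obtain ⟨⟨m, s⟩, hms⟩ := IsLocalizedModule.surj p.primeCompl j z
    obtain ⟨u, hu, t, ht, h1⟩ := exists_add_mem_jointEigenspace b μ m
    have h2 : j m = e ⟨u, hu⟩ := by
      refine (IsLocalizedModule.eq_iff_exists p.primeCompl j).2 ⟨⟨t, ht⟩, ?_⟩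
      rw [← sub_eq_zero, ← smul_sub]
      exact h1
    obtain ⟨v, hv⟩ := hsurj s.1 s.2 ⟨u, hu⟩
    refine ⟨v, ?_⟩
    apply IsLocalizedModule.smul_injective j s
    change s.1 • e v = s • z
    rw [hms, ← map_smul, hv, h2]

theorem finiteDimensional_localization (μ : Dual k V) :
    FiniteDimensional k (Localization.AtPrime (pointIdeal b μ) ⊗[MvPolynomial (Fin r) k] M) :=
  have := finiteDimensional_jointEigenspace (M := M) b μ
  (exists_linearEquiv_localization b μ).some.finiteDimensional

theorem localDim_eq_spectralMult (μ : Dual k V) :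
    localDim k (pointIdeal b μ) M = spectralMult (mulOp b M) μ :=
  (exists_linearEquiv_localization (M := M) b μ).some.finrank_eq.symm

end JointSpectrum

end

section

open scoped TensorProduct

/-! ### Gaudin modules over a coefficient ring, and dévissage -/

section GaudinModule

variable {k V : Type*} [Field k] [AddCommGroup V] [Module k V] {r : ℕ}
  {W : Subgroup (V ≃ₗ[k] V)} {T : Type*} [CommRing T] [Algebra k T]

/-- The functions `W → T` with the action of `S𝔥` by the Gaudin operators. -/
def GaudinModule (_ : MvPolynomial (Fin r) k →ₐ[k] End T (W → T)) : Type _ := W → T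

variable (φ : MvPolynomial (Fin r) k →ₐ[k] End T (W → T))

instance : AddCommGroup (GaudinModule φ) := inferInstanceAs (AddCommGroup (W → T))
instance : Module k (GaudinModule φ) := inferInstanceAs (Module k (W → T))
instance : Module (MvPolynomial (Fin r) k) (GaudinModule φ) where
  smul f m := φ f m
  one_smul m := by change φ 1 m = m; rw [map_one]; rfl
  mul_smul f g m := by change φ (f * g) m = _; rw [map_mul]; rfl
  smul_zero f := map_zero (φ f)
  smul_add f := map_add (φ f)
  add_smul f g m := by change φ (f + g) m = _; rw [map_add]; rfl
  zero_smul m := by change φ 0 m = _; rw [map_zero]; rfl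

instance : IsScalarTower k (MvPolynomial (Fin r) k) (GaudinModule φ) where
  smul_assoc a f m := by
    change φ (a • f) m = a • φ f m
    rw [map_smul]; rfl

/-- Multiplication by an element of the coefficient ring. -/
def GaudinModule.scalar (t : T) : GaudinModule φ →ₗ[MvPolynomial (Fin r) k] GaudinModule φ where
  toFun m := (t • (show W → T from m) : W → T)
  map_add' m n := smul_add t (show W → T from m) n
  map_smul' f m := ((φ f).map_smul t m).symm

/-- The functions with values in an ideal of the coefficient ring. -/
def GaudinModule.ofIdeal [Finite W] (J : Ideal T) :
    Submodule (MvPolynomial (Fin r) k) (GaudinModule φ) where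
  carrier := {m | ∀ w, m w ∈ J}
  add_mem' hm hn w := J.add_mem (hm w) (hn w)
  zero_mem' w := J.zero_mem
  smul_mem' f m hm w := by
    have := Fintype.ofFinite W
    have h1 : m = ∑ u, m u • (Pi.single u 1 : W → T) := by
      refine (pi_eq_sum_univ' (R := T) m).trans ?_
      refine Finset.sum_congr rfl fun u _ => ?_
      congr 1
    change φ f m w ∈ J
    rw [h1, map_sum, Finset.sum_apply]
    refine J.sum_mem fun u _ => ?_
    rw [map_smul, Pi.smul_apply, smul_eq_mul]
    exact J.mul_mem_right _ (hm u)

theorem GaudinModule.mem_ofIdeal [Finite W] {J : Ideal T} {m : GaudinModule φ} :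
    m ∈ GaudinModule.ofIdeal φ J ↔ ∀ w, m w ∈ J := Iff.rfl

theorem GaudinModule.finiteDimensional_quotient [Finite W] (J : Ideal T)
    [FiniteDimensional k (T ⧸ J)] :
    FiniteDimensional k (GaudinModule φ ⧸ GaudinModule.ofIdeal φ J) := by
  let q : GaudinModule φ →ₗ[k] W → T ⧸ J := LinearMap.pi fun w =>
    (Submodule.mkQ J).restrictScalars k ∘ₗ (LinearMap.proj w : (W → T) →ₗ[k] T)
  have hq : LinearMap.ker q = (GaudinModule.ofIdeal φ J).restrictScalars k := by
    ext m
    rw [LinearMap.mem_ker, Submodule.restrictScalars_mem, GaudinModule.mem_ofIdeal, funext_iff]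
    exact forall_congr' fun w => Submodule.Quotient.mk_eq_zero J
  let e : (GaudinModule φ ⧸ GaudinModule.ofIdeal φ J) ≃ₗ[k] LinearMap.range q :=
    (Submodule.Quotient.restrictScalarsEquiv k _).symm.trans
      ((Submodule.quotEquivOfEq _ _ hq.symm).trans q.quotKerEquivRange)
  exact e.symm.finiteDimensional

/-- With `q = (J : a)`, multiplication by `a` gives an exact sequence `0 → T/q → T/J → T/(J + (a)) →
0`. It persists for functions on `W`, since the Gaudin operators are `T`-linear. -/
theorem GaudinModule.localDim_quotient_sup_span [Finite W] (p : Ideal (MvPolynomial (Fin r) k))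
    [p.IsPrime] {J q : Ideal T} {a : T} (hq : ∀ t, t ∈ q ↔ a * t ∈ J)
    (hfin : FiniteDimensional k
      (Localization.AtPrime p ⊗[MvPolynomial (Fin r) k] (GaudinModule φ ⧸ ofIdeal φ J))) :
    localDim k p (GaudinModule φ ⧸ ofIdeal φ J) =
      localDim k p (GaudinModule φ ⧸ ofIdeal φ q) +
        localDim k p (GaudinModule φ ⧸ ofIdeal φ (J ⊔ Ideal.span {a})) := by
  have hle : ofIdeal φ J ≤ ofIdeal φ (J ⊔ Ideal.span {a}) :=
    fun m hm w => Ideal.mem_sup_left (hm w)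
  have hle' : ofIdeal φ q ≤ (ofIdeal φ J).comap (scalar φ a) := fun m hm w => (hq _).1 (hm w)
  refine localDim_add p ((ofIdeal φ q).mapQ _ (scalar φ a) hle') (Submodule.factor hle) ?_
    (Submodule.factor_surjective hle) ?_ hfin
  · refine (injective_iff_map_eq_zero _).2 fun x hx => ?_
    obtain ⟨m, rfl⟩ := Submodule.Quotient.mk_surjective _ x
    rw [Submodule.mapQ_apply, Submodule.Quotient.mk_eq_zero] at hx
    rw [Submodule.Quotient.mk_eq_zero]
    exact fun w => (hq _).2 (hx w)
  · intro x
    obtain ⟨m, rfl⟩ := Submodule.Quotient.mk_surjective _ x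
    constructor
    · intro hx
      have hx' : m ∈ ofIdeal φ (J ⊔ Ideal.span {a}) := by
        exact (Submodule.Quotient.mk_eq_zero _).1 hx
      have h1 : ∀ w, ∃ t : T, m w - a * t ∈ J := fun w => by
        obtain ⟨j, hj, s, hs, h2⟩ := Submodule.mem_sup.1 (hx' w)
        obtain ⟨t, rfl⟩ := Ideal.mem_span_singleton'.1 hs
        refine ⟨t, ?_⟩
        rw [← h2, mul_comm, add_sub_cancel_right]
        exact hj
      choose t ht using h1
      refine ⟨Submodule.Quotient.mk (show GaudinModule φ from t), ?_⟩
      rw [Submodule.mapQ_apply, eq_comm, Submodule.Quotient.eq]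
      exact ht
    · rintro ⟨y, hy⟩
      obtain ⟨n, rfl⟩ := Submodule.Quotient.mk_surjective _ y
      rw [← hy, Submodule.mapQ_apply]
      refine (Submodule.Quotient.mk_eq_zero _).2 fun w => ?_
      exact Ideal.mem_sup_right (Ideal.mul_mem_right _ _ (Ideal.mem_span_singleton_self a))

end GaudinModule

/-- Dévissage: the local dimensions of the quotients of a Gaudin module by the ideals of the
coefficient ring are determined by those for the maximal ideals. -/
theorem GaudinModule.localDim_quotient_ofIdeal {k V : Type*} [Field k] [IsAlgClosed k]
    [AddCommGroup V] [Module k V] {r : ℕ} (b : Basis (Fin r) k V)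
    {W : Subgroup (V ≃ₗ[k] V)} [Finite W] {T : Type*} [CommRing T] [Algebra k T]
    [IsNoetherianRing T]
    (φ : MvPolynomial (Fin r) k →ₐ[k] End T (W → T)) (μ : Dual k V) (d : ℕ) (n : ℕ) :
    ∀ (J : Ideal T) (_ : FiniteDimensional k (T ⧸ J))
      (_ : ∀ q : Ideal T, q.IsMaximal → J ≤ q →
        finrank k (T ⧸ q) = 1 ∧ localDim k (pointIdeal b μ) (GaudinModule φ ⧸ ofIdeal φ q) = d)
      (_ : finrank k (T ⧸ J) = n),
      localDim k (pointIdeal b μ) (GaudinModule φ ⧸ ofIdeal φ J) = n * d := by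
  induction n with
  | zero =>
    intro J hJ _ hn
    have h1 : Subsingleton (T ⧸ J) := finrank_zero_iff.1 hn
    have h2 : J = ⊤ := Ideal.Quotient.subsingleton_iff.1 h1
    have : Subsingleton (GaudinModule φ ⧸ ofIdeal φ J) := by
      rw [Submodule.Quotient.subsingleton_iff, eq_top_iff]
      intro m _ w
      rw [h2]; trivial
    rw [localDim_eq_zero_of_subsingleton, zero_mul]
  | succ n ih =>
    intro J hJ hmax hn
    have : Nontrivial (T ⧸ J) := nontrivial_of_finrank_pos (R := k) (by omega)
    -- An associated prime `q` of `T/J` is maximal because `T/J` is finite-dimensional. The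
    -- corresponding element `a` spans a one-dimensional copy of `T/q`, and dividing by it lowers
    -- the length by one.
    obtain ⟨q, hq⟩ := associatedPrimes.nonempty T (T ⧸ J)
    obtain ⟨hpr, x, hx⟩ := isAssociatedPrime_iff.mp (AssociatedPrimes.mem_iff.mp hq)
    obtain ⟨a, rfl⟩ := Ideal.Quotient.mk_surjective x
    have hqa : ∀ t, t ∈ q ↔ a * t ∈ J := fun t => by
      rw [hx, Submodule.mem_colon_singleton, Submodule.mem_bot, ← Ideal.Quotient.eq_zero_iff_mem,
        mul_comm, map_mul]
      rfl
    have hJq : J ≤ q := fun t ht => (hqa t).2 (J.mul_mem_left _ ht)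
    have hfq : FiniteDimensional k (T ⧸ q) :=
      Module.Finite.of_surjective ((Submodule.factor hJq).restrictScalars k)
        (Submodule.factor_surjective hJq)
    have hqm : q.IsMaximal := by
      have : IsArtinianRing (T ⧸ q) := IsArtinianRing.of_finite k _
      exact Ideal.Quotient.maximal_of_isField _ (IsArtinianRing.isField_of_isDomain _)
    have hle : J ≤ J ⊔ Ideal.span {a} := le_sup_left
    have hfJ : FiniteDimensional k (T ⧸ (J ⊔ Ideal.span {a})) :=
      Module.Finite.of_surjective ((Submodule.factor hle).restrictScalars k)
        (Submodule.factor_surjective hle)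
    have := finiteDimensional_quotient φ J
    have h1 := localDim_quotient_sup_span φ (pointIdeal b μ) hqa
      (finiteDimensional_localization b μ)
    have hdim : finrank k (T ⧸ (J ⊔ Ideal.span {a})) = n := by
      let f : T ⧸ J →ₗ[k] T ⧸ (J ⊔ Ideal.span {a}) := (Submodule.factor hle).restrictScalars k
      let g : T ⧸ q →ₗ[k] T ⧸ J := (q.mapQ J (LinearMap.mulLeft T a)
        fun t ht => (hqa t).1 ht).restrictScalars k
      have hg : Function.Injective g := by
        refine (injective_iff_map_eq_zero _).2 fun x hx => ?_
        obtain ⟨t, rfl⟩ := Ideal.Quotient.mk_surjective x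
        exact Ideal.Quotient.eq_zero_iff_mem.2 ((hqa t).2 (Ideal.Quotient.eq_zero_iff_mem.1 hx))
      have hfg : LinearMap.ker f = LinearMap.range g := by
        ext x
        obtain ⟨t, rfl⟩ := Ideal.Quotient.mk_surjective x
        constructor
        · intro hx
          have ht : t ∈ J ⊔ Ideal.span {a} := Ideal.Quotient.eq_zero_iff_mem.1 hx
          obtain ⟨j, hj, s, hs, h2⟩ := Submodule.mem_sup.1 ht
          obtain ⟨u, rfl⟩ := Ideal.mem_span_singleton'.1 hs
          refine ⟨Ideal.Quotient.mk q u, Ideal.Quotient.eq.2 ?_⟩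
          change a * u - t ∈ J
          rw [← h2, mul_comm, sub_add_cancel_right]
          exact J.neg_mem hj
        · rintro ⟨y, hy⟩
          obtain ⟨u, rfl⟩ := Ideal.Quotient.mk_surjective y
          rw [← hy]
          exact Ideal.Quotient.eq_zero_iff_mem.2
            (Ideal.mem_sup_right (Ideal.mul_mem_right _ _ (Ideal.mem_span_singleton_self a)))
      have h2 := LinearMap.finrank_range_add_finrank_ker f
      have hf : LinearMap.range f = ⊤ :=
        LinearMap.range_eq_top.2 (Submodule.factor_surjective hle)
      rw [hf, finrank_top, hfg,
        LinearMap.finrank_range_of_inj hg, (hmax q hqm hJq).1, hn] at h2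
      omega
    rw [h1, (hmax q hqm hJq).2, ih _ hfJ (fun q hq h => hmax q hq (hle.trans h)) hdim]
    ring

end

section

/-! ### Filtration of `S𝔥` by degree -/

section Degree

variable {k V : Type*} [Field k] [AddCommGroup V] [Module k V] {r : ℕ} (b : Basis (Fin r) k V)

/-- The polynomials of degree less than `n`. -/
def degreeLT (k : Type*) [Field k] (r n : ℕ) : Submodule k (MvPolynomial (Fin r) k) :=
  MvPolynomial.restrictSupport k {m | m.degree < n}

theorem degreeLT_mono {n n' : ℕ} (h : n ≤ n') : degreeLT k r n ≤ degreeLT k r n' :=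
  fun _ hf _ hm => (hf hm).trans_le h

theorem monomial_mem_degreeLT {m : Fin r →₀ ℕ} {n : ℕ} (h : m.degree < n) (a : k) :
    MvPolynomial.monomial m a ∈ degreeLT k r n := fun _ hm' => by
  have := MvPolynomial.support_monomial_subset hm'
  rw [Finset.mem_singleton] at this
  subst this
  exact h

theorem eq_zero_of_mem_degreeLT_zero {f : MvPolynomial (Fin r) k} (hf : f ∈ degreeLT k r 0) :
    f = 0 := by
  rw [← MvPolynomial.support_eq_empty, Finset.eq_empty_iff_forall_notMem]
  exact fun m hm => absurd (hf hm) (Nat.not_lt_zero _)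

theorem exists_mem_degreeLT (f : MvPolynomial (Fin r) k) : ∃ n, f ∈ degreeLT k r n :=
  ⟨f.support.sup Finsupp.degree + 1, fun _ hm => Nat.lt_succ_of_le (Finset.le_sup (f := Finsupp.degree) hm)⟩

/-- A linear statement about polynomials of degree less than `n` can be checked on monomials. -/
theorem degreeLT_le {n : ℕ} {S : Submodule k (MvPolynomial (Fin r) k)}
    (h : ∀ m : Fin r →₀ ℕ, m.degree < n → MvPolynomial.monomial m 1 ∈ S) :
    degreeLT k r n ≤ S := fun f hf => by
  rw [f.as_sum]
  refine S.sum_mem fun m hm => ?_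
  have := S.smul_mem (f.coeff m) (h m (hf hm))
  rwa [MvPolynomial.smul_monomial, smul_eq_mul, mul_one] at this

theorem linForm_mul_mem_degreeLT {n : ℕ} {f : MvPolynomial (Fin r) k} (hf : f ∈ degreeLT k r n)
    (y : V) : linForm b y * f ∈ degreeLT k r (n + 1) := by
  rw [linForm, Finset.sum_mul]
  refine Submodule.sum_mem _ fun i _ => ?_
  rw [mul_assoc, ← MvPolynomial.smul_eq_C_mul]
  refine Submodule.smul_mem _ _ fun m hm => ?_
  have hm : m ∈ (MvPolynomial.X i * f).support := hm
  rw [MvPolynomial.support_X_mul] at hm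
  obtain ⟨m', hm', rfl⟩ := Finset.mem_map.1 hm
  have := hf hm'
  change (Finsupp.single i 1 + m').degree < n + 1
  rw [map_add, Finsupp.degree_single]
  have : m'.degree < n := this
  omega

theorem monomial_degree_induction {Q : ℕ → MvPolynomial (Fin r) k → Prop}
    (h0 : Q 0 1) (hs : ∀ n i f, f ∈ degreeLT k r (n + 1) → Q n f →
      Q (n + 1) (MvPolynomial.X i * f)) (m : Fin r →₀ ℕ) :
    Q m.degree (MvPolynomial.monomial m 1) := by
  obtain ⟨n, hn⟩ : ∃ n, m.degree = n := ⟨_, rfl⟩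
  rw [hn]
  induction n generalizing m with
  | zero =>
    rw [Finsupp.degree_eq_zero_iff] at hn
    subst hn
    exact h0
  | succ n ih =>
    obtain ⟨i, hi⟩ : ∃ i, m i ≠ 0 := by
      by_contra! h
      have : m = 0 := Finsupp.ext h
      simp [this] at hn
    have hm : m = Finsupp.single i 1 + (m - Finsupp.single i 1) :=
      (add_tsub_cancel_of_le (Finsupp.single_le_iff.2 (Nat.one_le_iff_ne_zero.2 hi))).symm
    have hd : (m - Finsupp.single i 1).degree = n := by
      have := congrArg Finsupp.degree hm
      rw [map_add, Finsupp.degree_single, hn] at this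
      omega
    have h1 : MvPolynomial.monomial m (1 : k) =
        MvPolynomial.X i * MvPolynomial.monomial (m - Finsupp.single i 1) 1 := by
      rw [MvPolynomial.X, MvPolynomial.monomial_mul, ← hm, one_mul]
    rw [h1]
    exact hs n i _ (monomial_mem_degreeLT (by omega) 1) (ih _ hd)

theorem one_mem_degreeLT : (1 : MvPolynomial (Fin r) k) ∈ degreeLT k r 1 :=
  monomial_mem_degreeLT (m := 0) (by simp) 1

theorem polyAct_mem_degreeLT (g : V ≃ₗ[k] V) {n : ℕ} {f : MvPolynomial (Fin r) k}
    (hf : f ∈ degreeLT k r n) : polyAct b g f ∈ degreeLT k r n := by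
  have h1 : degreeLT k r n ≤ (degreeLT k r n).comap (polyAct b g).toLinearMap := by
    refine degreeLT_le fun m hm => ?_
    refine degreeLT_mono hm ?_
    refine monomial_degree_induction (Q := fun n f => polyAct b g f ∈ degreeLT k r (n + 1)) ?_ ?_ m
    · rw [map_one]; exact one_mem_degreeLT
    · intro n i f _ hf
      rw [map_mul, ← linForm_basis b i, polyAct_linForm]
      exact linForm_mul_mem_degreeLT b hf _
  exact h1 hf

end Degree

/-- If `x + Nx = 0`, then `Nⁿx = ±x` for all `n`, so `x = 0`. The inverse is the geometric series,
finite on each vector. -/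
theorem bijective_one_add_of_locally_nilpotent {R M : Type*} [Ring R] [AddCommGroup M] [Module R M]
    (N : End R M) (hN : ∀ x, ∃ n : ℕ, (N ^ n) x = 0) : Function.Bijective (1 + N : End R M) := by
  constructor
  · refine (injective_iff_map_eq_zero _).2 fun x hx => ?_
    have h1 : ∀ n : ℕ, (N ^ n) x = (-1 : ℤ) ^ n • x := by
      intro n
      induction n with
      | zero => simp
      | succ n ih =>
        have h2 : N x = -x := eq_neg_of_add_eq_zero_right hx
        rw [pow_succ, Module.End.mul_apply, h2, map_neg, ih, pow_succ]
        simp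
    obtain ⟨n, hn⟩ := hN x
    rw [h1] at hn
    rcases neg_one_pow_eq_or ℤ n with h | h <;> simpa [h] using hn
  · intro x
    obtain ⟨n, hn⟩ := hN x
    refine ⟨(∑ i ∈ Finset.range n, (-N) ^ i) x, ?_⟩
    have h1 := mul_neg_geom_sum (-N) n
    rw [sub_neg_eq_add] at h1
    rw [← Module.End.mul_apply, h1, LinearMap.sub_apply, neg_pow, Module.End.mul_apply, hn]
    simp

/-! ### Freeness of the universal Gaudin module -/

section Free

variable {k V : Type*} [Field k] [Infinite k] [AddCommGroup V] [Module k V] {r : ℕ}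
  (b : Basis (Fin r) k V) {W : Subgroup (V ≃ₗ[k] V)} [Fintype W] {c : W → k}
  (hc : ∀ g s : W, IsReflection s.1 → c (g * s * g⁻¹) = c s) (h : regularSet W)

theorem gaudinHom_intertwine {T T' : Type*} [CommRing T] [Algebra k T] [CommRing T'] [Algebra k T']
    {l : V →ₗ[k] T} {l' : V →ₗ[k] T'} (θ : (W → T) →ₗ[k] W → T')
    (hθ : ∀ y m, θ (gaudinOp W l c h.1 y m) = gaudinOp W l' c h.1 y (θ m))
    (f : MvPolynomial (Fin r) k) (m : W → T) :
    θ (gaudinHom b l hc h f m) = gaudinHom b l' hc h f (θ m) := by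
  induction f using MvPolynomial.induction_on generalizing m with
  | C a =>
    rw [← MvPolynomial.algebraMap_eq, AlgHom.commutes, AlgHom.commutes]
    exact θ.map_smul a m
  | add f g hf hg => rw [map_add, map_add, LinearMap.add_apply, LinearMap.add_apply, map_add, hf, hg]
  | mul_X f i hf =>
    rw [map_mul, map_mul, Module.End.mul_apply, Module.End.mul_apply, hf, ← linForm_basis b i,
      gaudinHom_linForm, gaudinHom_linForm, hθ]

/-- The Gaudin module over the ring of functions of `λ`. -/
abbrev UniversalGaudin : Type _ := GaudinModule (gaudinHom b (linHom b) hc h)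

/-- The Gaudin module of the fiber over `λ`. -/
abbrev FiberGaudin (lam : Dual k V) : Type _ := GaudinModule (gaudinHom b lam hc h)

/-- The pole part does not raise degrees, while the diagonal part raises them by one. To leading
order `f(G)` thus acts on `δ_u` through the diagonal, giving `u⁻¹f`. -/
theorem gaudinHom_single_sub_mem {f : MvPolynomial (Fin r) k} {n : ℕ}
    (hf : f ∈ degreeLT k r (n + 1)) (u w : W) :
    gaudinHom b (linHom b) hc h f (Pi.single u 1) w -
      (Pi.single u (polyAct b u.1⁻¹ f) : W → MvPolynomial (Fin r) k) w ∈ degreeLT k r n := by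
  let E (w : W) : MvPolynomial (Fin r) k →ₗ[k] MvPolynomial (Fin r) k :=
    LinearMap.proj w ∘ₗ ((LinearMap.applyₗ (R := MvPolynomial (Fin r) k)
      (Pi.single u 1 : W → MvPolynomial (Fin r) k)).restrictScalars k ∘ₗ
        (gaudinHom b (linHom b) hc h).toLinearMap -
      LinearMap.single k (fun _ : W => MvPolynomial (Fin r) k) u ∘ₗ (polyAct b u.1⁻¹).toLinearMap)
  have hE : ∀ w f, E w f = gaudinHom b (linHom b) hc h f (Pi.single u 1) w -
      (Pi.single u (polyAct b u.1⁻¹ f) : W → MvPolynomial (Fin r) k) w := fun _ _ => rfl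
  have hsingle : ∀ {n : ℕ} {f : MvPolynomial (Fin r) k}, f ∈ degreeLT k r n → ∀ w,
      (Pi.single u (polyAct b u.1⁻¹ f) : W → MvPolynomial (Fin r) k) w ∈ degreeLT k r n := by
    intro n f hf w
    by_cases hw : w = u
    · subst hw; rw [Pi.single_eq_same]; exact polyAct_mem_degreeLT b _ hf
    · rw [Pi.single_eq_of_ne hw]; exact zero_mem _
  have hle : degreeLT k r (n + 1) ≤ ⨅ w, (degreeLT k r n).comap (E w) := by
    refine degreeLT_le fun m hm => (Submodule.mem_iInf _).2 fun w =>
      degreeLT_mono (Nat.le_of_lt_succ hm) ?_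
    revert w
    refine monomial_degree_induction (Q := fun n f => ∀ w, E w f ∈ degreeLT k r n) ?_ ?_ m
    · intro w
      rw [hE, map_one, map_one]
      simp
    · intro n i f hf ih w
      have hg : ∀ w, gaudinHom b (linHom b) hc h f (Pi.single u 1) w ∈ degreeLT k r (n + 1) := by
        intro w
        have h1 := add_mem (degreeLT_mono (Nat.le_succ n) (ih w)) (hsingle hf w)
        rwa [hE, sub_add_cancel] at h1
      have h2 : (Pi.single u (polyAct b u.1⁻¹ (MvPolynomial.X i * f)) :
          W → MvPolynomial (Fin r) k) w = linForm b (w⁻¹.1 (b i)) *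
          (Pi.single u (polyAct b u.1⁻¹ f) : W → MvPolynomial (Fin r) k) w := by
        by_cases hw : w = u
        · subst hw
          rw [Pi.single_eq_same, Pi.single_eq_same, map_mul, ← linForm_basis b i, polyAct_linForm]
          rfl
        · rw [Pi.single_eq_of_ne hw, Pi.single_eq_of_ne hw, mul_zero]
      rw [hE, map_mul, Module.End.mul_apply, ← linForm_basis b i, gaudinHom_linForm,
        gaudinOp_apply_apply, linForm_basis, h2, linHom_apply, add_sub_right_comm, ← mul_sub, ← hE]
      refine add_mem (linForm_mul_mem_degreeLT b (ih w) _) (Submodule.sum_mem _ fun s _ => ?_)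
      exact Submodule.smul_mem _ _ (hg _)
  exact (Submodule.mem_iInf _).1 (hle hf) w

/-- The universal Gaudin module is free over `S𝔥`, on the basis of the group elements. -/
def universalGaudinEquiv : (W → MvPolynomial (Fin r) k) ≃ₗ[MvPolynomial (Fin r) k]
    UniversalGaudin b hc h := by
  let R := MvPolynomial (Fin r) k
  let e : W → UniversalGaudin b hc h := fun u => (Pi.single u 1 : W → R)
  let Ψ : (W → R) →ₗ[R] UniversalGaudin b hc h := Fintype.linearCombination R e
  let D : (W → R) ≃ₗ[k] (W → R) := LinearEquiv.piCongrRight fun w =>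
    LinearEquiv.ofLinearMap (polyAct b w.1⁻¹).toLinearMap (polyAct b w.1).toLinearMap
      (LinearMap.ext fun f => polyAct_inv_apply b w.1 f)
      (LinearMap.ext fun f => by simpa using polyAct_inv_apply b w.1⁻¹ f)
  -- `D` is the leading part of `Ψ`, and `D⁻¹Ψ = 1 + E` with `E` lowering the degree, hence locally
  -- nilpotent.
  let E : End k (W → R) := D.symm.toLinearMap ∘ₗ (Ψ.restrictScalars k) - 1
  have hΨ : ⇑Ψ = D ∘ ⇑(1 + E : End k (W → R)) := by
    funext q
    simp only [E, add_sub_cancel]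
    exact (D.apply_symm_apply _).symm
  refine LinearEquiv.ofBijective Ψ ?_
  rw [hΨ]
  refine D.bijective.comp (bijective_one_add_of_locally_nilpotent E fun q => ?_)
  have hstep : ∀ (n : ℕ) (q : W → R), (∀ w, q w ∈ degreeLT k r (n + 1)) →
      ∀ w, E q w ∈ degreeLT k r n := by
    intro n q hq w
    have h1 : E q = D.symm (∑ u, (fun w => gaudinHom b (linHom b) hc h (q u) (Pi.single u 1) w -
      (Pi.single u (polyAct b u.1⁻¹ (q u)) : W → R) w)) := by
      have h2 : (∑ u, (fun w => gaudinHom b (linHom b) hc h (q u) (Pi.single u 1) w -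
          (Pi.single u (polyAct b u.1⁻¹ (q u)) : W → R) w)) = (show W → R from Ψ q) - D q := by
        funext w
        rw [Finset.sum_apply, Finset.sum_sub_distrib, Fintype.sum_pi_single]
        change _ = Ψ q w - _
        rw [Fintype.linearCombination_apply]
        congr 1
        exact (Finset.sum_apply w _ _).symm
      rw [h2, map_sub, LinearEquiv.symm_apply_apply]
      rfl
    rw [h1]
    refine polyAct_mem_degreeLT b _ ?_
    rw [Finset.sum_apply]
    exact Submodule.sum_mem _ fun u _ => gaudinHom_single_sub_mem b hc h (hq u) u w
  have hpow : ∀ (n : ℕ) (q : W → R), (∀ w, q w ∈ degreeLT k r n) → (E ^ n) q = 0 := by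
    intro n
    induction n with
    | zero => exact fun q hq => funext fun w => eq_zero_of_mem_degreeLT_zero (hq w)
    | succ n ih =>
      intro q hq
      rw [pow_succ, Module.End.mul_apply]
      exact ih _ (hstep n q hq)
  choose d hd using fun w => exists_mem_degreeLT (q w)
  exact ⟨Finset.univ.sup d, hpow _ q fun w => degreeLT_mono (Finset.le_sup (Finset.mem_univ w)) (hd w)⟩

end Free

end

section

open scoped TensorProduct

theorem smul_top_pi_eq_ker {R ι : Type*} [CommRing R] [Finite ι] (I : Ideal R) :
    (I • ⊤ : Submodule R (ι → R)) =
      LinearMap.ker (LinearMap.pi fun i => (Submodule.mkQ I) ∘ₗ LinearMap.proj i :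
        (ι → R) →ₗ[R] ι → R ⧸ I) := by
  have := Fintype.ofFinite ι
  refine le_antisymm (Submodule.smul_le.2 fun a ha m _ => ?_) fun m hm => ?_
  · rw [LinearMap.mem_ker]
    funext i
    exact (Submodule.Quotient.mk_eq_zero I).2 (I.mul_mem_right _ ha)
  · rw [LinearMap.mem_ker] at hm
    rw [pi_eq_sum_univ' (R := R) m]
    refine Submodule.sum_mem _ fun i _ => Submodule.smul_mem_smul ?_ trivial
    exact (Submodule.Quotient.mk_eq_zero I).1 (congrFun hm i)

/-- The quotient of a finite power of a ring by an ideal. -/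
def quotSMulTopPiEquiv {R : Type*} (ι : Type*) [CommRing R] [Finite ι] (I : Ideal R) :
    ((ι → R) ⧸ (I • ⊤ : Submodule R (ι → R))) ≃ₗ[R] ι → R ⧸ I :=
  (Submodule.quotEquivOfEq _ _ (smul_top_pi_eq_ker I)).trans <|
    LinearMap.quotKerEquivOfSurjective _ fun f => by
      choose g hg using fun i => Submodule.Quotient.mk_surjective I (f i)
      exact ⟨g, funext hg⟩

/-! ### Comparison of spectral and solution multiplicities -/

section Multiplicity

variable {k V : Type*} [Field k] [AddCommGroup V] [Module k V] {r : ℕ}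
  (b : Basis (Fin r) k V) {W : Subgroup (V ≃ₗ[k] V)} [Fintype W] {c : W → k}
  (hc : ∀ g s : W, IsReflection s.1 → c (g * s * g⁻¹) = c s) (h : regularSet W)

section

variable [Infinite k]

/-- Reduction of the universal Gaudin module to the fiber at a point. -/
def quotientPointEquiv (lam : Dual k V) :
    (UniversalGaudin b hc h ⧸ GaudinModule.ofIdeal (gaudinHom b (linHom b) hc h)
      (pointIdeal b lam)) ≃ₗ[MvPolynomial (Fin r) k] FiberGaudin b hc h lam := by
  let θ : (W → MvPolynomial (Fin r) k) →ₗ[k] W → k :=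
    LinearMap.pi fun w => (evalAt b lam).toLinearMap ∘ₗ LinearMap.proj w
  have hθ : ∀ m w, θ m w = evalAt b lam (m w) := fun _ _ => rfl
  let Θ : UniversalGaudin b hc h →ₗ[MvPolynomial (Fin r) k] FiberGaudin b hc h lam :=
    { toFun := θ
      map_add' := θ.map_add
      map_smul' := fun f m => gaudinHom_intertwine b hc h θ (fun y m => by
        funext w
        rw [hθ, gaudinOp_apply_apply, gaudinOp_apply_apply, map_add, map_mul, map_sum,
          linHom_apply, evalAt_linForm]
        simp [hθ]) f m }
  have hΘ : Function.Surjective Θ := fun m =>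
    ⟨(fun w => MvPolynomial.C (show k from m w) : W → MvPolynomial (Fin r) k), by
      funext w
      change evalAt b lam (MvPolynomial.C (m w)) = m w
      simp [evalAt]⟩
  refine (Submodule.quotEquivOfEq _ _ ?_).trans (Θ.quotKerEquivOfSurjective hΘ)
  ext m
  rw [LinearMap.mem_ker, GaudinModule.mem_ofIdeal]
  exact ⟨fun hm => funext hm, fun hm w => congrFun hm w⟩

/-- The Gaudin modules of the fibers over the points of an orbit are isomorphic. -/
def fiberGaudinActEquiv (lam : Dual k V) (g : W) :
    FiberGaudin b hc h (lam ∘ₗ g.1.toLinearMap) ≃ₗ[MvPolynomial (Fin r) k]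
      FiberGaudin b hc h lam where
  -- Right translation commutes with the reflections, which act from the left, and moves `λ` along
  -- its orbit in the diagonal part.
  toFun m := fun w : W => (show W → k from m) (w * g)
  invFun m := fun w : W => (show W → k from m) (w * g⁻¹)
  left_inv m := funext fun w : W => congrArg (show W → k from m) (inv_mul_cancel_right w g)
  right_inv m := funext fun w : W => congrArg (show W → k from m) (mul_inv_cancel_right w g)
  map_add' _ _ := rfl
  map_smul' f m := gaudinHom_intertwine b hc h (l := lam ∘ₗ g.1.toLinearMap) (l' := lam)
    (LinearMap.funLeft k k fun w : W => w * g)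
    (fun y m => by
      funext w
      rw [LinearMap.funLeft_apply, gaudinOp_apply_apply, gaudinOp_apply_apply]
      congr 1
      rw [LinearMap.funLeft_apply, mul_inv_rev]
      simp) f m

variable {P : Fin r → MvPolynomial (Fin r) k} (hP : ∀ j, P j ∈ invariants b W)

include hP in
-- For the universal `λ` the scalar `P_j(λ)` of `gaudinHom_hamiltonian` is the polynomial `P_j`
-- itself, so an equation in the Gaudin operators turns into a multiplication of coefficients.
theorem gaudinHom_hamiltonian_sub (lam : Dual k V) (j : Fin r) (m : W → MvPolynomial (Fin r) k) :
    gaudinHom b (linHom b) hc h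
      (hamiltonian b W c (P j) h - MvPolynomial.C (evalAt b lam (P j))) m =
      (P j - MvPolynomial.C (evalAt b lam (P j))) • m := by
  rw [map_sub, gaudinHom_hamiltonian b (linHom b) hc (hP j) h, ← MvPolynomial.algebraMap_eq,
    AlgHom.commutes, LinearMap.sub_apply, sub_smul]
  congr 1
  · rw [Module.algebraMap_end_apply]
    congr 1
    simp only [linHom_apply, linForm_basis]
    exact MvPolynomial.aeval_X_left_apply _
  · rw [Module.algebraMap_end_apply]
    funext w
    simp [Algebra.smul_def]

include hP in
/-- The equations act on the universal Gaudin module through the coefficients. -/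
theorem equationIdeal_smul_top (lam : Dual k V) :
    (equationIdeal b W c P h lam • ⊤ :
        Submodule (MvPolynomial (Fin r) k) (UniversalGaudin b hc h)) =
      GaudinModule.ofIdeal (gaudinHom b (linHom b) hc h)
        (Ideal.span (Set.range fun j => P j - MvPolynomial.C (evalAt b lam (P j)))) := by
  refine le_antisymm ?_ fun m hm => ?_
  · rw [equationIdeal, ← Set.image_univ, ← Submodule.span_univ, Ideal.span,
      Submodule.span_smul_span, Submodule.span_le]
    rintro _ ⟨_, ⟨j, _, rfl⟩, m, _, rfl⟩
    intro w
    have h1 := congrFun (gaudinHom_hamiltonian_sub b hc h hP lam j m) w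
    change gaudinHom b (linHom b) hc h _ m w ∈ _
    refine h1 ▸ ?_
    exact Ideal.mul_mem_right _ _ (Ideal.subset_span ⟨j, rfl⟩)
  · have h1 : ∀ w, ∃ a : Fin r → MvPolynomial (Fin r) k,
        ∑ j, a j * (P j - MvPolynomial.C (evalAt b lam (P j))) = m w :=
      fun w => (Submodule.mem_span_range_iff_exists_fun _).1 (hm w)
    choose a ha using h1
    have h2 : m = ∑ j, (hamiltonian b W c (P j) h - MvPolynomial.C (evalAt b lam (P j))) •
        (show UniversalGaudin b hc h from fun w => a w j) := by
      have h3 : ∀ j, (hamiltonian b W c (P j) h - MvPolynomial.C (evalAt b lam (P j))) •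
        (show UniversalGaudin b hc h from fun w => a w j) =
          (show UniversalGaudin b hc h from
            (P j - MvPolynomial.C (evalAt b lam (P j))) • fun w => a w j) :=
        fun j => gaudinHom_hamiltonian_sub b hc h hP lam j _
      rw [Finset.sum_congr rfl fun j _ => h3 j]
      funext w
      rw [← ha w]
      refine Eq.trans ?_ (Finset.sum_apply w _ (fun j => (P j - MvPolynomial.C (evalAt b lam (P j))) •
        (fun w => a w j : W → MvPolynomial (Fin r) k))).symm
      exact Finset.sum_congr rfl fun j _ => mul_comm _ _
    rw [h2]
    exact Submodule.sum_mem _ fun j _ => Submodule.smul_mem_smul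
      (Ideal.subset_span ⟨j, rfl⟩) trivial

end

variable [IsAlgClosed k] {P : Fin r → MvPolynomial (Fin r) k}
  (hP_gen : Algebra.adjoin k (Set.range P) = invariants b W)

include hP_gen

theorem finiteDimensional_quotient_generators (lam : Dual k V) :
    FiniteDimensional k (MvPolynomial (Fin r) k ⧸
      Ideal.span (Set.range fun j => P j - MvPolynomial.C (evalAt b lam (P j)))) := by
  -- The rank is `|W| > 0`, so it cannot be the default value `0` of `finrank`.
  refine FiniteDimensional.of_finrank_pos ?_
  rw [finrank_quotient_generators b hP_gen]
  exact Nat.card_pos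

/-- The maximal ideals over the fiber ideal are the points of the orbit of `λ`. Their Gaudin modules
are isomorphic, so the dévissage counts the same number `|W|` times. -/
theorem localDim_universalGaudin (lam μ : Dual k V) :
    localDim k (pointIdeal b μ) (UniversalGaudin b hc h ⧸
      GaudinModule.ofIdeal (gaudinHom b (linHom b) hc h)
        (Ideal.span (Set.range fun j => P j - MvPolynomial.C (evalAt b lam (P j))))) =
      Fintype.card W * localDim k (pointIdeal b μ) (FiberGaudin b hc h lam) := by
  refine GaudinModule.localDim_quotient_ofIdeal b _ μ _ _ _
    (finiteDimensional_quotient_generators b hP_gen lam) (fun q hq hle => ?_) ?_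
  · obtain ⟨ν, rfl⟩ := exists_eq_pointIdeal b hq
    refine ⟨?_, ?_⟩
    · have e := (Ideal.quotientKerAlgEquivOfSurjective (f := evalAt b ν)
        fun a => ⟨MvPolynomial.C a, by simp [evalAt]⟩).toLinearEquiv.finrank_eq
      rwa [finrank_self] at e
    · obtain ⟨g, rfl⟩ := exists_act_eq_of_generators b hP_gen (μ := ν) (ν := lam) fun j => by
        have h1 : evalAt b ν (P j - MvPolynomial.C (evalAt b lam (P j))) = 0 :=
          hle (Ideal.subset_span ⟨j, rfl⟩)
        rw [map_sub, sub_eq_zero] at h1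
        rw [h1]
        simp [evalAt]
      rw [localDim_congr _ (quotientPointEquiv b hc h _),
        localDim_congr _ (fiberGaudinActEquiv b hc h lam g)]
  · rw [finrank_quotient_generators b hP_gen, Nat.card_eq_fintype_card]

/-- The module `R / I` of the equations, `|W|` times. -/
def quotientEquationEquiv (lam : Dual k V) :
    (UniversalGaudin b hc h ⧸ GaudinModule.ofIdeal (gaudinHom b (linHom b) hc h)
        (Ideal.span (Set.range fun j => P j - MvPolynomial.C (evalAt b lam (P j)))))
      ≃ₗ[MvPolynomial (Fin r) k]
      (W → MvPolynomial (Fin r) k ⧸ equationIdeal b W c P h lam) :=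
  (Submodule.quotEquivOfEq _ _
    (equationIdeal_smul_top b hc h (generator_mem b hP_gen) lam).symm).trans <|
    (Submodule.Quotient.equiv (equationIdeal b W c P h lam • ⊤)
      (equationIdeal b W c P h lam • ⊤) (universalGaudinEquiv b hc h) (by
        rw [Submodule.map_smul'', Submodule.map_top, LinearEquiv.range])).symm.trans <|
      quotSMulTopPiEquiv W _

include hc in
theorem finiteDimensional_quotient_equation (lam : Dual k V) :
    FiniteDimensional k (MvPolynomial (Fin r) k ⧸ equationIdeal b W c P h lam) := by
  have := finiteDimensional_quotient_generators b hP_gen lam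
  have := GaudinModule.finiteDimensional_quotient (gaudinHom b (linHom b) hc h)
    (Ideal.span (Set.range fun j => P j - MvPolynomial.C (evalAt b lam (P j))))
  have h1 : FiniteDimensional k (W → MvPolynomial (Fin r) k ⧸ equationIdeal b W c P h lam) :=
    ((quotientEquationEquiv b hc h hP_gen lam).restrictScalars k).finiteDimensional
  exact Module.Finite.of_surjective (LinearMap.proj (1 : W) : (W → _) →ₗ[k] _)
    (LinearMap.proj_surjective _)

/-- The multiplicities of the joint spectrum are those of the solutions. -/
theorem spectralMult_eq_solutionMult (lam μ : Dual k V) :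
    spectralMult (mulOp b (FiberGaudin b hc h lam)) μ =
      solutionMult b (equationIdeal b W c P h lam) μ := by
  have := finiteDimensional_quotient_equation b hc h hP_gen lam
  have : FiniteDimensional k (FiberGaudin b hc h lam) :=
    inferInstanceAs (FiniteDimensional k (W → k))
  rw [← localDim_eq_spectralMult, solutionMult, ← localDim_quotient]
  have h1 := localDim_universalGaudin b hc h hP_gen lam μ
  rw [localDim_congr _ (quotientEquationEquiv b hc h hP_gen lam), localDim_pi _
    (finiteDimensional_localization b μ)] at h1
  -- Both sides count the local dimension of the same quotient of the universal module, each with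
  -- the factor `|W|`.
  exact (Nat.eq_of_mul_eq_mul_left Fintype.card_pos h1).symm

end Multiplicity

end

section

open scoped TensorProduct

/-! ### Transport of joint spectra along an isomorphism -/

section Conjugation

variable {k V E E' : Type*} [Field k] [AddCommGroup V] [Module k V] [AddCommGroup E] [Module k E]
  [AddCommGroup E'] [Module k E'] {G : V → End k E} {G' : V → End k E'} (e : E ≃ₗ[k] E')
  (he : ∀ y x, e (G y x) = G' y (e x))

include he

theorem isJointEigenvalue_congr (μ : Dual k V) :
    IsJointEigenvalue G μ ↔ IsJointEigenvalue G' μ := by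
  constructor
  · rintro ⟨x, hx, h⟩
    exact ⟨e x, by simpa using hx, fun y => by rw [← he, h, map_smul]⟩
  · rintro ⟨x, hx, h⟩
    refine ⟨e.symm x, by simpa using hx, fun y => e.injective ?_⟩
    rw [he, e.apply_symm_apply, h, map_smul, e.apply_symm_apply]

theorem spectralMult_congr (μ : Dual k V) : spectralMult G μ = spectralMult G' μ := by
  have h1 : ∀ y (n : ℕ) x, e (((G y - μ y • 1) ^ n) x) = ((G' y - μ y • 1) ^ n) (e x) := by
    intro y n
    induction n with
    | zero => intro x; rfl
    | succ n ih =>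
      intro x
      rw [pow_succ, pow_succ, Module.End.mul_apply, Module.End.mul_apply, ih]
      congr 1
      simp [he]
  have h2 : (⨅ y, (G y).maxGenEigenspace (μ y) : Submodule k E).map e.toLinearMap =
      (⨅ y, (G' y).maxGenEigenspace (μ y) : Submodule k E') := by
    ext x
    rw [Submodule.map_equiv_eq_comap_symm]
    simp only [Submodule.mem_comap, Submodule.mem_iInf, End.mem_maxGenEigenspace]
    refine forall_congr' fun y => exists_congr fun n => ?_
    rw [← e.map_eq_zero_iff, h1]
    simp
  rw [spectralMult, spectralMult, ← h2]
  exact (LinearEquiv.finrank_map_eq e _).symm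

end Conjugation

/-! ### Joint eigenvalues are the solutions -/

section Eigenvalues

variable {k V : Type*} [Field k] [AddCommGroup V] [Module k V] {r : ℕ}
  (b : Basis (Fin r) k V)

theorem smul_eq_evalAt_smul {M : Type*} [AddCommGroup M] [Module k M]
    [Module (MvPolynomial (Fin r) k) M] [IsScalarTower k (MvPolynomial (Fin r) k) M]
    {μ : Dual k V} {m : M} (hm : ∀ y, mulOp b M y m = μ y • m) (f : MvPolynomial (Fin r) k) :
    f • m = evalAt b μ f • m := by
  induction f using MvPolynomial.induction_on with
  | C a =>
    rw [← MvPolynomial.algebraMap_eq, algebraMap_smul, AlgHom.commutes]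
    rfl
  | add f g hf hg => rw [add_smul, hf, hg, map_add, add_smul]
  | mul_X f i hf =>
    have h1 := hm (b i)
    rw [mulOp_apply, linForm_basis] at h1
    rw [mul_smul, h1, smul_comm, hf, map_mul, mul_smul, smul_comm]
    simp [evalAt]

variable {W : Subgroup (V ≃ₗ[k] V)} [Fintype W] {c : W → k}
  (hc : ∀ g s : W, IsReflection s.1 → c (g * s * g⁻¹) = c s) (h : regularSet W)
  [IsAlgClosed k] {P : Fin r → MvPolynomial (Fin r) k}
  (hP_gen : Algebra.adjoin k (Set.range P) = invariants b W)

omit [IsAlgClosed k] in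
theorem mulOp_fiberGaudin [Infinite k] (lam : Dual k V) (y : V) :
    mulOp b (FiberGaudin b hc h lam) y = gaudinOp W lam c h.1 y := by
  refine LinearMap.ext fun m => ?_
  change gaudinHom b lam hc h (linForm b y) m = _
  rw [gaudinHom_linForm]
  rfl

/-- If the localization of `S𝔥/I` vanished, some `s` outside the ideal of `μ` would kill `1`, that
is, lie in `I`. -/
theorem solutionMult_pos {I : Ideal (MvPolynomial (Fin r) k)}
    (hI : FiniteDimensional k (MvPolynomial (Fin r) k ⧸ I)) {μ : Dual k V}
    (hle : I ≤ pointIdeal b μ) : 0 < solutionMult b I μ := by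
  rw [solutionMult, ← localDim_quotient]
  have := finiteDimensional_localization (M := MvPolynomial (Fin r) k ⧸ I) b μ
  rw [Nat.pos_iff_ne_zero]
  intro h0
  have hs := finrank_zero_iff.1 h0
  let j := TensorProduct.mk (MvPolynomial (Fin r) k) (Localization.AtPrime (pointIdeal b μ))
    (MvPolynomial (Fin r) k ⧸ I) 1
  obtain ⟨s, hs⟩ := IsLocalizedModule.exists_of_eq (S := (pointIdeal b μ).primeCompl) (f := j)
    (hs.elim (j (Ideal.Quotient.mk I 1)) (j 0))
  rw [smul_zero] at hs
  refine s.2 (hle ?_)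
  have h1 : Ideal.Quotient.mk I (s.1 * 1) = 0 := hs
  rwa [mul_one, Ideal.Quotient.eq_zero_iff_mem] at h1

include hP_gen

/-- The joint eigenvalues are the solutions of the equations. -/
theorem isJointEigenvalue_iff (lam μ : Dual k V) :
    IsJointEigenvalue (mulOp b (FiberGaudin b hc h lam)) μ ↔
      ∀ j, evalAt b lam (P j) = evalAt b μ (hamiltonian b W c (P j) h) := by
  constructor
  · rintro ⟨m, hm0, hm⟩ j
    have h1 := smul_eq_evalAt_smul b hm (hamiltonian b W c (P j) h)
    have h2 : hamiltonian b W c (P j) h • m = evalAt b lam (P j) • m := by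
      change gaudinHom b lam hc h _ m = _
      rw [gaudinHom_hamiltonian b lam hc (generator_mem b hP_gen j) h]
      rfl
    rw [h2] at h1
    exact smul_left_injective k hm0 h1
  · intro heq
    have hfin : FiniteDimensional k (FiberGaudin b hc h lam) :=
      inferInstanceAs (FiniteDimensional k (W → k))
    -- A solution has positive multiplicity, hence a nonzero generalized eigenspace, which contains
    -- an eigenvector.
    have h1 := solutionMult_pos b (finiteDimensional_quotient_equation b hc h hP_gen lam) (μ := μ)
      (Ideal.span_le.2 (by
        rintro _ ⟨j, rfl⟩
        change evalAt b μ _ = 0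
        rw [map_sub, ← heq j, sub_eq_zero]
        simp [evalAt]))
    rw [← spectralMult_eq_solutionMult b hc h hP_gen] at h1
    obtain ⟨m, hm, h2⟩ := exists_joint_eigenvector (M := FiberGaudin b hc h lam) b (μ := μ) (by
      intro h0
      have h3 : spectralMult (mulOp b (FiberGaudin b hc h lam)) μ =
        finrank k (jointEigenspace b (FiberGaudin b hc h lam) μ) := rfl
      rw [h3, h0] at h1
      exact h1.ne' (finrank_zero_of_subsingleton (R := k)
        (M := (⊥ : Submodule (MvPolynomial (Fin r) k) (FiberGaudin b hc h lam)))))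
    exact ⟨m, hm, h2⟩

end Eigenvalues

/-! ### Transfer of the results to `M(h,λ)` -/

section Fiber

variable {k V : Type*} [Field k] [IsAlgClosed k] [AddCommGroup V] [Module k V] {r : ℕ}
  (b : Basis (Fin r) k V) {W : Subgroup (V ≃ₗ[k] V)} [Fintype W] {c : W → k}
  (hc : ∀ g s : W, IsReflection s.1 → c (g * s * g⁻¹) = c s) (h : regularSet W) (lam : Dual k V)

theorem fiberEquiv_gaudin_mulOp (v : V) (x : Fiber W c h.1 lam) :
    (show FiberGaudin b hc h lam from fiberEquiv b hc lam h (gaudin W c h.1 lam v x)) =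
      mulOp b (FiberGaudin b hc h lam) v (fiberEquiv b hc lam h x) := by
  rw [mulOp_fiberGaudin]
  exact fiberEquiv_gaudin b hc lam h v x

include hc b in
theorem finrank_fiber : finrank k (Fiber W c h.1 lam) = Fintype.card W := by
  rw [(fiberEquiv b hc lam h).finrank_eq, finrank_fintype_fun_eq_card]

include hc b in
theorem gaudin_commute (u v : V) : Commute (gaudin W c h.1 lam u) (gaudin W c h.1 lam v) := by
  refine LinearMap.ext fun x => (fiberEquiv b hc lam h).injective ?_
  rw [Module.End.mul_apply, Module.End.mul_apply, fiberEquiv_gaudin, fiberEquiv_gaudin,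
    fiberEquiv_gaudin, fiberEquiv_gaudin]
  exact LinearMap.congr_fun (gaudinOp_commute lam hc b h.2 u v).eq _

theorem isJointEigenvalue_gaudin_iff (μ : Dual k V) :
    IsJointEigenvalue (gaudin W c h.1 lam) μ ↔
      IsJointEigenvalue (mulOp b (FiberGaudin b hc h lam)) μ :=
  isJointEigenvalue_congr (E' := FiberGaudin b hc h lam) (fiberEquiv b hc lam h)
    (fiberEquiv_gaudin_mulOp b hc h lam) μ

theorem spectralMult_gaudin (μ : Dual k V) :
    spectralMult (gaudin W c h.1 lam) μ = spectralMult (mulOp b (FiberGaudin b hc h lam)) μ :=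
  spectralMult_congr (E' := FiberGaudin b hc h lam) (fiberEquiv b hc lam h)
    (fiberEquiv_gaudin_mulOp b hc h lam) μ

end Fiber

end

section

/-! ### A discriminant detecting separable characteristic polynomials -/

section Discriminant

/-- A variant of the discriminant of the characteristic polynomial. -/
def charDisc {R n : Type*} [CommRing R] [Fintype n] [DecidableEq n] (A : Matrix n n R) : R :=
  (Polynomial.aeval A (Polynomial.derivative A.charpoly)).det

theorem map_charDisc {R S n : Type*} [CommRing R] [CommRing S] [Fintype n] [DecidableEq n]
    (f : R →+* S) (A : Matrix n n R) : f (charDisc A) = charDisc (A.map f) := by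
  rw [charDisc, charDisc, Matrix.charpoly_map, Polynomial.derivative_map, RingHom.map_det]
  congr 1
  refine Polynomial.map_aeval_eq_aeval_map ?_ _ _
  ext a i j
  simp [Matrix.algebraMap_matrix_apply, apply_ite f]

/-- A common root `a` of `χ_A` and `χ_A'` makes `A - a` a singular factor of `χ_A'(A)`. Conversely a
Bézout relation, with `χ_A(A) = 0`, inverts `χ_A'(A)`. -/
theorem charDisc_ne_zero_iff {k n : Type*} [Field k] [IsAlgClosed k] [Fintype n] [DecidableEq n]
    (A : Matrix n n k) : charDisc A ≠ 0 ↔ A.charpoly.Separable := by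
  constructor
  · intro h
    rw [Polynomial.Separable, Polynomial.isCoprime_iff_aeval_ne_zero_of_isAlgClosed (k := k) (K := k)]
    intro a
    by_contra! hcon
    obtain ⟨q, hq⟩ := Polynomial.dvd_iff_isRoot.2 (hcon.2 : (Polynomial.derivative A.charpoly).IsRoot a)
    refine h ?_
    have h1 : (Matrix.scalar n a - A).det = 0 := by
      rw [← Matrix.eval_charpoly]; exact hcon.1
    have h2 : A - algebraMap k _ a = -(Matrix.scalar n a - A) := by
      rw [neg_sub]; rfl
    rw [charDisc, hq, map_mul, map_sub, Polynomial.aeval_X, Polynomial.aeval_C, Matrix.det_mul, h2,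
      Matrix.det_neg, h1, mul_zero, zero_mul]
  · rintro ⟨p, q, hpq⟩
    have h1 := congrArg (Polynomial.aeval A) hpq
    rw [map_add, map_mul, map_mul, Matrix.aeval_self_charpoly, mul_zero, zero_add, map_one] at h1
    have h2 := congrArg Matrix.det h1
    rw [Matrix.det_mul, Matrix.det_one] at h2
    exact right_ne_zero_of_mul_eq_one h2

/-- Substituting `aX` in the characteristic polynomial of `aA` gives `aⁿ` times that of `A`. -/
theorem charpoly_separable_of_smul {k n : Type*} [Field k] [Fintype n] [DecidableEq n]
    {A : Matrix n n k} {a : k} (ha : a ≠ 0) (h : (a • A).charpoly.Separable) :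
    A.charpoly.Separable := by
  let φ : Polynomial k →+* Polynomial k := Polynomial.compRingHom (Polynomial.C a * Polynomial.X)
  have h1 : φ (a • A).charpoly = Polynomial.C (a ^ Fintype.card n) * A.charpoly := by
    rw [Matrix.charpoly, RingHom.map_det, Matrix.charpoly, map_pow, ← Matrix.det_smul]
    congr 1
    ext1 i j
    simp only [φ, RingHom.mapMatrix_apply, Matrix.map_apply, Matrix.charmatrix_apply,
      Polynomial.coe_compRingHom, Matrix.smul_apply, Matrix.diagonal_apply]
    split_ifs <;> simp [mul_sub]
  have h2 : (φ (a • A).charpoly).Separable := by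
    have h3 : IsCoprime (φ (a • A).charpoly) (φ (Polynomial.derivative (a • A).charpoly)) :=
      IsCoprime.map h φ
    have h4 : Polynomial.derivative (φ (a • A).charpoly) =
        Polynomial.C a * φ (Polynomial.derivative (a • A).charpoly) := by
      simp [φ, Polynomial.derivative_comp]
    unfold Polynomial.Separable
    rw [h4]
    exact (isCoprime_mul_unit_left_right
      (Polynomial.isUnit_C.2 (isUnit_iff_ne_zero.2 ha)) _ _).2 h3
  rw [h1] at h2
  exact h2.of_mul_right

end Discriminant

/-! ### Counting joint eigenvalues -/

section Count

variable {k V : Type*} [Field k] [IsAlgClosed k] [AddCommGroup V] [Module k V] {r : ℕ}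
  (b : Basis (Fin r) k V) {M : Type*} [AddCommGroup M] [Module k M]
  [Module (MvPolynomial (Fin r) k) M] [IsScalarTower k (MvPolynomial (Fin r) k) M]
  [FiniteDimensional k M]

omit [IsAlgClosed k] [FiniteDimensional k M] in
theorem mulOp_commute (y z : V) : Commute (mulOp b M y) (mulOp b M z) := by
  change mulOp b M y * mulOp b M z = mulOp b M z * mulOp b M y
  rw [mulOp, mulOp, ← map_mul, mul_comm, map_mul]

/-- The quotient by an associated prime embeds in `M`, so it is a finite-dimensional domain, hence a
field; the Nullstellensatz makes the prime the ideal of a point. -/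
theorem exists_joint_eigenvector_of_nontrivial [Nontrivial M] :
    ∃ (μ : Dual k V) (m : M), m ≠ 0 ∧ ∀ y, linForm b y • m = μ y • m := by
  by_contra! hcon
  obtain ⟨q, hq⟩ := associatedPrimes.nonempty (MvPolynomial (Fin r) k) M
  obtain ⟨hpr, m, hm⟩ := isAssociatedPrime_iff.mp (AssociatedPrimes.mem_iff.mp hq)
  have hqm : ∀ f : MvPolynomial (Fin r) k, f ∈ q ↔ f • m = 0 := fun f => by
    rw [hm, Submodule.mem_colon_singleton, Submodule.mem_bot]
  have hfin : FiniteDimensional k (MvPolynomial (Fin r) k ⧸ q) := by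
    let e := LinearMap.toSpanSingleton (MvPolynomial (Fin r) k) M m
    have he : q ≤ LinearMap.ker e := fun f hf => by simpa [e] using (hqm f).1 hf
    refine Module.Finite.of_injective ((Submodule.liftQ q e he).restrictScalars k) ?_
    refine (injective_iff_map_eq_zero _).2 fun x hx => ?_
    obtain ⟨f, rfl⟩ := Ideal.Quotient.mk_surjective x
    exact Ideal.Quotient.eq_zero_iff_mem.2 ((hqm f).2 hx)
  have hqm' : q.IsMaximal := by
    have : IsArtinianRing (MvPolynomial (Fin r) k ⧸ q) := IsArtinianRing.of_finite k _
    exact Ideal.Quotient.maximal_of_isField _ (IsArtinianRing.isField_of_isDomain _)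
  obtain ⟨μ, rfl⟩ := exists_eq_pointIdeal b hqm'
  obtain ⟨y, hy⟩ := hcon μ m (fun h0 => hpr.ne_top (by
    rw [Ideal.eq_top_iff_one, hqm, h0, smul_zero]))
  refine hy ?_
  have h1 := sub_C_mem_pointIdeal b μ (linForm b y)
  rw [hqm, sub_smul, sub_eq_zero, evalAt_linForm, ← MvPolynomial.algebraMap_eq,
    algebraMap_smul] at h1
  exact h1

omit [IsAlgClosed k] in
theorem jointEigenvalues_finite_ncard_le :
    {μ | IsJointEigenvalue (mulOp b M) μ}.Finite ∧
      {μ | IsJointEigenvalue (mulOp b M) μ}.ncard ≤ finrank k M := by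
  have hind := End.independent_iInf_maxGenEigenspace_of_forall_mapsTo (mulOp b M)
    (fun i j φ => End.mapsTo_maxGenEigenspace_of_comm (mulOp_commute b j i) φ)
  have := hind.fintypeNeBotOfFiniteDimensional
  let f : {μ | IsJointEigenvalue (mulOp b M) μ} →
      {χ : V → k // ⨅ i, (mulOp b M i).maxGenEigenspace (χ i) ≠ ⊥} := fun μ => ⟨⇑μ.1, by
    obtain ⟨m, hm, h⟩ := μ.2
    intro h0
    refine hm ((Submodule.mem_bot k).1 (h0 ▸ ?_))
    simp only [Submodule.mem_iInf, End.mem_maxGenEigenspace]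
    exact fun y => ⟨1, by simp [h y]⟩⟩
  have hf : Function.Injective f := fun μ ν h =>
    Subtype.ext (DFunLike.coe_injective (congrArg Subtype.val h))
  have hfin : Finite {μ | IsJointEigenvalue (mulOp b M) μ} := Finite.of_injective f hf
  refine ⟨hfin, ?_⟩
  have h1 := hind.subtype_ne_bot_le_finrank
  rw [← Nat.card_coe_set_eq]
  exact (Nat.card_le_card_of_injective f hf).trans (by rwa [Nat.card_eq_fintype_card])

/-- If one of the operators has simple spectrum, then so has the family. -/
theorem ncard_jointEigenvalues {y : V} (hy : (LinearMap.charpoly (mulOp b M y)).Separable) :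
    {μ | IsJointEigenvalue (mulOp b M) μ}.ncard = finrank k M := by
  obtain ⟨hfin, hle⟩ := jointEigenvalues_finite_ncard_le b (M := M)
  refine le_antisymm hle ?_
  have hcard : (LinearMap.charpoly (mulOp b M y)).roots.toFinset.card = finrank k M := by
    rw [Multiset.toFinset_card_of_nodup (Polynomial.nodup_roots hy),
      IsAlgClosed.card_roots_eq_natDegree, LinearMap.charpoly_natDegree]
  rw [← hcard, ← Set.ncard_coe_finset]
  -- Evaluation at `y` maps the joint eigenvalues onto the eigenvalues of the single operator `y`,
  -- of which there are `dim M`.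
  refine (Set.ncard_le_ncard ?_ (hfin.image fun μ : Dual k V => μ y)).trans
    (Set.ncard_image_le hfin)
  intro ν hν
  have hν' : End.HasEigenvalue (mulOp b M y) ν := by
    rw [End.hasEigenvalue_iff_isRoot_charpoly]
    exact (Polynomial.mem_roots'.1 (by simpa using hν)).2
  obtain ⟨v, hv⟩ := hν'.exists_hasEigenvector
  -- The eigenspace of `y` is stable under all the operators, so it contains a joint eigenvector.
  let N : Submodule (MvPolynomial (Fin r) k) M :=
    LinearMap.ker (LinearMap.lsmul (MvPolynomial (Fin r) k) M (linForm b y - MvPolynomial.C ν))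
  have hN : ∀ m, m ∈ N ↔ linForm b y • m = ν • m := fun m => by
    rw [LinearMap.mem_ker, LinearMap.lsmul_apply, sub_smul, sub_eq_zero,
      ← MvPolynomial.algebraMap_eq, algebraMap_smul]
  have : Nontrivial N := ⟨⟨v, (hN v).2 hv.apply_eq_smul⟩, 0, fun h => hv.2 (congrArg Subtype.val h)⟩
  have : FiniteDimensional k N :=
    Module.Finite.of_injective (N.subtype.restrictScalars k) Subtype.val_injective
  obtain ⟨μ, m, hm, h⟩ := exists_joint_eigenvector_of_nontrivial b (M := N)
  refine ⟨μ, ⟨m.1, by simpa using hm, fun z => congrArg Subtype.val (h z)⟩, ?_⟩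
  have h1 : μ y • m.1 = ν • m.1 := by
    rw [← (hN m.1).1 m.2]
    exact (congrArg Subtype.val (h y)).symm
  exact smul_left_injective k (by simpa using hm : m.1 ≠ 0) h1

end Count

end

section

/-! ### Generic simplicity of the spectrum -/

section GenericVectors

variable {k V : Type*} [Field k] [Infinite k] [AddCommGroup V] [Module k V]

/-- A vector with trivial stabilizer. -/
theorem exists_trivial_stabilizer (W : Subgroup (V ≃ₗ[k] V)) [Finite W] :
    ∃ y : V, ∀ w : W, w.1 y = y → w = 1 := by
  obtain ⟨y, hy⟩ := Submodule.exists_forall_notMem_of_forall_ne_top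
    (fun w : {w : W // w ≠ 1} => LinearMap.ker (w.1.1.toLinearMap - LinearMap.id)) (fun w h => by
      refine w.2 (Subtype.ext (LinearEquiv.ext fun y => ?_))
      have h1 : y ∈ LinearMap.ker (w.1.1.toLinearMap - LinearMap.id) := h ▸ Submodule.mem_top
      simpa [sub_eq_zero] using h1)
  refine ⟨y, fun w hw => ?_⟩
  by_contra h1
  refine hy ⟨w, h1⟩ ?_
  simpa [sub_eq_zero] using hw

omit [Infinite k] in
theorem mem_regularSet_of_trivial_stabilizer {W : Subgroup (V ≃ₗ[k] V)} {y : V}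
    (hy : ∀ w : W, w.1 y = y → w = 1) : y ∈ regularSet W := fun s hs h =>
  hs.1 (congrArg Subtype.val (hy s h))

/-- A linear form taking distinct values on a given regular orbit. -/
theorem exists_injective_on_orbit {W : Subgroup (V ≃ₗ[k] V)} [Finite W] {y : V}
    (hy : ∀ w : W, w.1 y = y → w = 1) :
    ∃ lam : Dual k V, Function.Injective fun w : W => lam (w⁻¹.1 y) := by
  obtain ⟨lam, hl⟩ := Module.exists_dual_forall_apply_ne_zero (K := k)
    (fun p : {p : W × W // p.1 ≠ p.2} => p.1.1⁻¹.1 y - p.1.2⁻¹.1 y) (fun p h => by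
      refine p.2 ?_
      have h1 : (p.1.2 * p.1.1⁻¹).1 y = y := by
        change p.1.2.1 (p.1.1⁻¹.1 y) = y
        rw [sub_eq_zero.1 h]
        change (p.1.2 * p.1.2⁻¹).1 y = y
        rw [mul_inv_cancel]
        rfl
      exact (mul_inv_eq_one.1 (hy _ h1)).symm)
  refine ⟨lam, fun w u h => ?_⟩
  by_contra hne
  refine hl ⟨(w, u), hne⟩ ?_
  rw [map_sub, sub_eq_zero]
  exact h

end GenericVectors

section Matrix

variable {k V : Type*} [Field k] [AddCommGroup V] [Module k V] (W : Subgroup (V ≃ₗ[k] V)) [Fintype W]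
  (c : W → k)

/-- The matrix of the Gaudin operator multiplied by the product of the roots, for a
linear map `l` and the values `α` of the roots in an arbitrary algebra. -/
def scaledGaudin {A : Type*} [CommRing A] [Algebra k A] (l : V → A) (α : W → A) (y : V) :
    Matrix W W A := fun w u =>
  (if w = u then (∏ s ∈ refls W, α s) * l (w⁻¹.1 y) else 0) +
    ∑ s ∈ refls W, if s * w = u then
      algebraMap k A (c s * root s.1 y) * ∏ t ∈ (refls W).erase s, α t else 0

theorem map_scaledGaudin {A B : Type*} [CommRing A] [Algebra k A] [CommRing B] [Algebra k B]
    (f : A →ₐ[k] B) (l : V → A) (α : W → A) (y : V) :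
    (scaledGaudin W c l α y).map f = scaledGaudin W c (f ∘ l) (f ∘ α) y := by
  ext w u
  simp [scaledGaudin, apply_ite f]

theorem scaledGaudin_eq_smul (lam : Dual k V) {h : V} (hh : h ∈ regularSet W) (y : V) :
    scaledGaudin W c lam (fun s => root s.1 h) y =
      (∏ s ∈ refls W, root s.1 h) • LinearMap.toMatrix' (gaudinOp W lam c h y) := by
  ext w u
  rw [Matrix.smul_apply, LinearMap.toMatrix'_apply, gaudinOp_apply_apply, scaledGaudin, smul_add]
  congr 1
  · by_cases hwu : w = u <;> simp [hwu]
  · rw [Finset.smul_sum]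
    refine Finset.sum_congr rfl fun s hs => ?_
    by_cases hwu : s * w = u
    · have h1 := root_ne_zero W hh s ((mem_refls W).1 hs)
      rw [← Finset.mul_prod_erase _ _ hs]
      simp [hwu, rho]
      field_simp
    · simp [hwu]

/-- Scaling `λ` scales only the diagonal part, so the pole part can be treated as a perturbation. -/
theorem toMatrix_gaudinOp_smul (a : k) (lam : Dual k V) (h y : V) :
    LinearMap.toMatrix' (gaudinOp W (a • lam) c h y) =
      a • Matrix.diagonal (fun w : W => lam (w⁻¹.1 y)) +
        LinearMap.toMatrix' (gaudinPole W c k h y) := by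
  rw [gaudinOp_apply, map_add]
  congr 1
  ext w u
  rw [LinearMap.toMatrix'_apply, gaudinDiag_apply]
  by_cases hwu : w = u <;> simp [hwu]

end Matrix

/-- A perturbation of a diagonal matrix with distinct entries has separable characteristic
polynomial, for some nonzero value of the parameter. -/
theorem exists_charpoly_separable {k n : Type*} [Field k] [IsAlgClosed k] [Fintype n] [DecidableEq n]
    {d : n → k} (hd : Function.Injective d) (N : Matrix n n k) :
    ∃ a : k, a ≠ 0 ∧ (a • Matrix.diagonal d + N).charpoly.Separable := by
  -- The discriminant of `d + XN` is a polynomial in `X`, nonzero at `X = 0`. It is therefore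
  -- nonzero at some `x ≠ 0`, and `a = x⁻¹` rescales `d + xN` into `ad + N`.
  let B : Matrix n n (Polynomial k) :=
    (Matrix.diagonal d).map Polynomial.C + (Polynomial.X : Polynomial k) • N.map Polynomial.C
  have hB : ∀ x : k, B.map (Polynomial.evalRingHom x) = Matrix.diagonal d + x • N := fun x => by
    ext i j
    rcases eq_or_ne i j with rfl | hij
    · simp [B]; ring
    · simp [B, hij]; ring
  have hB' : ∀ x : k, (charDisc B).eval x = charDisc (Matrix.diagonal d + x • N) := fun x => by
    rw [← hB, ← map_charDisc]; rfl
  have h0 : (charDisc B).eval 0 ≠ 0 := by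
    rw [hB', zero_smul, add_zero, charDisc_ne_zero_iff, Matrix.charpoly_diagonal]
    exact Polynomial.separable_prod_X_sub_C_iff.2 hd
  have h1 : Polynomial.X * charDisc B ≠ 0 :=
    mul_ne_zero Polynomial.X_ne_zero (fun h => h0 (by rw [h, Polynomial.eval_zero]))
  obtain ⟨x, hx⟩ : ∃ x, (Polynomial.X * charDisc B).eval x ≠ 0 := by
    by_contra! h
    exact h1 (Polynomial.funext fun x => by rw [h x, Polynomial.eval_zero])
  rw [Polynomial.eval_mul, Polynomial.eval_X] at hx
  have hx0 := left_ne_zero_of_mul hx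
  have hx1 := right_ne_zero_of_mul hx
  rw [hB', charDisc_ne_zero_iff] at hx1
  refine ⟨x⁻¹, inv_ne_zero hx0, charpoly_separable_of_smul hx0 ?_⟩
  rwa [smul_add, smul_smul, mul_inv_cancel₀ hx0, one_smul]

section Generic

variable {k V : Type*} [Field k] [IsAlgClosed k] [AddCommGroup V] [Module k V] {r : ℕ}
  (b : Basis (Fin r) k V) {W : Subgroup (V ≃ₗ[k] V)} [Fintype W] {c : W → k}

/-- The universal case of `scaledGaudin`, with entries in `k[𝔥 × 𝔥*]`. -/
def genericGaudin (W : Subgroup (V ≃ₗ[k] V)) [Fintype W] (c : W → k) (y : V) :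
    Matrix W W (MvPolynomial (Fin r ⊕ Fin r) k) :=
  scaledGaudin W c (fun v => ∑ i, MvPolynomial.C (b.repr v i) * MvPolynomial.X (Sum.inr i))
    (fun s => ∑ i, MvPolynomial.C (root s.1 (b i)) * MvPolynomial.X (Sum.inl i)) y

omit [IsAlgClosed k] in
theorem eval_charDisc_genericGaudin (y : V) (h : V) (lam : Dual k V) :
    MvPolynomial.eval (Sum.elim (fun i => b.repr h i) (fun i => lam (b i)))
        (charDisc (genericGaudin b W c y)) =
      charDisc (scaledGaudin W c lam (fun s => root s.1 h) y) := by
  have h1 : ∀ l : Dual k V, ∀ v, ∑ i, b.repr v i * l (b i) = l v := fun l v => by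
    conv_rhs => rw [← b.sum_repr v, map_sum]
    simp only [map_smul, smul_eq_mul]
  rw [← MvPolynomial.coe_aeval_eq_eval, map_charDisc]
  congr 1
  refine (map_scaledGaudin W c (MvPolynomial.aeval _) _ _ y).trans ?_
  congr 1
  · funext v
    simp [h1]
  · funext s
    simp [mul_comm, ← h1 (root s.1) h]

theorem exists_generic (hc : ∀ g s : W, IsReflection s.1 → c (g * s * g⁻¹) = c s) :
    ∃ F : MvPolynomial (Fin r ⊕ Fin r) k, F ≠ 0 ∧
      ∀ (h : regularSet W) (lam : Dual k V),
        MvPolynomial.eval (Sum.elim (fun i => b.repr h.1 i) (fun i => lam (b i))) F ≠ 0 →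
        {μ | IsJointEigenvalue (gaudin W c h.1 lam) μ}.ncard = Fintype.card W := by
  have : Infinite k := IsAlgClosed.instInfinite
  obtain ⟨y, hy⟩ := exists_trivial_stabilizer W
  -- The denominators are cleared so that the discriminant is a polynomial on `𝔥 × 𝔥*`. It is tested
  -- at the base point `h = y` itself and at a multiple of a form separating the orbit of `y`.
  refine ⟨charDisc (genericGaudin b W c y), ?_, fun h lam hF => ?_⟩
  · have hreg := mem_regularSet_of_trivial_stabilizer hy
    obtain ⟨lam, hlam⟩ := exists_injective_on_orbit hy
    obtain ⟨a, -, ha⟩ := exists_charpoly_separable hlam (LinearMap.toMatrix' (gaudinPole W c k y y))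
    rw [← toMatrix_gaudinOp_smul] at ha
    have hδ : ∏ s ∈ refls W, root s.1 y ≠ 0 :=
      Finset.prod_ne_zero_iff.2 fun s hs => root_ne_zero W hreg s ((mem_refls W).1 hs)
    intro h0
    have h1 := eval_charDisc_genericGaudin b (W := W) (c := c) y y (a • lam)
    rw [h0, map_zero, scaledGaudin_eq_smul W c _ hreg] at h1
    refine (charDisc_ne_zero_iff _).2 ?_ h1.symm
    refine charpoly_separable_of_smul (inv_ne_zero hδ) ?_
    rwa [smul_smul, inv_mul_cancel₀ hδ, one_smul]
  · rw [eval_charDisc_genericGaudin, charDisc_ne_zero_iff, scaledGaudin_eq_smul W c _ h.2] at hF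
    have hδ : ∏ s ∈ refls W, root s.1 h.1 ≠ 0 :=
      Finset.prod_ne_zero_iff.2 fun s hs => root_ne_zero W h.2 s ((mem_refls W).1 hs)
    have h1 := charpoly_separable_of_smul hδ hF
    have hfin : FiniteDimensional k (FiberGaudin b hc h lam) :=
      inferInstanceAs (FiniteDimensional k (W → k))
    have h2 : (LinearMap.charpoly (mulOp b (FiberGaudin b hc h lam) y)).Separable := by
      rw [mulOp_fiberGaudin]
      rwa [← Matrix.charpoly_toLin', Matrix.toLin'_toMatrix'] at h1
    have h3 := ncard_jointEigenvalues b h2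
    rw [show finrank k (FiberGaudin b hc h lam) = Fintype.card W from
      finrank_fintype_fun_eq_card k] at h3
    rw [← h3]
    congr 1
    ext μ
    exact isJointEigenvalue_gaudin_iff b hc h lam μ

end Generic

end

section

/-! ### Leading terms of Jacobians -/

section DegreeMul

open scoped Pointwise

variable {k : Type*} [Field k] {r : ℕ}

theorem mem_degreeLT_of_isHomogeneous {f : MvPolynomial (Fin r) k} {n : ℕ}
    (hf : f.IsHomogeneous n) : f ∈ degreeLT k r (n + 1) := fun m hm => by
  have : n = m.degree := hf.degree_eq_sum_deg_support (s := m) hm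
  change m.degree < n + 1
  omega

theorem mul_mem_degreeLT {m n : ℕ} {f g : MvPolynomial (Fin r) k} (hf : f ∈ degreeLT k r m)
    (hg : g ∈ degreeLT k r (n + 1)) : f * g ∈ degreeLT k r (m + n) := fun x hx => by
  have hx : x ∈ f.support + g.support := MvPolynomial.support_mul f g hx
  obtain ⟨y, hy, z, hz, rfl⟩ := Finset.mem_add.1 hx
  have h1 : y.degree < m := hf hy
  have h2 : z.degree < n + 1 := hg hz
  change (y + z).degree < m + n
  rw [map_add]
  omega

theorem pderiv_mem_degreeLT {n : ℕ} {f : MvPolynomial (Fin r) k} (hf : f ∈ degreeLT k r (n + 1))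
    (i : Fin r) : MvPolynomial.pderiv i f ∈ degreeLT k r n := by
  have h1 : degreeLT k r (n + 1) ≤ (degreeLT k r n).comap (MvPolynomial.pderiv i).toLinearMap := by
    refine degreeLT_le fun m hm => ?_
    change MvPolynomial.pderiv i (MvPolynomial.monomial m (1 : k)) ∈ degreeLT k r n
    rw [MvPolynomial.pderiv_monomial]
    by_cases hi : m i = 0
    · simp [hi]
    · refine monomial_mem_degreeLT ?_ _
      have := congrArg Finsupp.degree
        (tsub_add_cancel_of_le (Finsupp.single_le_iff.2 (Nat.one_le_iff_ne_zero.2 hi)))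
      rw [map_add, Finsupp.degree_single] at this
      omega
  exact h1 hf

theorem prod_add_sub_prod_mem_degreeLT {ι : Type*} (s : Finset ι) (e : ι → ℕ)
    {A E : ι → MvPolynomial (Fin r) k} (hA : ∀ j, (A j).IsHomogeneous (e j))
    (hE : ∀ j, E j ∈ degreeLT k r (e j)) :
    ∏ j ∈ s, (A j + E j) - ∏ j ∈ s, A j ∈ degreeLT k r (∑ j ∈ s, e j) := by
  induction s using Finset.induction_on with
  | empty => simp
  | insert a s ha ih =>
    rw [Finset.prod_insert ha, Finset.prod_insert ha, Finset.sum_insert ha]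
    have h1 : (A a + E a) * ∏ j ∈ s, (A j + E j) - A a * ∏ j ∈ s, A j =
      E a * ((∏ j ∈ s, (A j + E j) - ∏ j ∈ s, A j) + ∏ j ∈ s, A j) +
        (∏ j ∈ s, (A j + E j) - ∏ j ∈ s, A j) * A a := by ring
    rw [h1]
    refine Submodule.add_mem _ (mul_mem_degreeLT (hE a) (Submodule.add_mem _
      (degreeLT_mono (Nat.le_succ _) ih)
      (mem_degreeLT_of_isHomogeneous (MvPolynomial.IsHomogeneous.prod s _ _ fun j _ => hA j)))) ?_
    rw [add_comm (e a)]
    exact mul_mem_degreeLT ih (mem_degreeLT_of_isHomogeneous (hA a))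

/-- The Jacobian determinant of `r` polynomials in `r` variables. -/
def jacobian (f : Fin r → MvPolynomial (Fin r) k) : MvPolynomial (Fin r) k :=
  (Matrix.of fun i j => MvPolynomial.pderiv i (f j)).det

variable {f g : Fin r → MvPolynomial (Fin r) k} {e : Fin r → ℕ}

theorem jacobian_isHomogeneous (hf : ∀ j, (f j).IsHomogeneous (e j + 1)) :
    (jacobian f).IsHomogeneous (∑ j, e j) := by
  rw [jacobian, Matrix.det_apply]
  refine MvPolynomial.IsHomogeneous.sum _ _ _ fun σ _ => ?_
  have h1 : (∏ j, MvPolynomial.pderiv (σ j) (f j)).IsHomogeneous (∑ j, e j) :=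
    MvPolynomial.IsHomogeneous.prod _ _ _ fun j _ => (hf j).pderiv
  rcases Int.units_eq_one_or (Equiv.Perm.sign σ) with h | h
  · rw [h, one_smul]; exact h1
  · rw [h, Units.neg_smul, one_smul]; exact h1.neg

/-- Here `e j` is the degree of `f j` minus one, the degree left after differentiation.
Perturbations below the leading terms change the determinant only below degree `∑ e j`. -/
theorem jacobian_sub_mem_degreeLT (hf : ∀ j, (f j).IsHomogeneous (e j + 1))
    (hg : ∀ j, g j - f j ∈ degreeLT k r (e j + 1)) :
    jacobian g - jacobian f ∈ degreeLT k r (∑ j, e j) := by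
  rw [jacobian, jacobian, Matrix.det_apply, Matrix.det_apply, ← Finset.sum_sub_distrib]
  refine Submodule.sum_mem _ fun σ _ => ?_
  have h1 := prod_add_sub_prod_mem_degreeLT Finset.univ e
    (A := fun j => MvPolynomial.pderiv (σ j) (f j))
    (E := fun j => MvPolynomial.pderiv (σ j) (g j - f j)) (fun j => (hf j).pderiv)
    (fun j => pderiv_mem_degreeLT (hg j) _)
  simp only [map_sub, add_sub_cancel] at h1
  rcases Int.units_eq_one_or (Equiv.Perm.sign σ) with h | h
  · rw [h, one_smul, one_smul]; exact h1
  · rw [h, Units.neg_smul, one_smul, Units.neg_smul, one_smul, ← neg_sub']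
    exact Submodule.neg_mem _ h1

end DegreeMul

/-! ### Tangent vectors and multiple solutions -/

section Tangent

variable {k V : Type*} [Field k] [AddCommGroup V] [Module k V] {r : ℕ} (b : Basis (Fin r) k V)
  (μ : Dual k V) (v : Fin r → k)

/-- The first order Taylor expansion of polynomials at `μ` in the direction `v`. -/
def tangentHom : MvPolynomial (Fin r) k →ₐ[k] DualNumber k :=
  MvPolynomial.aeval fun i => TrivSqZeroExt.inl (μ (b i)) + TrivSqZeroExt.inr (v i)

theorem fst_tangentHom (f : MvPolynomial (Fin r) k) :
    (tangentHom b μ v f).fst = evalAt b μ f := by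
  have h1 : (TrivSqZeroExt.fstHom k k k).comp (tangentHom b μ v) = evalAt b μ := by
    ext i; simp [tangentHom, evalAt]
  exact DFunLike.congr_fun h1 f

theorem snd_tangentHom (f : MvPolynomial (Fin r) k) :
    (tangentHom b μ v f).snd = ∑ i, v i * evalAt b μ (MvPolynomial.pderiv i f) := by
  induction f using MvPolynomial.induction_on with
  | C a =>
    rw [← MvPolynomial.algebraMap_eq, AlgHom.commutes]
    simp [TrivSqZeroExt.algebraMap_eq_inl]
  | add p q hp hq =>
    rw [map_add, TrivSqZeroExt.snd_add, hp, hq, ← Finset.sum_add_distrib]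
    simp only [map_add, mul_add]
  | mul_X p j hp =>
    rw [map_mul, TrivSqZeroExt.snd_mul, hp, fst_tangentHom, fst_tangentHom]
    have h1 : (tangentHom b μ v (MvPolynomial.X j)).snd = v j := by simp [tangentHom]
    rw [h1]
    simp only [Derivation.leibniz, MvPolynomial.pderiv_X, map_add, smul_eq_mul, map_mul, mul_add,
      Finset.sum_add_distrib, Pi.single_apply]
    simp [apply_ite, evalAt, Finset.mul_sum, mul_left_comm, mul_comm]

variable {b μ}

variable [IsAlgClosed k]

/-- A nonzero tangent vector to the scheme of solutions maps its local algebra onto the dual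
numbers, of dimension `2`. -/
theorem two_le_solutionMult_of_tangent {I : Ideal (MvPolynomial (Fin r) k)}
    (hI : FiniteDimensional k (MvPolynomial (Fin r) k ⧸ I)) (hv : v ≠ 0)
    (h : ∀ f ∈ I, tangentHom b μ v f = 0) : 2 ≤ solutionMult b I μ := by
  let L := Localization.AtPrime (pointIdeal b μ)
  let φ : L →+* DualNumber k := IsLocalization.lift (M := (pointIdeal b μ).primeCompl)
    (g := (tangentHom b μ v).toRingHom) fun s => by
      rw [TrivSqZeroExt.isUnit_iff_isUnit_fst, isUnit_iff_ne_zero]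
      exact fun h0 => s.2 ((fst_tangentHom b μ v s.1).symm.trans h0)
  have hφ : ∀ f, φ (algebraMap _ L f) = tangentHom b μ v f := fun f => IsLocalization.lift_eq _ f
  let J := I.map (algebraMap (MvPolynomial (Fin r) k) L)
  have hJ : ∀ x ∈ J, φ x = 0 := by
    have : J ≤ RingHom.ker φ := Ideal.map_le_iff_le_comap.2 fun f hf => by
      rw [Ideal.mem_comap, RingHom.mem_ker, hφ, h f hf]
    exact this
  let ψ : L ⧸ J →+* DualNumber k := Ideal.Quotient.lift J φ hJ
  have hψk : ∀ a : k, ψ (algebraMap k _ a) = algebraMap k _ a := fun a => by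
    have h1 : algebraMap k (L ⧸ J) a =
        Ideal.Quotient.mk J (algebraMap _ L (algebraMap k (MvPolynomial (Fin r) k) a)) := rfl
    rw [h1, Ideal.Quotient.lift_mk, hφ, AlgHom.commutes]
  let Ψ : (L ⧸ J) →ₐ[k] DualNumber k := { ψ with commutes' := hψk }
  have hΨ : Function.Surjective Ψ := by
    obtain ⟨i, hi⟩ := Function.ne_iff.1 hv
    have h1 : Ψ (Ideal.Quotient.mk J (algebraMap _ L
        (MvPolynomial.X i - MvPolynomial.C (μ (b i))))) = TrivSqZeroExt.inr (v i) := by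
      change φ _ = _
      rw [hφ]
      ext
      · rw [fst_tangentHom]; simp [evalAt]
      · rw [snd_tangentHom]; simp [Pi.single_apply, apply_ite]
    intro x
    refine ⟨algebraMap k _ x.fst + (x.snd / v i) • Ideal.Quotient.mk J (algebraMap _ L
        (MvPolynomial.X i - MvPolynomial.C (μ (b i)))), ?_⟩
    rw [map_add, map_smul, h1, AlgHom.commutes]
    ext
    · simp [TrivSqZeroExt.algebraMap_eq_inl]
    · simp [TrivSqZeroExt.algebraMap_eq_inl, div_mul_cancel₀ _ hi]
  -- Without finiteness `finrank` could be `0` and the surjection would give no bound.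
  have hfin : FiniteDimensional k (L ⧸ J) := by
    have := finiteDimensional_localization (M := MvPolynomial (Fin r) k ⧸ I) b μ
    exact (localizationQuotientEquiv k (pointIdeal b μ) I).finiteDimensional
  have h2 := LinearMap.finrank_le_finrank_of_surjective (f := Ψ.toLinearMap) hΨ
  have h3 : finrank k (DualNumber k) = 2 := by
    exact (finrank_prod (R := k) (M := k) (M' := k)).trans (by rw [finrank_self])
  rwa [h3] at h2

/-- A solution at which the Jacobian vanishes is not simple. -/
theorem two_le_solutionMult {f : Fin r → MvPolynomial (Fin r) k}
    (hI : FiniteDimensional k (MvPolynomial (Fin r) k ⧸ Ideal.span (Set.range f)))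
    (hf : ∀ j, evalAt b μ (f j) = 0) (hjac : evalAt b μ (jacobian f) = 0) :
    2 ≤ solutionMult b (Ideal.span (Set.range f)) μ := by
  have h1 : (Matrix.of fun i j => evalAt b μ (MvPolynomial.pderiv i (f j))).det = 0 := by
    rw [← hjac, jacobian, AlgHom.map_det]; rfl
  obtain ⟨v, hv, h2⟩ := Matrix.exists_vecMul_eq_zero_iff.2 h1
  refine two_le_solutionMult_of_tangent v hI hv fun p hp => ?_
  have h3 : Ideal.span (Set.range f) ≤ RingHom.ker (tangentHom b μ v) := by
    refine Ideal.span_le.2 ?_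
    rintro _ ⟨j, rfl⟩
    change tangentHom b μ v (f j) = 0
    ext
    · rw [fst_tangentHom, hf]; rfl
    · rw [snd_tangentHom]; exact congrFun h2 j
  exact h3 hp

end Tangent

end

section

/-! ### Leading terms of the hamiltonians -/

section LeadingTerm

variable {k V : Type*} [Field k] [Infinite k] [AddCommGroup V] [Module k V] {r : ℕ}
  (b : Basis (Fin r) k V) {W : Subgroup (V ≃ₗ[k] V)} [Fintype W] {c : W → k}
  (hc : ∀ g s : W, IsReflection s.1 → c (g * s * g⁻¹) = c s)

omit [Infinite k] in
theorem theta_phaseCovRep_apply (y : V) (F : PhaseFun r W) (h : regularSet W) :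
    (phaseCovRep b W).theta c y F h = linForm b y * F h -
      ∑ s ∈ refls W, (c s * rho s.1 y h.1) •
        polyAct b s.1 (F ⟨s⁻¹.1 h.1, regularSet_act W h.2 s⁻¹⟩) := by
  rw [← dunkl_eq_theta, dunkl, LinearMap.sub_apply, Pi.sub_apply, LinearMap.sum_apply,
    Finset.sum_apply]
  congr 1
  refine Finset.sum_congr rfl fun s _ => ?_
  rw [mul_smul, MvPolynomial.smul_eq_C_mul _ (rho s.1 y h.1)]
  rfl

include hc

theorem hamiltonian_add (f g : MvPolynomial (Fin r) k) :
    hamiltonian b W c (f + g) = hamiltonian b W c f + hamiltonian b W c g := by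
  rw [hamiltonian_eq_thetaHom hc, hamiltonian_eq_thetaHom hc, hamiltonian_eq_thetaHom hc, map_add]
  rfl

theorem hamiltonian_smul (a : k) (f : MvPolynomial (Fin r) k) :
    hamiltonian b W c (a • f) = a • hamiltonian b W c f := by
  rw [hamiltonian_eq_thetaHom hc, hamiltonian_eq_thetaHom hc, map_smul]
  rfl

/-- The Hamiltonian attached to a homogeneous polynomial has it as its leading term. -/
theorem hamiltonian_sub_mem_degreeLT {f : MvPolynomial (Fin r) k} {n : ℕ} (hf : f.IsHomogeneous n)
    (h : regularSet W) : hamiltonian b W c f h - f ∈ degreeLT k r n := by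
  -- All base points are treated at once, because the reflections in a Dunkl operator move `h`.
  have hmon : ∀ m : Fin r →₀ ℕ, ∀ h : regularSet W,
      hamiltonian b W c (MvPolynomial.monomial m 1) h - MvPolynomial.monomial m 1 ∈
        degreeLT k r m.degree := by
    refine monomial_degree_induction (Q := fun n f => ∀ h : regularSet W,
      hamiltonian b W c f h - f ∈ degreeLT k r n) (fun h => ?_) fun n i f hf ih h => ?_
    · rw [hamiltonian_eq_thetaHom hc, map_one ((phaseCovRep b W).thetaHom hc), Module.End.one_apply, Pi.one_apply, sub_self]
      exact Submodule.zero_mem _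
    · rw [hamiltonian_eq_thetaHom hc, map_mul, Module.End.mul_apply, ← hamiltonian_eq_thetaHom hc,
        CovRep.thetaHom_X, theta_phaseCovRep_apply, linForm_basis, sub_right_comm, ← mul_sub]
      refine Submodule.sub_mem _ ?_ (Submodule.sum_mem _ fun s _ => Submodule.smul_mem _ _
        (polyAct_mem_degreeLT b _ ?_))
      · rw [← linForm_basis b]
        exact linForm_mul_mem_degreeLT b (ih h) _
      · have := Submodule.add_mem _ (degreeLT_mono (Nat.le_succ n) (ih ⟨_, regularSet_act W h.2 s⁻¹⟩)) hf
        rwa [sub_add_cancel] at this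
  let S : Submodule k (MvPolynomial (Fin r) k) :=
    { carrier := {f | hamiltonian b W c f h - f ∈ degreeLT k r n}
      zero_mem' := by
        have h1 := hamiltonian_smul b hc 0 (0 : MvPolynomial (Fin r) k)
        rw [zero_smul, zero_smul] at h1
        rw [Set.mem_ofPred_eq, h1]
        simp
      add_mem' := fun {f g} hf hg => by
        rw [Set.mem_ofPred_eq, hamiltonian_add b hc, Pi.add_apply, add_sub_add_comm]
        exact Submodule.add_mem _ hf hg
      smul_mem' := fun a f hf => by
        rw [Set.mem_ofPred_eq, hamiltonian_smul b hc, Pi.smul_apply, ← smul_sub]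
        exact Submodule.smul_mem _ _ hf }
  have h1 : f ∈ S := by
    rw [f.as_sum]
    refine S.sum_mem fun m hm => ?_
    have h2 : MvPolynomial.monomial m (1 : k) ∈ S := by
      change _ ∈ degreeLT k r n
      rw [hf.degree_eq_sum_deg_support (s := m) hm]
      exact hmon m h
    have := S.smul_mem (f.coeff m) h2
    rwa [MvPolynomial.smul_monomial, smul_eq_mul, mul_one] at this
  exact h1

end LeadingTerm

/-! ### The case `c = 0` -/

section Decoupled

variable {k V : Type*} [Field k] [Infinite k] [AddCommGroup V] [Module k V] {r : ℕ}
  (b : Basis (Fin r) k V) {W : Subgroup (V ≃ₗ[k] V)} [Fintype W]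

theorem hamiltonian_zero (f : MvPolynomial (Fin r) k) (h : regularSet W) :
    hamiltonian b W 0 f h = f := by
  have hc : ∀ g s : W, IsReflection s.1 → (0 : W → k) (g * s * g⁻¹) = (0 : W → k) s :=
    fun _ _ _ => rfl
  rw [hamiltonian_eq_thetaHom hc]
  suffices ∀ F : PhaseFun r W, (phaseCovRep b W).thetaHom hc f F h = f * F h by
    rw [this]; exact mul_one f
  induction f using MvPolynomial.induction_on with
  | C a =>
    intro F
    rw [← MvPolynomial.algebraMap_eq, AlgHom.commutes, ← Algebra.smul_def]
    rfl
  | add p q hp hq =>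
    intro F
    rw [map_add, LinearMap.add_apply, Pi.add_apply, hp, hq, add_mul]
  | mul_X p i hp =>
    intro F
    rw [map_mul, Module.End.mul_apply, hp, CovRep.thetaHom_X, theta_phaseCovRep_apply]
    simp [linForm_basis, mul_assoc]

-- For `c = 0` the operator of `y` is diagonal with distinct entries, so the generalized eigenspace
-- of `λ` lies on the line of `δ₁`.
omit [Infinite k] in
theorem spectralMult_gaudinOp_zero_le {y : V} {lam : Dual k V}
    (h1 : Function.Injective fun w : W => lam (w⁻¹.1 y)) (h : V) :
    spectralMult (fun z => gaudinOp W lam 0 h z) lam ≤ 1 := by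
  have h2 : ∀ (n : ℕ) (f : W → k) (w : W),
      ((gaudinOp W lam 0 h y - lam y • (1 : End k (W → k))) ^ n) f w =
        (lam (w⁻¹.1 y) - lam y) ^ n * f w := by
    intro n
    induction n with
    | zero => intro f w; simp
    | succ n ih =>
      intro f w
      rw [pow_succ, Module.End.mul_apply, ih, pow_succ, mul_assoc]
      congr 1
      rw [LinearMap.sub_apply, Pi.sub_apply, gaudinOp_apply_apply]
      simp [sub_mul]
  refine (Submodule.finrank_mono (t := Submodule.span k {Pi.single (1 : W) (1 : k)}) ?_).trans
    (finrank_span_le_card _ |>.trans (by simp))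
  intro f hf
  obtain ⟨n, hn⟩ := (End.mem_maxGenEigenspace _ _ _).1 ((Submodule.mem_iInf _).1 hf y)
  refine Submodule.mem_span_singleton.2 ⟨f 1, ?_⟩
  funext w
  by_cases hw : w = 1
  · subst hw; simp
  · have h3 := congrFun hn w
    rw [h2, Pi.zero_apply, mul_eq_zero] at h3
    rw [Pi.smul_apply, Pi.single_eq_of_ne hw, smul_zero]
    refine (h3.resolve_left fun h4 => hw (h1 ?_)).symm
    have h5 := sub_eq_zero.1 (eq_zero_of_pow_eq_zero h4)
    change lam (w⁻¹.1 y) = lam ((1 : W)⁻¹.1 y)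
    rw [h5, inv_one]
    rfl

end Decoupled

/-! ### Existence of multiple solutions -/

section Coalescence

variable {k V : Type*} [Field k] [IsAlgClosed k] [AddCommGroup V] [Module k V] {r : ℕ}
  (b : Basis (Fin r) k V) {W : Subgroup (V ≃ₗ[k] V)} [Fintype W]
  {P : Fin r → MvPolynomial (Fin r) k}
  (hP_gen : Algebra.adjoin k (Set.range P) = invariants b W)

include hP_gen

/-- The proof goes through the case `c = 0` and works in every characteristic. If the Jacobian were
zero, `λ` would be a multiple solution of `P_j(μ) = P_j(λ)`, while for suitable `λ` the decoupled
Gaudin operators have simple spectrum there. -/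
theorem jacobian_generators_ne_zero : jacobian P ≠ 0 := by
  have : Infinite k := IsAlgClosed.instInfinite
  obtain ⟨y, hy⟩ := exists_trivial_stabilizer W
  obtain ⟨lam, hlam⟩ := exists_injective_on_orbit hy
  let h : regularSet W := ⟨y, mem_regularSet_of_trivial_stabilizer hy⟩
  have hc : ∀ g s : W, IsReflection s.1 → (0 : W → k) (g * s * g⁻¹) = (0 : W → k) s :=
    fun _ _ _ => rfl
  intro h0
  have h1 := finiteDimensional_quotient_equation b hc h hP_gen lam
  have h2 := spectralMult_eq_solutionMult b hc h hP_gen lam lam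
  have h3 : equationIdeal b W 0 P h lam =
      Ideal.span (Set.range fun j => P j - MvPolynomial.C (evalAt b lam (P j))) := by
    simp only [equationIdeal, hamiltonian_zero]
  rw [h3] at h1 h2
  have h4 : jacobian (fun j => P j - MvPolynomial.C (evalAt b lam (P j))) = jacobian P := by
    simp [jacobian]
  have h5 := two_le_solutionMult (b := b) (μ := lam) h1 (fun j => by simp [evalAt])
    (by rw [h4, h0, map_zero])
  rw [← h2] at h5
  have h6 : (fun z => mulOp b (FiberGaudin b hc h lam) z) = fun z => gaudinOp W lam 0 h.1 z := by
    funext z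
    exact mulOp_fiberGaudin b hc h lam z
  have h7 := spectralMult_gaudinOp_zero_le hlam h.1
  rw [← h6] at h7
  exact absurd (h5.trans h7) (by norm_num)

/-- The generators take arbitrary values. -/
theorem exists_evalAt_generators (hP_ind : AlgebraicIndependent k P) (a : Fin r → k) :
    ∃ lam, ∀ j, evalAt b lam (P j) = a j := by
  let e : MvPolynomial (Fin r) k ≃ₐ[k] invariants b W :=
    hP_ind.aevalEquiv.trans (Subalgebra.equivOfEq _ _ hP_gen)
  -- By algebraic independence the prescribed values define a character of the invariants;
  -- integrality lifts its kernel to a point of `𝔥*`.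
  let ψ : invariants b W →ₐ[k] k := (MvPolynomial.aeval a).comp e.symm.toAlgHom
  have he : ∀ j, (e (MvPolynomial.X j) : MvPolynomial (Fin r) k) = P j := fun j => by
    change ((hP_ind.aevalEquiv (MvPolynomial.X j) : Algebra.adjoin k (Set.range P)) :
      MvPolynomial (Fin r) k) = P j
    refine (hP_ind.algebraMap_aevalEquiv _).trans ?_
    simp
  have hψ : ∀ j, ψ (e (MvPolynomial.X j)) = a j := fun j => by simp [ψ]
  have hm : (RingHom.ker ψ).IsMaximal :=
    RingHom.ker_isMaximal_of_surjective ψ fun x => ⟨algebraMap k _ x, ψ.commutes x⟩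
  obtain ⟨lam, hlam⟩ := exists_pointIdeal_comap b W hm
  refine ⟨lam, fun j => ?_⟩
  have h1 : e (MvPolynomial.X j) - algebraMap k _ (a j) ∈ RingHom.ker ψ := by
    rw [RingHom.mem_ker, map_sub, hψ, AlgHom.commutes]; exact sub_self _
  rw [← hlam, Ideal.mem_comap, map_sub] at h1
  have h2 : evalAt b lam (P j - MvPolynomial.C (a j)) = 0 := by
    rw [← he]; exact h1
  rw [map_sub, sub_eq_zero] at h2
  rw [h2]
  simp [evalAt]

-- For linear invariants `P_j(gμ - μ) = 0 = P_j(0)`. The generators separate orbits and the orbit of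
-- `0` is a point, so `g` fixes every `μ`.
omit [IsAlgClosed k] in
theorem eq_bot_of_generators_linear (hlin : ∀ j, (P j).IsHomogeneous 1) : W = ⊥ := by
  have hadd : ∀ j (μ ν : Dual k V),
      evalAt b (μ - ν) (P j) = evalAt b μ (P j) - evalAt b ν (P j) := fun j μ ν => by
    have h1 := hlin j
    rw [← MvPolynomial.mem_homogeneousSubmodule, MvPolynomial.homogeneousSubmodule_one_eq_span_X] at h1
    refine Submodule.span_induction (p := fun f _ =>
      evalAt b (μ - ν) f = evalAt b μ f - evalAt b ν f) ?_ ?_ ?_ ?_ h1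
    · rintro _ ⟨i, rfl⟩; simp [evalAt]
    · simp
    · intro f g _ _ hf hg
      rw [map_add, map_add, map_add, hf, hg]; ring
    · intro a f _ hf
      rw [map_smul, map_smul, map_smul, hf, smul_sub]
  refine (Subgroup.eq_bot_iff_forall _).2 fun g hg => ?_
  have h1 : ∀ μ : Dual k V, μ ∘ₗ g.toLinearMap - μ = 0 := fun μ => by
    obtain ⟨w, hw⟩ := exists_act_eq_of_generators b hP_gen (μ := μ ∘ₗ g.toLinearMap - μ) (ν := 0)
      fun j => by
        rw [hadd, ← evalAt_polyAct, (mem_invariants b).1 (generator_mem b hP_gen j) ⟨g, hg⟩, sub_self]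
        have := hadd j 0 0
        rwa [sub_self, sub_self, eq_comm] at this
    rw [hw, LinearMap.zero_comp]
  refine LinearEquiv.ext fun y => ?_
  refine (Module.forall_dual_apply_eq_zero_iff k _).1 ?_ |> sub_eq_zero.1
  intro μ
  have := LinearMap.congr_fun (h1 μ) y
  rw [map_sub]
  exact this

/-- Unless `W` is trivial, for some values of the parameters there is a multiple solution. -/
theorem exists_two_le_solutionMult {c : W → k}
    (hc : ∀ g s : W, IsReflection s.1 → c (g * s * g⁻¹) = c s)
    (hP_hom : ∀ j, ∃ d, (P j).IsHomogeneous d) (hP_ind : AlgebraicIndependent k P) (hW : W ≠ ⊥) :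
    ∃ (h : regularSet W) (lam μ : Dual k V), 2 ≤ solutionMult b (equationIdeal b W c P h lam) μ := by
  have : Infinite k := IsAlgClosed.instInfinite
  obtain ⟨y, hy⟩ := exists_trivial_stabilizer W
  let h : regularSet W := ⟨y, mem_regularSet_of_trivial_stabilizer hy⟩
  choose d hd using hP_hom
  -- A generator of degree `0` would be a constant, contradicting algebraic independence.
  have hd0 : ∀ j, d j ≠ 0 := fun j h0 => by
    have h1 := hd j
    rw [h0, ← MvPolynomial.totalDegree_zero_iff_isHomogeneous,
      MvPolynomial.totalDegree_eq_zero_iff_eq_C] at h1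
    refine (hP_ind.transcendental j) ?_
    rw [h1]
    exact isAlgebraic_algebraMap _
  let e : Fin r → ℕ := fun j => d j - 1
  have hde : ∀ j, d j = e j + 1 := fun j => (Nat.succ_pred_eq_of_ne_zero (hd0 j)).symm
  let H : Fin r → MvPolynomial (Fin r) k := fun j => hamiltonian b W c (P j) h
  have hsub : jacobian H - jacobian P ∈ degreeLT k r (∑ j, e j) :=
    jacobian_sub_mem_degreeLT (fun j => hde j ▸ hd j)
      fun j => hde j ▸ hamiltonian_sub_mem_degreeLT b hc (hd j) h
  by_cases hzero : ∃ μ, evalAt b μ (jacobian H) = 0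
  · obtain ⟨μ, hμ⟩ := hzero
    obtain ⟨lam, hlam⟩ := exists_evalAt_generators b hP_gen hP_ind fun j => evalAt b μ (H j)
    refine ⟨h, lam, μ, two_le_solutionMult (finiteDimensional_quotient_equation b hc h hP_gen lam)
      (fun j => ?_) ?_⟩
    · rw [map_sub, hlam]
      simp [evalAt, H]
    · rw [← hμ]
      simp [jacobian, H]
  · exfalso
    push Not at hzero
    -- By the Nullstellensatz a polynomial without zeros is a unit, hence a constant.
    have hunit : IsUnit (jacobian H) := by
      by_contra h1
      obtain ⟨m, hm, hmem⟩ := exists_max_ideal_of_mem_nonunits h1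
      obtain ⟨μ, rfl⟩ := exists_eq_pointIdeal b hm
      exact hzero μ hmem
    have hconst : (jacobian H).IsHomogeneous 0 := by
      obtain ⟨a, -, ha⟩ := MvPolynomial.isUnit_iff_eq_C_of_isReduced.1 hunit
      rw [ha]
      exact MvPolynomial.isHomogeneous_C _ _
    have hJ := jacobian_isHomogeneous (fun j => hde j ▸ hd j)
    have hJ0 := jacobian_generators_ne_zero b hP_gen
    have hN : ∑ j, e j = 0 := by
      by_contra hN
      -- If `∑ e j > 0`, both the constant `jacobian H` and its difference from `jacobian P` have
      -- degree below `∑ e j`, so the nonzero form `jacobian P` of degree `∑ e j` would too.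
      have h1 : jacobian P ∈ degreeLT k r (∑ j, e j) := by
        have := Submodule.sub_mem _ (degreeLT_mono (Nat.one_le_iff_ne_zero.2 hN)
          (mem_degreeLT_of_isHomogeneous hconst)) hsub
        rwa [sub_sub_cancel] at this
      obtain ⟨m, hm⟩ := MvPolynomial.support_nonempty.2 hJ0
      have h2 : m.degree < ∑ j, e j := h1 hm
      exact h2.ne (hJ.degree_eq_sum_deg_support (s := m) hm).symm
    refine hW (eq_bot_of_generators_linear b hP_gen fun j => ?_)
    have h1 : e j = 0 := (Finset.sum_eq_zero_iff.1 hN) j (Finset.mem_univ j)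
    have h2 := hd j
    rwa [hde, h1] at h2

end Coalescence

end

end Gaudin

end

theorem proposition4p5 {k V : Type*} [Field k] [IsAlgClosed k] [AddCommGroup V] [Module k V]
    {r : ℕ} (b : Module.Basis (Fin r) k V)
    (W : Subgroup (V ≃ₗ[k] V)) [Fintype W]
    (hW : Subgroup.closure {g | g ∈ W ∧ Gaudin.IsReflection g} = W)
    (c : W → k) (hc : ∀ g s : W, Gaudin.IsReflection s.1 → c (g * s * g⁻¹) = c s)
    (P : Fin r → MvPolynomial (Fin r) k)
    (hP_hom : ∀ j, ∃ d, (P j).IsHomogeneous d)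
    (hP_ind : AlgebraicIndependent k P)
    (hP_gen : Algebra.adjoin k (Set.range P) = Gaudin.invariants b W) :
    (∀ (h : Gaudin.regularSet W) (lam : Module.Dual k V),
      -- `M(h,λ)` has dimension `|W|` and the Gaudin operators on it commute
      Module.finrank k (Gaudin.Fiber W c h.1 lam) = Fintype.card W ∧
      (∀ u v : V, Commute (Gaudin.gaudin W c h.1 lam u) (Gaudin.gaudin W c h.1 lam v)) ∧
      -- the joint eigenvalues are the solutions
      (∀ μ : Module.Dual k V, Gaudin.IsJointEigenvalue (Gaudin.gaudin W c h.1 lam) μ ↔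
        ∀ j, Gaudin.evalAt b lam (P j) =
          Gaudin.evalAt b μ (Gaudin.hamiltonian b W c (P j) h)) ∧
      -- with the same multiplicities
      (∀ μ : Module.Dual k V, Gaudin.spectralMult (Gaudin.gaudin W c h.1 lam) μ =
        Gaudin.solutionMult b (Gaudin.equationIdeal b W c P h lam) μ)) ∧
    -- for generic `(h,λ)` there are `|W|` distinct joint eigenvalues
    (∃ F : MvPolynomial (Fin r ⊕ Fin r) k, F ≠ 0 ∧
      ∀ (h : Gaudin.regularSet W) (lam : Module.Dual k V),
        MvPolynomial.eval (Sum.elim (fun i => b.repr h.1 i) (fun i => lam (b i))) F ≠ 0 →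
        {μ | Gaudin.IsJointEigenvalue (Gaudin.gaudin W c h.1 lam) μ}.ncard = Fintype.card W) ∧
    -- for special `(h,λ)` some of the solutions coalesce (unless `W` is trivial)
    (W ≠ ⊥ → ∃ (h : Gaudin.regularSet W) (lam μ : Module.Dual k V),
      2 ≤ Gaudin.solutionMult b (Gaudin.equationIdeal b W c P h lam) μ) := by
  classical
  refine ⟨fun h lam => ⟨Gaudin.finrank_fiber b hc h lam, Gaudin.gaudin_commute b hc h lam,
    fun μ => ?_, fun μ => ?_⟩, ?_, ?_⟩
  · rw [Gaudin.isJointEigenvalue_gaudin_iff b hc]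
    exact Gaudin.isJointEigenvalue_iff b hc h hP_gen lam μ
  · rw [Gaudin.spectralMult_gaudin b hc]
    exact Gaudin.spectralMult_eq_solutionMult b hc h hP_gen lam μ
  · exact Gaudin.exists_generic b hc
  · exact Gaudin.exists_two_le_solutionMult b hP_gen hc hP_hom hP_ind
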